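/- **Theorem (Linearization Principle).** Let $E\to M$ be a smooth real vector bundle of finite rank over a smooth (Hausdorff, finite-dimensional) manifold. An *almost Loday algebroid* structure on $E$ is an $\mathbb R$-bilinear bracket $\mathfrak a=[\cdot,\cdot]$ on $\Gamma(E)$ with smooth bundle maps $\rho:E\to TM$ (anchor) and $\lambda:T^*M\otimes E\otimes E\to E$ (co-anchor), over the identity of $M$, such that for all $\alpha,\beta\in\Gamma(E)$, $f\in C^\infty(M)$ $$[\alpha,f\beta]=f[\alpha,\beta]+(\rho(\alpha)f)\beta,\qquad [f\alpha,\beta]=f[\alpha,\beta]-(\rho(\beta)f)\alpha+\lambda(df\otimes\alpha\otimes\beta).$$ It is a *Loday algebroid* if $[[\alpha,\beta],\gamma]+[\beta,[\alpha,\gamma]]-[\alpha,[\beta,\gamma]]=0$ for all $\alpha,\beta,\gamma$. Let $(E,\mathfrak a,\rho,\lambda)$ be a Loday algebroid and $p\in M$ a *singular point*: $\rho_p=0$ and $\lambda_p=0$. *Linearization.* In local coordinates $(x_k)$ centred at $p$ and a local frame $(e_i)$ near $p$ write $[e_i,e_j]=\sum_k\Gamma_{ij}^k e_k$, $\rho(e_i)=\sum_j\theta_{ij}\,\partial/\partial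 x_j$, $\lambda(dx_i\otimes e_j\otimes e_k)=\sum_l\lambda_{ijk}^l e_l$. The linearization of $\mathfrak a$ at $p$ is the bracket on the sections of the trivial bundle $T_pM\times E_p\to T_pM$ that satisfies the two Leibniz rules above, has $[e_i,e_j]=\sum_k\Gamma_{ij}^k(p)e_k$ on the constant sections $e_i=(e_i)_p$, and has anchor and co-anchor at $x=\sum_k x_k\,\partial/\partial x_k|_p\in T_pM$ given by $$\rho^L(e_i)=\sum_{j,k}\frac{\partial\theta_{ij}}{\partial x_k}(p)\,x_k\frac{\partial}{\partial x_j},\qquad \lambda^L(dx_i\otimes e_j\otimes e_k)=\sum_{l,m}\frac{\partial\lambda_{ijk}^l}{\partial x_m}(p)\,x_m\,e_l .$$ The algebroid is *linearizable around $p$* if there is a smooth vector bundle isomorphism, carrying bracket to bracket, from the restriction of $E$ to an open neighbourhood of $p$ onto the restriction of $T_pM\times E_p$ to an open neighbourhood of $0\in T_pM$, covering a diffeomorphism that takes $p$ to $0$. *Euler-like derivations.* A derivation of $E$ is an $\mathbb R$-linear map $D:\Gamma(E)\to\Gamma(E)$ with a smooth vector field $X$ (its symbol) such that $D(f\alpha)=fD\alpha+(Xf)\alpha$.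 It is *Euler-like at $p$* if $X(p)=0$, the linearization $T_pM\to T_pM$ of $X$ at $p$ is the identity, and the induced endomorphism $D^L:E_p\to E_p$, $\alpha(p)\mapsto (D\alpha)(p)$, is zero. **Claim.** $(E,\mathfrak a,\rho,\lambda)$ is linearizable around the singular point $p$ if and only if there is a derivation $D$ of $E$, Euler-like at $p$, whose flow acts by local automorphisms of $\mathfrak a$ near $p$, i.e. such that on some open neighbourhood $U$ of $p$ the Lie derivative $$(\mathcal L_D\mathfrak a)(\alpha,\beta)=[D\alpha,\beta]+[\alpha,D\beta]-D[\alpha,\beta]$$ vanishes for all $\alpha,\beta\in\Gamma(E)$. -/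

import Mathlib

open Bundle Filter Topology
open scoped Manifold ContDiff

set_option linter.unusedSectionVars false

noncomputable section

namespace Loday

/-! ### Smooth vector bundles, functions and sections

`M` is a smooth manifold modelled on the finite-dimensional real vector space `H`, and `V → M` is a
smooth vector bundle of finite rank with model fibre `F`. -/

section Bundles

variable (H : Type*) [NormedAddCommGroup H] [NormedSpace ℝ H]
  {M : Type*} [TopologicalSpace M] [ChartedSpace H M]
  (F : Type*) [NormedAddCommGroup F] [NormedSpace ℝ F]
  (V : M → Type*) [TopologicalSpace (TotalSpace F V)]
  [∀ x, TopologicalSpace (V x)] [FiberBundle F V]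

/-- The space `Γ(V)` of global smooth sections of `V`. -/
abbrev Sec : Type _ := Cₛ^∞⟮𝓘(ℝ, H); F, V⟯

variable {H F V}

/-- The differential `df_x : T_x M → ℝ` of a smooth function. -/
def d (f : C^∞⟮𝓘(ℝ, H), M; ℝ⟯) (x : M) : TangentSpace 𝓘(ℝ, H) x →L[ℝ] ℝ :=
  (NormedSpace.fromTangentSpace (f x)).toContinuousLinearMap ∘L
    mfderiv 𝓘(ℝ, H) 𝓘(ℝ, ℝ) f x

/-- The product `f α` of a smooth function and a smooth section. -/
def fsmul [∀ x, AddCommGroup (V x)] [∀ x, Module ℝ (V x)] [VectorBundle ℝ F V]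
    (f : C^∞⟮𝓘(ℝ, H), M; ℝ⟯) (α : Sec H F V) : Sec H F V :=
  ⟨fun x => f x • α x, f.contMDiff.smul_section α.contMDiff⟩

end Bundles

/-! ### Almost Loday algebroids -/

section Algebroids

variable (H : Type*) [NormedAddCommGroup H] [NormedSpace ℝ H]
  {M : Type*} [TopologicalSpace M] [ChartedSpace H M] [IsManifold 𝓘(ℝ, H) ∞ M]
  (F : Type*) [NormedAddCommGroup F] [NormedSpace ℝ F]
  (V : M → Type*) [TopologicalSpace (TotalSpace F V)]
  [∀ x, AddCommGroup (V x)] [∀ x, Module ℝ (V x)]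
  [∀ x, TopologicalSpace (V x)] [FiberBundle F V] [VectorBundle ℝ F V]

/-- An almost Loday algebroid structure on the vector bundle `V → M`: an `ℝ`-bilinear bracket on
`Γ(V)` with an anchor `ρ : V → TM` and a co-anchor `λ : T^*M ⊗ V ⊗ V → V` (smooth bundle maps over
the identity) satisfying the two Leibniz rules. -/
structure AlmostLodayAlgebroid where
  bracket : Sec H F V →ₗ[ℝ] Sec H F V →ₗ[ℝ] Sec H F V
  anchor : ∀ x : M, V x →ₗ[ℝ] TangentSpace 𝓘(ℝ, H) x
  anchor_smooth : ContMDiff (𝓘(ℝ, H).prod 𝓘(ℝ, F)) 𝓘(ℝ, H).tangent ∞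
    (fun v : TotalSpace F V => (⟨v.proj, anchor v.proj v.snd⟩ : TangentBundle 𝓘(ℝ, H) M))
  coanchor : ∀ x : M,
    (TangentSpace 𝓘(ℝ, H) x →L[ℝ] ℝ) →ₗ[ℝ] V x →ₗ[ℝ] V x →ₗ[ℝ] V x
  /-- Smoothness of the bundle map `λ`: as `T^*M` is locally spanned by exact forms, it means that
  `λ(df ⊗ α ⊗ β)` is smooth for all smooth `f`, `α`, `β`. -/
  coanchor_smooth : ∀ (f : C^∞⟮𝓘(ℝ, H), M; ℝ⟯) (α β : Sec H F V),
    ContMDiff 𝓘(ℝ, H) (𝓘(ℝ, H).prod 𝓘(ℝ, F)) ∞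
      (fun x => (⟨x, coanchor x (d f x) (α x) (β x)⟩ : TotalSpace F V))
  /-- `[α, f β] = f [α, β] + (ρ(α) f) β` -/
  leibniz_right : ∀ (f : C^∞⟮𝓘(ℝ, H), M; ℝ⟯) (α β : Sec H F V) (x : M),
    bracket α (fsmul f β) x = f x • bracket α β x + d f x (anchor x (α x)) • β x
  /-- `[f α, β] = f [α, β] - (ρ(β) f) α + λ(df ⊗ α ⊗ β)` -/
  leibniz_left : ∀ (f : C^∞⟮𝓘(ℝ, H), M; ℝ⟯) (α β : Sec H F V) (x : M),
    bracket (fsmul f α) β x = f x • bracket α β x - d f x (anchor x (β x)) • α x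
      + coanchor x (d f x) (α x) (β x)

/-- A derivation `(D, X)` of the `C^∞(M)`-module `Γ(V)`, with symbol the smooth vector field `X`:
`D (f α) = f D α + (X f) α`. -/
structure Der where
  toLin : Sec H F V →ₗ[ℝ] Sec H F V
  symbol : ∀ x : M, TangentSpace 𝓘(ℝ, H) x
  symbol_smooth : ContMDiff 𝓘(ℝ, H) 𝓘(ℝ, H).tangent ∞
    (fun x => (⟨x, symbol x⟩ : TangentBundle 𝓘(ℝ, H) M))
  leibniz : ∀ (f : C^∞⟮𝓘(ℝ, H), M; ℝ⟯) (α : Sec H F V) (x : M),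
    toLin (fsmul f α) x = f x • toLin α x + d f x (symbol x) • α x

variable {H F V}

/-- The Jacobiator `[[α, β], γ] + [β, [α, γ]] - [α, [β, γ]]`. -/
def AlmostLodayAlgebroid.jacobiator (A : AlmostLodayAlgebroid H F V) (α β γ : Sec H F V) :
    Sec H F V :=
  A.bracket (A.bracket α β) γ + A.bracket β (A.bracket α γ) - A.bracket α (A.bracket β γ)

/-- An almost Loday algebroid is a Loday algebroid if its Jacobiator vanishes. -/
def AlmostLodayAlgebroid.IsLoday (A : AlmostLodayAlgebroid H F V) : Prop :=
  ∀ α β γ : Sec H F V, A.jacobiator α β γ = 0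

/-- `p` is a singular point if the anchor and the co-anchor vanish at `p`. -/
def AlmostLodayAlgebroid.IsSingularAt (A : AlmostLodayAlgebroid H F V) (p : M) : Prop :=
  A.anchor p = 0 ∧ A.coanchor p = 0

/-- The Lie derivative of the bracket along a derivation,
`(L_D 𝔞)(α, β) = [D α, β] + [α, D β] - D [α, β]`. -/
def AlmostLodayAlgebroid.lieDeriv (A : AlmostLodayAlgebroid H F V) (D : Der H F V)
    (α β : Sec H F V) : Sec H F V :=
  A.bracket (D.toLin α) β + A.bracket α (D.toLin β) - D.toLin (A.bracket α β)

end Algebroids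

/-! ### Local isomorphisms -/

section LocalIso

variable {H : Type*} [NormedAddCommGroup H] [NormedSpace ℝ H]
  {M : Type*} [TopologicalSpace M] [ChartedSpace H M] [IsManifold 𝓘(ℝ, H) ∞ M]
  {F : Type*} [NormedAddCommGroup F] [NormedSpace ℝ F]
  {V : M → Type*} [TopologicalSpace (TotalSpace F V)]
  [∀ x, AddCommGroup (V x)] [∀ x, Module ℝ (V x)]
  [∀ x, TopologicalSpace (V x)] [FiberBundle F V] [VectorBundle ℝ F V]
  {H' : Type*} [NormedAddCommGroup H'] [NormedSpace ℝ H']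
  {M' : Type*} [TopologicalSpace M'] [ChartedSpace H' M'] [IsManifold 𝓘(ℝ, H') ∞ M']
  {F' : Type*} [NormedAddCommGroup F'] [NormedSpace ℝ F']
  {V' : M' → Type*} [TopologicalSpace (TotalSpace F' V')]
  [∀ x, AddCommGroup (V' x)] [∀ x, Module ℝ (V' x)]
  [∀ x, TopologicalSpace (V' x)] [FiberBundle F' V'] [VectorBundle ℝ F' V']

/-- `A` near `p` is isomorphic to `B` near `q`: there are a diffeomorphism `φ` from an open
neighbourhood `U` of `p` onto an open neighbourhood of `q` with `φ p = q` and a smooth vector bundle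
isomorphism `Φ` covering `φ` which carries the bracket of `A` to the bracket of `B`.

Brackets are local operators, so the last condition is expressed with germs: at each `x ∈ U`, if
`α, β` are carried by `Φ` to `α', β'` near `x`, then `[α, β]_A` is carried to `[α', β']_B` at `x`.
The anchor and the co-anchor are determined by the bracket, hence are preserved too. -/
def LocallyIsomorphic (A : AlmostLodayAlgebroid H F V) (p : M)
    (B : AlmostLodayAlgebroid H' F' V') (q : M') : Prop :=
  ∃ (φ : OpenPartialHomeomorph M M') (Φ : ∀ x : M, V x →ₗ[ℝ] V' (φ x)),
    p ∈ φ.source ∧ φ p = q ∧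
    ContMDiffOn 𝓘(ℝ, H) 𝓘(ℝ, H') ∞ φ φ.source ∧
    ContMDiffOn 𝓘(ℝ, H') 𝓘(ℝ, H) ∞ φ.symm φ.target ∧
    (∀ x ∈ φ.source, Function.Bijective (Φ x)) ∧
    ContMDiffOn (𝓘(ℝ, H).prod 𝓘(ℝ, F)) (𝓘(ℝ, H').prod 𝓘(ℝ, F')) ∞
      (fun v : TotalSpace F V => (⟨φ v.proj, Φ v.proj v.snd⟩ : TotalSpace F' V'))
      (TotalSpace.proj ⁻¹' φ.source) ∧
    ∀ x ∈ φ.source, ∀ (α β : Sec H F V) (α' β' : Sec H' F' V'),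
      (∀ᶠ y in 𝓝 x, Φ y (α y) = α' (φ y)) → (∀ᶠ y in 𝓝 x, Φ y (β y) = β' (φ y)) →
      Φ x (A.bracket α β x) = B.bracket α' β' (φ x)

end LocalIso

/-! ### The almost Loday algebroid given by linear data

For linear maps `a : F ⊗ F → F`, `r : F → End H`, `l : H^* ⊗ F ⊗ F → Hom(H, F)`, the bracket on the
sections of the trivial bundle `H × F → H` that restricts to `a` on constant sections and is
extended by the Leibniz rules with anchor `(x, u) ↦ r(u) x` and co-anchor
`(x, ξ ⊗ u ⊗ v) ↦ l(ξ ⊗ u ⊗ v) x`. -/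

section Model

variable {H : Type*} [NormedAddCommGroup H] [NormedSpace ℝ H]
  {F : Type*} [NormedAddCommGroup F] [NormedSpace ℝ F]

/-- A smooth section of the trivial bundle `H × F → H`, as a function `H → F`. -/
def fn (α : Sec H F (Trivial H F)) (x : H) : F := α x

lemma contMDiff_trivial_iff (s : H → F) :
    ContMDiff 𝓘(ℝ, H) (𝓘(ℝ, H).prod 𝓘(ℝ, F)) ∞
      (fun x => (⟨x, s x⟩ : TotalSpace F (Trivial H F))) ↔ ContDiff ℝ ∞ s := by
  rw [← contMDiff_iff_contDiff]
  refine forall_congr' fun x => ?_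
  rw [contMDiffAt_section]
  rfl

lemma contDiff_fn (α : Sec H F (Trivial H F)) : ContDiff ℝ ∞ (fn α) :=
  (contMDiff_trivial_iff (fn α)).1 α.contMDiff

/-- A smooth function `H → F` as a section of the trivial bundle. -/
def ofFn (s : H → F) (hs : ContDiff ℝ ∞ s) : Sec H F (Trivial H F) :=
  ⟨s, (contMDiff_trivial_iff s).2 hs⟩

variable [FiniteDimensional ℝ F]

/-- The bracket of two functions `H → F` obtained from linear data. If `α = ∑ αⁱ eᵢ` for a basis
`(eᵢ)` of `F`, its value at `x` is
`a(α(x), β(x)) + D_{r(α(x)) x} β - D_{r(β(x)) x} α + ∑ᵢ l(dαⁱ ⊗ eᵢ ⊗ β(x)) x`. -/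
def modelBracket (a : F →ₗ[ℝ] F →ₗ[ℝ] F) (r : F →ₗ[ℝ] (H →L[ℝ] H))
    (l : (H →L[ℝ] ℝ) →ₗ[ℝ] F →ₗ[ℝ] F →ₗ[ℝ] (H →L[ℝ] F)) (α β : H → F) (x : H) : F :=
  a (α x) (β x) + fderiv ℝ β x (r (α x) x) - fderiv ℝ α x (r (β x) x)
    + ∑ i, l ((LinearMap.toContinuousLinearMap ((Module.finBasis ℝ F).coord i)) ∘L fderiv ℝ α x)
        (Module.finBasis ℝ F i) (β x) x

lemma contDiff_bilin {E₁ E₂ E₃ : Type*} [NormedAddCommGroup E₁] [NormedSpace ℝ E₁]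
    [NormedAddCommGroup E₂] [NormedSpace ℝ E₂] [NormedAddCommGroup E₃] [NormedSpace ℝ E₃]
    [FiniteDimensional ℝ E₁] [FiniteDimensional ℝ E₂] {X : Type*} [NormedAddCommGroup X]
    [NormedSpace ℝ X] (B : E₁ →ₗ[ℝ] E₂ →ₗ[ℝ] E₃) {f : X → E₁} {g : X → E₂}
    (hf : ContDiff ℝ ∞ f) (hg : ContDiff ℝ ∞ g) : ContDiff ℝ ∞ (fun x => B (f x) (g x)) := by
  let C : E₁ →L[ℝ] E₂ →L[ℝ] E₃ := LinearMap.toContinuousLinearMap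
    ((LinearMap.toContinuousLinearMap : (E₂ →ₗ[ℝ] E₃) ≃ₗ[ℝ] (E₂ →L[ℝ] E₃)).toLinearMap ∘ₗ B)
  exact (C.contDiff.comp hf).clm_apply hg

lemma contDiff_trilin {E₁ E₂ E₃ E₄ : Type*} [NormedAddCommGroup E₁] [NormedSpace ℝ E₁]
    [NormedAddCommGroup E₂] [NormedSpace ℝ E₂] [NormedAddCommGroup E₃] [NormedSpace ℝ E₃]
    [NormedAddCommGroup E₄] [NormedSpace ℝ E₄] [FiniteDimensional ℝ E₁] [FiniteDimensional ℝ E₂]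
    [FiniteDimensional ℝ E₃] {X : Type*} [NormedAddCommGroup X] [NormedSpace ℝ X]
    (B : E₁ →ₗ[ℝ] E₂ →ₗ[ℝ] E₃ →ₗ[ℝ] E₄) {f : X → E₁} {g : X → E₂} {h : X → E₃}
    (hf : ContDiff ℝ ∞ f) (hg : ContDiff ℝ ∞ g) (hh : ContDiff ℝ ∞ h) :
    ContDiff ℝ ∞ (fun x => B (f x) (g x) (h x)) := by
  let T : (E₃ →ₗ[ℝ] E₄) ≃ₗ[ℝ] (E₃ →L[ℝ] E₄) := LinearMap.toContinuousLinearMap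
  let C : E₁ →ₗ[ℝ] E₂ →ₗ[ℝ] (E₃ →L[ℝ] E₄) := B.compr₂ T.toLinearMap
  exact (contDiff_bilin C hf hg).clm_apply hh

section

variable (a : F →ₗ[ℝ] F →ₗ[ℝ] F) (r : F →ₗ[ℝ] (H →L[ℝ] H))
  (l : (H →L[ℝ] ℝ) →ₗ[ℝ] F →ₗ[ℝ] F →ₗ[ℝ] (H →L[ℝ] F))

lemma contDiff_modelBracket [FiniteDimensional ℝ H] {α β : H → F} (hα : ContDiff ℝ ∞ α) (hβ : ContDiff ℝ ∞ β) :
    ContDiff ℝ ∞ (modelBracket a r l α β) := by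
  have hr : ∀ {γ : H → F}, ContDiff ℝ ∞ γ → ContDiff ℝ ∞ (fun x => r (γ x) x) := fun hγ =>
    ((LinearMap.toContinuousLinearMap r).contDiff.comp hγ).clm_apply contDiff_id
  have hd : ∀ {γ : H → F}, ContDiff ℝ ∞ γ → ContDiff ℝ ∞ (fderiv ℝ γ) := fun hγ =>
    hγ.fderiv_right (m := ∞) (by simp)
  unfold modelBracket
  refine (((contDiff_bilin a hα hβ).add ((hd hβ).clm_apply (hr hα))).sub
    ((hd hα).clm_apply (hr hβ))).add (ContDiff.sum fun i _ => ?_)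
  exact (contDiff_trilin l (contDiff_const.clm_comp (hd hα)) contDiff_const hβ).clm_apply
    contDiff_id

lemma modelBracket_add_left {α₁ α₂ β : H → F} {x : H} (h₁ : DifferentiableAt ℝ α₁ x)
    (h₂ : DifferentiableAt ℝ α₂ x) : modelBracket a r l (α₁ + α₂) β x =
      modelBracket a r l α₁ β x + modelBracket a r l α₂ β x := by
  simp only [modelBracket, fderiv_add h₁ h₂, Pi.add_apply, map_add, LinearMap.add_apply,
    add_apply, ContinuousLinearMap.comp_add, Finset.sum_add_distrib]
  abel

lemma modelBracket_add_right {α β₁ β₂ : H → F} {x : H} (h₁ : DifferentiableAt ℝ β₁ x)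
    (h₂ : DifferentiableAt ℝ β₂ x) : modelBracket a r l α (β₁ + β₂) x =
      modelBracket a r l α β₁ x + modelBracket a r l α β₂ x := by
  simp only [modelBracket, fderiv_add h₁ h₂, Pi.add_apply, map_add,
    add_apply, Finset.sum_add_distrib]
  abel

lemma modelBracket_smul_right {f : H → ℝ} {α β : H → F} {x : H} (hf : DifferentiableAt ℝ f x)
    (hβ : DifferentiableAt ℝ β x) : modelBracket a r l α (fun y => f y • β y) x =
      f x • modelBracket a r l α β x + fderiv ℝ f x (r (α x) x) • β x := by
  simp only [modelBracket, fderiv_fun_smul hf hβ, map_smul, add_apply,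
    smul_apply, ContinuousLinearMap.smulRight_apply, smul_add, smul_sub,
    Finset.smul_sum]
  abel

lemma modelBracket_smul_left {f : H → ℝ} {α β : H → F} {x : H} (hf : DifferentiableAt ℝ f x)
    (hα : DifferentiableAt ℝ α x) : modelBracket a r l (fun y => f y • α y) β x =
      f x • modelBracket a r l α β x - fderiv ℝ f x (r (β x) x) • α x
        + l (fderiv ℝ f x) (α x) (β x) x := by
  have key : ∑ i, l ((LinearMap.toContinuousLinearMap ((Module.finBasis ℝ F).coord i)) ∘L
      ((fderiv ℝ f x).smulRight (α x))) (Module.finBasis ℝ F i) (β x) x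
      = l (fderiv ℝ f x) (α x) (β x) x := by
    have h : ∀ i, (LinearMap.toContinuousLinearMap ((Module.finBasis ℝ F).coord i)) ∘L
        ((fderiv ℝ f x).smulRight (α x)) = (Module.finBasis ℝ F).repr (α x) i • fderiv ℝ f x := by
      intro i
      ext v
      simp [mul_comm]
    conv_rhs => rw [← (Module.finBasis ℝ F).sum_repr (α x)]
    simp only [h, map_smul, map_sum, LinearMap.smul_apply, LinearMap.sum_apply,
      smul_apply, sum_apply]
  simp only [modelBracket, fderiv_fun_smul hf hα, map_smul, add_apply,
    smul_apply, ContinuousLinearMap.smulRight_apply, smul_add, smul_sub,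
    Finset.smul_sum, ContinuousLinearMap.comp_add, map_add, LinearMap.add_apply,
    Finset.sum_add_distrib, key, LinearMap.smul_apply, ContinuousLinearMap.comp_smul]
  abel

lemma d_eq_fderiv (f : C^∞⟮𝓘(ℝ, H), H; ℝ⟯) (x : H) :
    @Eq (H →L[ℝ] ℝ) (d f x) (fderiv ℝ f x) := by
  ext v
  simp only [d, mfderiv_eq_fderiv]
  rfl

/-- The almost Loday algebroid structure on `H × F → H` given by linear data. -/
def model [FiniteDimensional ℝ H] : AlmostLodayAlgebroid H F (Trivial H F) where
  bracket := LinearMap.mk₂ ℝ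
    (fun α β => ofFn (modelBracket a r l (fn α) (fn β))
      (contDiff_modelBracket a r l (contDiff_fn α) (contDiff_fn β)))
    (fun α₁ α₂ β => by
      ext x
      exact modelBracket_add_left a r l ((contDiff_fn α₁).differentiable (by simp) x)
        ((contDiff_fn α₂).differentiable (by simp) x))
    (fun c α β => by
      ext x
      refine (modelBracket_smul_left a r l (f := fun _ => c) (differentiableAt_const c)
        ((contDiff_fn α).differentiable (by simp) x)).trans ?_
      simp
      rfl)
    (fun α β₁ β₂ => by
      ext x
      exact modelBracket_add_right a r l ((contDiff_fn β₁).differentiable (by simp) x)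
        ((contDiff_fn β₂).differentiable (by simp) x))
    (fun c α β => by
      ext x
      refine (modelBracket_smul_right a r l (f := fun _ => c) (differentiableAt_const c)
        ((contDiff_fn β).differentiable (by simp) x)).trans ?_
      simp
      rfl)
  anchor x := (ContinuousLinearMap.apply ℝ H x).toLinearMap ∘ₗ r
  anchor_smooth := by
    intro v
    have hv : ContMDiffAt (𝓘(ℝ, H).prod 𝓘(ℝ, F)) (𝓘(ℝ, H).prod 𝓘(ℝ, F)) ∞
      (fun w : TotalSpace F (Trivial H F) => w) v := contMDiffAt_id
    obtain ⟨h₁, h₂⟩ := contMDiffAt_totalSpace.1 hv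
    refine contMDiffAt_totalSpace.2 ⟨h₁, ?_⟩
    have h₃ : ContMDiffAt (𝓘(ℝ, H).prod 𝓘(ℝ, F)) 𝓘(ℝ, H →L[ℝ] H) ∞
      (fun w : TotalSpace F (Trivial H F) => r w.snd) v :=
      (LinearMap.toContinuousLinearMap r).contDiff.contMDiff.contMDiffAt.comp v h₂
    refine (h₃.clm_apply h₁).congr_of_eventuallyEq (Eventually.of_forall fun w => ?_)
    simp
    rfl
  coanchor x := l.compr₂ (LinearMap.compRight ℝ (ContinuousLinearMap.apply ℝ F x).toLinearMap)
  coanchor_smooth f α β := by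
    have hf : ContDiff ℝ ∞ f := f.contMDiff.contDiff
    have h := (contDiff_trilin l (hf.fderiv_right (m := ∞) (by simp)) (contDiff_fn α)
      (contDiff_fn β)).clm_apply contDiff_id
    simp only [← d_eq_fderiv] at h
    exact (contMDiff_trivial_iff _).2 h
  leibniz_right f α β x := by
    have h := modelBracket_smul_right a r l (α := fn α)
      (f.contMDiff.contDiff.differentiable (by simp) x) ((contDiff_fn β).differentiable (by simp) x)
    rw [← d_eq_fderiv] at h
    exact h
  leibniz_left f α β x := by
    have h := modelBracket_smul_left a r l (β := fn β)
      (f.contMDiff.contDiff.differentiable (by simp) x) ((contDiff_fn α).differentiable (by simp) x)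
    rw [← d_eq_fderiv] at h
    exact h

end

end Model

/-! ### Linearization at a point -/

section Linearization

variable {H : Type*} [NormedAddCommGroup H] [NormedSpace ℝ H]
  {M : Type*} [TopologicalSpace M] [ChartedSpace H M] [IsManifold 𝓘(ℝ, H) ∞ M]
  {F : Type*} [NormedAddCommGroup F] [NormedSpace ℝ F]
  {V : M → Type*} [TopologicalSpace (TotalSpace F V)]
  [∀ x, AddCommGroup (V x)] [∀ x, Module ℝ (V x)]
  [∀ x, TopologicalSpace (V x)] [FiberBundle F V] [VectorBundle ℝ F V]

variable (F) in
/-- The linearization at `p` of a section `s` vanishing at `p`: the Jacobian matrix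
`(∂sʲ/∂xᵏ(p))` of its components in the chart and the trivialization at `p`. Here `T_p M` is
identified with `H` by the chart and `V p` with `F` by the trivialization. -/
def linPart (p : M) (s : ∀ x, V x) : H →L[ℝ] F :=
  fderiv ℝ (fun y => (trivializationAt F V p
    ⟨(extChartAt 𝓘(ℝ, H) p).symm y, s ((extChartAt 𝓘(ℝ, H) p).symm y)⟩).2)
    (extChartAt 𝓘(ℝ, H) p p)

lemma differentiableAt_coords {p : M} {s : ∀ x, V x}
    (hs : ContMDiff 𝓘(ℝ, H) (𝓘(ℝ, H).prod 𝓘(ℝ, F)) ∞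
      (fun x => (⟨x, s x⟩ : TotalSpace F V))) :
    DifferentiableAt ℝ (fun y => (trivializationAt F V p
      ⟨(extChartAt 𝓘(ℝ, H) p).symm y, s ((extChartAt 𝓘(ℝ, H) p).symm y)⟩).2)
      (extChartAt 𝓘(ℝ, H) p p) := by
  have h := (contMDiffAt_section p).1 (hs p)
  have h2 := (contMDiffAt_iff.1 h).2
  simp only [modelWithCornersSelf_coe, Set.range_id, contDiffWithinAt_univ] at h2
  exact h2.differentiableAt (by simp)

lemma coords_eventually (p : M) : ∀ᶠ y in 𝓝 (extChartAt 𝓘(ℝ, H) p p),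
    (extChartAt 𝓘(ℝ, H) p).symm y ∈ (trivializationAt F V p).baseSet := by
  have h : ContinuousAt (extChartAt 𝓘(ℝ, H) p).symm (extChartAt 𝓘(ℝ, H) p p) :=
    continuousAt_extChartAt_symm p
  refine h.preimage_mem_nhds ((trivializationAt F V p).open_baseSet.mem_nhds ?_)
  rw [extChartAt_to_inv]
  exact FiberBundle.mem_baseSet_trivializationAt' p

lemma linPart_add {p : M} {s t : ∀ x, V x}
    (hs : ContMDiff 𝓘(ℝ, H) (𝓘(ℝ, H).prod 𝓘(ℝ, F)) ∞ (fun x => (⟨x, s x⟩ : TotalSpace F V)))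
    (ht : ContMDiff 𝓘(ℝ, H) (𝓘(ℝ, H).prod 𝓘(ℝ, F)) ∞ (fun x => (⟨x, t x⟩ : TotalSpace F V))) :
    linPart (H := H) F p (fun x => s x + t x) = linPart (H := H) F p s + linPart (H := H) F p t := by
  unfold linPart
  rw [← fderiv_add (differentiableAt_coords hs) (differentiableAt_coords ht)]
  refine Filter.EventuallyEq.fderiv_eq ?_
  filter_upwards [coords_eventually (F := F) (V := V) p] with y hy
  exact ((trivializationAt F V p).linear ℝ hy).map_add _ _

lemma linPart_smul {p : M} {s : ∀ x, V x} (c : ℝ)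
    (hs : ContMDiff 𝓘(ℝ, H) (𝓘(ℝ, H).prod 𝓘(ℝ, F)) ∞ (fun x => (⟨x, s x⟩ : TotalSpace F V))) :
    linPart (H := H) F p (fun x => c • s x) = c • linPart (H := H) F p s := by
  unfold linPart
  rw [← fderiv_const_smul (differentiableAt_coords hs)]
  refine Filter.EventuallyEq.fderiv_eq ?_
  filter_upwards [coords_eventually (F := F) (V := V) p] with y hy
  exact ((trivializationAt F V p).linear ℝ hy).map_smul _ _

variable [FiniteDimensional ℝ H] [T2Space M]

variable (F V) in
lemma exists_cutoff (p : M) : ∃ χ : SmoothBumpFunction 𝓘(ℝ, H) p,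
    tsupport χ ⊆ (trivializationAt F V p).baseSet := by
  obtain ⟨χ, -, h⟩ := (SmoothBumpFunction.nhds_basis_tsupport (I := 𝓘(ℝ, H)) p).mem_iff.1
    ((trivializationAt F V p).open_baseSet.mem_nhds (FiberBundle.mem_baseSet_trivializationAt' p))
  exact ⟨χ, h⟩

variable (F V) in
/-- A bump function at `p` supported in the domains of the chart and the trivialization at `p`;
it equals `1` near `p`. -/
def cutoff (p : M) : SmoothBumpFunction 𝓘(ℝ, H) p := (exists_cutoff F V p).choose

/-- The local frame given by the trivialization at `p`, cut off to global sections: near `p`, the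
section `frame p u` has constant component `u ∈ F` in the trivialization at `p`. -/
def frame [ContMDiffVectorBundle ∞ F V 𝓘(ℝ, H)] (p : M) : F →ₗ[ℝ] Sec H F V where
  toFun u := ⟨fun x => cutoff (H := H) F V p x • (trivializationAt F V p).symmₗ ℝ x u, by
    refine ContMDiffOn.smul_section_of_tsupport (cutoff (H := H) F V p).contMDiff.contMDiffOn
      (trivializationAt F V p).open_baseSet (exists_cutoff F V p).choose_spec ?_
    intro x hx
    rw [(trivializationAt F V p).contMDiffWithinAt_section _ hx]
    exact (contMDiffOn_const (c := u)).congr (fun y hy => by simp [hy]) x hx⟩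
  map_add' u v := by ext x; simp
  map_smul' c u := by ext x; simp [smul_comm c]

/-- Linear coordinates at `p`, cut off to global functions: near `p`, `coord p ξ` is the linear form
`ξ` composed with the chart at `p`. -/
def coord (p : M) : (H →L[ℝ] ℝ) →ₗ[ℝ] C^∞⟮𝓘(ℝ, H), M; ℝ⟯ where
  toFun ξ := ⟨fun x => (cutoff (H := H) H (TangentSpace 𝓘(ℝ, H)) p) x • ξ (extChartAt 𝓘(ℝ, H) p x),
    (cutoff (H := H) H (TangentSpace 𝓘(ℝ, H)) p).contMDiff_smul
      (ξ.contDiff.contMDiff.comp_contMDiffOn (contMDiffOn_extChartAt (n := ∞)))⟩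
  map_add' ξ η := by
    ext x
    exact smul_add (cutoff (H := H) H (TangentSpace 𝓘(ℝ, H)) p x) _ _
  map_smul' c ξ := by
    ext x
    exact smul_comm _ c _

lemma d_add (f g : C^∞⟮𝓘(ℝ, H), M; ℝ⟯) (x : M) : d (f + g) x = d f x + d g x := by
  have hf : MDifferentiableAt 𝓘(ℝ, H) 𝓘(ℝ, ℝ) f x := f.contMDiff.mdifferentiable (by simp) x
  have hg : MDifferentiableAt 𝓘(ℝ, H) 𝓘(ℝ, ℝ) g x := g.contMDiff.mdifferentiable (by simp) x
  ext v
  exact DFunLike.congr_fun (hf.hasMFDerivAt.add hg.hasMFDerivAt).mfderiv v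

lemma d_smul (c : ℝ) (f : C^∞⟮𝓘(ℝ, H), M; ℝ⟯) (x : M) : d (c • f) x = c • d f x := by
  have hf : MDifferentiableAt 𝓘(ℝ, H) 𝓘(ℝ, ℝ) f x := f.contMDiff.mdifferentiable (by simp) x
  ext v
  exact DFunLike.congr_fun (hf.hasMFDerivAt.const_smul c).mfderiv v

namespace AlmostLodayAlgebroid

variable [ContMDiffVectorBundle ∞ F V 𝓘(ℝ, H)] (A : AlmostLodayAlgebroid H F V)

lemma anchor_section_smooth (α : Sec H F V) : ContMDiff 𝓘(ℝ, H) 𝓘(ℝ, H).tangent ∞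
    (fun x => (⟨x, A.anchor x (α x)⟩ : TangentBundle 𝓘(ℝ, H) M)) :=
  A.anchor_smooth.comp α.contMDiff

/-- `𝔞^L(u, v) = [eᵤ, eᵥ](p)`, where `eᵤ`, `eᵥ` are the sections with constant components `u`, `v`
in the local frame at `p`. -/
def bracketLin (p : M) : F →ₗ[ℝ] F →ₗ[ℝ] F :=
  LinearMap.mk₂ ℝ (fun u v => (trivializationAt F V p).linearMapAt ℝ p
    (A.bracket (frame p u) (frame p v) p))
    (fun u u' v => by simp) (fun c u v => by simp) (fun u v v' => by simp) (fun c u v => by simp)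

/-- `ρ^L(u)` is the linearization at `p` of the vector field `ρ(eᵤ)`. -/
def anchorLin (p : M) : F →ₗ[ℝ] (H →L[ℝ] H) where
  toFun u := linPart H p (fun x => A.anchor x (frame p u x))
  map_add' u v := by
    refine Eq.trans ?_ (linPart_add (A.anchor_section_smooth (frame p _)) (A.anchor_section_smooth (frame p _)))
    simp
  map_smul' c u := by
    refine Eq.trans ?_ (linPart_smul c (A.anchor_section_smooth (frame p _)))
    simp

/-- `λ^L(ξ, u, v)` is the linearization at `p` of the section `λ(dξ ⊗ eᵤ ⊗ eᵥ)`, where the covector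
`ξ` is regarded as a linear function of the coordinates at `p`. -/
def coanchorLin (p : M) : (H →L[ℝ] ℝ) →ₗ[ℝ] F →ₗ[ℝ] F →ₗ[ℝ] (H →L[ℝ] F) where
  toFun ξ := LinearMap.mk₂ ℝ (fun u v => linPart F p (fun x =>
      A.coanchor x (d (coord p ξ) x) (frame (V := V) p u x) (frame (V := V) p v x)))
    (fun u u' v => by
      refine Eq.trans ?_ (linPart_add (A.coanchor_smooth (coord p _) (frame p _) (frame p _)) (A.coanchor_smooth (coord p _) (frame p _) (frame p _)))
      simp)
    (fun c u v => by
      refine Eq.trans ?_ (linPart_smul c (A.coanchor_smooth (coord p _) (frame p _) (frame p _)))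
      simp)
    (fun u v v' => by
      refine Eq.trans ?_ (linPart_add (A.coanchor_smooth (coord p _) (frame p _) (frame p _)) (A.coanchor_smooth (coord p _) (frame p _) (frame p _)))
      simp)
    (fun c u v => by
      refine Eq.trans ?_ (linPart_smul c (A.coanchor_smooth (coord p _) (frame p _) (frame p _)))
      simp)
  map_add' ξ η := by
    ext1 u
    ext1 v
    simp only [LinearMap.add_apply, LinearMap.mk₂_apply]
    refine Eq.trans ?_ (linPart_add (A.coanchor_smooth (coord p _) (frame p _) (frame p _)) (A.coanchor_smooth (coord p _) (frame p _) (frame p _)))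
    simp [d_add]
  map_smul' c ξ := by
    ext1 u
    ext1 v
    simp only [LinearMap.smul_apply, LinearMap.mk₂_apply, RingHom.id_apply]
    refine Eq.trans ?_ (linPart_smul c (A.coanchor_smooth (coord p _) (frame p _) (frame p _)))
    simp [d_smul]

variable [FiniteDimensional ℝ F]

/-- The linearization of `A` at `p`, on the trivial bundle `T_p M × V_p → T_p M`, with `T_p M`
identified with `H` by the chart at `p` and `V_p` identified with `F` by the trivialization at `p`.
-/
def linearization (p : M) : AlmostLodayAlgebroid H F (Trivial H F) :=
  model (A.bracketLin p) (A.anchorLin p) (A.coanchorLin p)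

/-- `A` is linearizable around `p` if near `p` it is isomorphic to its linearization at `p` near the
origin. -/
def IsLinearizableAt (p : M) : Prop :=
  LocallyIsomorphic A p (A.linearization p) (0 : H)

end AlmostLodayAlgebroid

/-- The endomorphism `D^L` of `V_p = F`: `D^L(u) = (D eᵤ)(p)` for the section `eᵤ` with constant
components `u` in the local frame at `p`. -/
def Der.fiberLin [ContMDiffVectorBundle ∞ F V 𝓘(ℝ, H)] (D : Der H F V) (p : M) : F →ₗ[ℝ] F where
  toFun u := (trivializationAt F V p).linearMapAt ℝ p (D.toLin (frame p u) p)
  map_add' u v := by simp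
  map_smul' c u := by simp

/-- A derivation `(D, X)` is Euler-like at `p` if `X` vanishes at `p` with linearization
`X^L = id`, and `D^L = 0`. -/
def Der.IsEulerLikeAt [ContMDiffVectorBundle ∞ F V 𝓘(ℝ, H)] (D : Der H F V) (p : M) : Prop :=
  D.symbol p = 0 ∧ linPart H p D.symbol = ContinuousLinearMap.id ℝ H ∧ D.fiberLin p = 0

end Linearization

end Loday

end

/-! Write `E` for the Euler vector field of a vector space, acting on sections of a trivial bundle
by differentiating components: `α ↦ dα_x(x)`. The theorem says that an algebroid is linear near `p`
exactly when it has the symmetry `E`.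

If the algebroid is isomorphic to its linear model, then `E` is a derivation of the model bracket:
the structure constants have weight 0, while the linear dependence of anchor and co-anchor on the
point compensates the weight of one differentiation (`modelBracket_euler`). Pulled back through the
isomorphism and cut off by a bump function, `E` becomes the required `D`; it is Euler-like because
`E` is so in one coordinate system and the property does not depend on coordinates.

Conversely, an Euler-like `D` is put into the form `E` by a change of coordinates and of frame
(`Der.IsEulerLikeAt.exists_coords`). Both changes solve equations `du_y(y) = k u(y) + ...`, which
are singular at the origin. Substituting `u(t y) = tᵏ b(t)` along rays turns them into the regular
integral equation `b(s) = ∫₀ˢ G(x, y, b(x)) dx`. This is solved, smoothly in the parameter `y`, by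
the inverse function theorem on the Banach space `C([0,1], Z)`; uniqueness of small solutions shows
that the solutions on one ray are rescalings of each other, so that `u(y) = b(1)` is a well-defined
smooth solution (`exists_radial_solution`).

In the new coordinates, `D` kills constant sections `e_u` and fixes sections `ξ e_u` with `ξ` a
linear coordinate. As `D` is a derivation of the bracket, `[e_u, e_v]` has weight 0 and `[e_u, ξ
e_v]`, `[ξ e_u, e_v]` have weight 1. A smooth function of weight 0 under `E` is constant and one of
weight 1 is linear. The Leibniz rules then force anchor and co-anchor to be linear, so the bracket
is given by linear data (`Coords.locallyIsomorphic_model`).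

It remains to identify these data with the linearization, which is defined in the preferred chart
and trivialization. The new coordinates agree with those to first order and the new trivialization
agrees at `p`. Since `ρ` and `λ` vanish at `p`, the bracket at `p` and the linear parts of anchor
and co-anchor see no more than that (`bracket_congr_of_isSingularAt`, `linPart_anchor`,
`linPart_coanchorSec`). -/

noncomputable section

namespace Loday

/-! ### Smoothness of composition operators on spaces of continuous functions. -/

section Nemytskii

universe u v

variable {K : Type*} [TopologicalSpace K] [CompactSpace K]
  {E : Type u} [NormedAddCommGroup E] [NormedSpace ℝ E]

/-- Pointwise application of a continuous bilinear map to continuous functions. -/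
def pointwiseBilin {W F : Type*} [NormedAddCommGroup W] [NormedSpace ℝ W]
    [NormedAddCommGroup F] [NormedSpace ℝ F] (B : W →L[ℝ] E →L[ℝ] F) :
    C(K, W) →L[ℝ] C(K, E) →L[ℝ] C(K, F) :=
  LinearMap.mkContinuous₂ (LinearMap.mk₂ ℝ
    (fun (A : C(K, W)) (b : C(K, E)) => (⟨fun s => B (A s) (b s), by fun_prop⟩ : C(K, F)))
    (fun A A' b => by ext; simp) (fun c A b => by ext; simp)
    (fun A b b' => by ext; simp) (fun c A b => by ext; simp)) ‖B‖ (fun A b => by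
    rw [ContinuousMap.norm_le _ (by positivity)]
    intro s
    refine (B.le_opNorm₂ _ _).trans ?_
    gcongr
    · exact A.norm_coe_le_norm s
    · exact b.norm_coe_le_norm s)

/-- The derivative `f'` is uniformly continuous near the compact range of `b`, even though `E` need
not be locally compact. One radius `δ` therefore serves every `s`, and the mean value inequality on
`ball (b s) δ` gives a remainder estimate in the sup norm. -/
lemma hasFDerivAt_postcomp {F : Type*} [NormedAddCommGroup F] [NormedSpace ℝ F]
    {f : C(E, F)} {f' : C(E, E →L[ℝ] F)} (h : ∀ x, HasFDerivAt f (f' x) x) (b : C(K, E)) :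
    HasFDerivAt (fun c : C(K, E) => f.comp c) (pointwiseBilin (ContinuousLinearMap.id ℝ (E →L[ℝ] F)) (f'.comp b)) b := by
  rw [hasFDerivAt_iff_isLittleO, Asymptotics.isLittleO_iff]
  intro ε hε
  have hu := (isCompact_range b.continuous).uniformContinuousAt_of_continuousAt f'
    (fun x _ => f'.continuous.continuousAt) (Metric.dist_mem_uniformity hε)
  obtain ⟨δ, hδ, hu⟩ := Metric.mem_uniformity_dist.1 hu
  filter_upwards [Metric.ball_mem_nhds b hδ] with c hc
  rw [ContinuousMap.norm_le _ (by positivity)]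
  intro s
  have hcs : dist (c s) (b s) < δ := (ContinuousMap.dist_apply_le_dist s).trans_lt hc
  have key := (convex_ball (b s) δ).norm_image_sub_le_of_norm_hasFDerivWithin_le' (f := f)
    (f' := f') (φ := f' (b s)) (C := ε) (fun x _ => (h x).hasFDerivWithinAt) (fun x hx => by
      have := hu (a := b s) (b := x) (by rw [dist_comm]; exact hx) (Set.mem_range_self s)
      rw [← dist_eq_norm, dist_comm]
      exact this.le) (Metric.mem_ball_self hδ) hcs
  exact key.trans (mul_le_mul_of_nonneg_left ((c - b).norm_coe_le_norm s) hε.le)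

/-- The derivative of composition with `f` is composition with `fderiv ℝ f` followed by a bounded
bilinear operation, so induction on `n` applies with `E →L[ℝ] F` in place of `F`. The universe `max
u v` is stable under this replacement. -/
lemma contDiff_postcomp_aux {F : Type (max u v)} [NormedAddCommGroup F] [NormedSpace ℝ F] (n : ℕ)
    (f : C(E, F)) (hf : ContDiff ℝ n f) : ContDiff ℝ n (fun c : C(K, E) => f.comp c) := by
  induction n generalizing F with
  | zero =>
    simp only [CharP.cast_eq_zero, contDiff_zero]
    exact ContinuousMap.continuous_postcomp f
  | succ n ih =>
    rw [Nat.cast_succ] at hf ⊢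
    obtain ⟨hd, -, hf'⟩ := contDiff_succ_iff_fderiv.1 hf
    have h := hasFDerivAt_postcomp (K := K) (f := f) (f' := ⟨fderiv ℝ f, hf'.continuous⟩)
      (fun x => (hd x).hasFDerivAt)
    refine contDiff_succ_iff_fderiv.2 ⟨fun b => (h b).differentiableAt, by simp, ?_⟩
    rw [funext fun b => (h b).fderiv]
    exact (pointwiseBilin (K := K) (ContinuousLinearMap.id ℝ (E →L[ℝ] F))).contDiff.comp (ih ⟨fderiv ℝ f, hf'.continuous⟩ hf')

/-- Composition with a smooth map is a smooth map between spaces of continuous functions. -/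
lemma contDiff_postcomp {F : Type v} [NormedAddCommGroup F] [NormedSpace ℝ F]
    (f : C(E, F)) (hf : ContDiff ℝ ∞ f) : ContDiff ℝ ∞ (fun c : C(K, E) => f.comp c) := by
  rw [contDiff_infty]
  intro n
  -- The auxiliary lemma wants a target in `Type (max u v)`; lifting along a linear isomorphism
  -- removes this restriction.
  let L : F ≃L[ℝ] ULift.{u} F := ContinuousLinearEquiv.ulift.symm
  have h := contDiff_postcomp_aux.{u, v} (K := K) n
    ((⟨L, L.continuous⟩ : C(F, ULift.{u} F)).comp f)
    (L.contDiff.comp (hf.of_le (by exact_mod_cast le_top)))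
  exact ((L.symm : ULift.{u} F →L[ℝ] F).compLeftContinuous ℝ K).contDiff.comp h

lemma fderiv_postcomp_apply {F : Type v} [NormedAddCommGroup F] [NormedSpace ℝ F]
    (f : C(E, F)) (hf : ContDiff ℝ ∞ f) (b h : C(K, E)) (s : K) :
    fderiv ℝ (fun c : C(K, E) => f.comp c) b h s = fderiv ℝ f (b s) (h s) := by
  have := hasFDerivAt_postcomp (K := K) (f := f)
    (f' := ⟨fderiv ℝ f, hf.continuous_fderiv (by simp)⟩)
    (fun x => (hf.differentiable (by simp) x).hasFDerivAt) b
  rw [this.fderiv]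
  rfl

end Nemytskii

/-! ### Inverse function theorem with smoothness on an open set. -/

section LocalInverse

variable {X Y : Type*} [NormedAddCommGroup X] [NormedSpace ℝ X] [CompleteSpace X]
  [NormedAddCommGroup Y] [NormedSpace ℝ Y]

/-- The inverse function theorem for smooth maps, with an inverse smooth on an open set. -/
lemma exists_smooth_localInverse {f : X → Y} {U : Set X} (hU : IsOpen U)
    (hf : ContDiffOn ℝ ∞ f U) {a : X} (ha : a ∈ U) {f' : X ≃L[ℝ] Y}
    (hf' : HasFDerivAt f (f' : X →L[ℝ] Y) a) :
    ∃ e : OpenPartialHomeomorph X Y, a ∈ e.source ∧ e.source ⊆ U ∧ (∀ x, e x = f x) ∧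
      ContDiffOn ℝ ∞ e.symm e.target := by
  have hfa : ContDiffAt ℝ ∞ f a := hf.contDiffAt (hU.mem_nhds ha)
  let e₀ := hfa.toOpenPartialHomeomorph f hf' (by simp)
  -- The local inverse is smooth at every point whose preimage has invertible derivative.
  -- Invertibility is an open condition, so restricting to `S` gives smoothness on the whole target.
  let S : Set X := U ∩ fderiv ℝ f ⁻¹' Set.range ((↑) : (X ≃L[ℝ] Y) → X →L[ℝ] Y)
  have hS : IsOpen S := (hf.continuousOn_fderiv_of_isOpen hU (by simp)).isOpen_inter_preimage hU
    ContinuousLinearEquiv.isOpen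
  refine ⟨e₀.restrOpen S hS, ?_, ?_, fun x => rfl, ?_⟩
  · rw [OpenPartialHomeomorph.restrOpen_source]
    exact ⟨hfa.mem_toOpenPartialHomeomorph_source hf' (by simp), ha, f', hf'.fderiv.symm⟩
  · rw [OpenPartialHomeomorph.restrOpen_source]
    exact fun x hx => hx.2.1
  · intro y hy
    have hx := (e₀.restrOpen S hS).map_target hy
    rw [OpenPartialHomeomorph.restrOpen_source] at hx
    obtain ⟨-, hxU, g, hg⟩ := hx
    have hc : ContDiffAt ℝ ∞ f ((e₀.restrOpen S hS).symm y) := hf.contDiffAt (hU.mem_nhds hxU)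
    refine ((e₀.restrOpen S hS).contDiffAt_symm hy (f₀' := g) ?_ hc).contDiffWithinAt
    rw [hg]
    exact (hc.differentiableAt (by simp)).hasFDerivAt

end LocalInverse

/-! ### The Volterra operator on continuous functions on the unit interval. -/

section Primitive

open MeasureTheory Set

variable {Z : Type*} [NormedAddCommGroup Z] [NormedSpace ℝ Z]

lemma continuous_comp_projIcc (f : C(unitInterval, Z)) :
    Continuous fun x : ℝ => f (projIcc 0 1 zero_le_one x) :=
  f.continuous.comp continuous_projIcc

/-- The primitive vanishing at `0` of a continuous function on `[0, 1]`. -/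
def primitive : C(unitInterval, Z) →L[ℝ] C(unitInterval, Z) :=
  LinearMap.mkContinuous
    { toFun := fun f => ⟨fun s => ∫ x in (0:ℝ)..s, f (projIcc 0 1 zero_le_one x),
        (intervalIntegral.continuous_primitive
          (fun a b => (continuous_comp_projIcc f).intervalIntegrable a b) 0).comp
            continuous_subtype_val⟩
      map_add' := fun f g => by
        ext s
        exact intervalIntegral.integral_add ((continuous_comp_projIcc f).intervalIntegrable _ _)
          ((continuous_comp_projIcc g).intervalIntegrable _ _)
      map_smul' := fun c f => by
        ext s
        exact intervalIntegral.integral_smul c _ } 1 (fun f => by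
    rw [ContinuousMap.norm_le _ (by positivity)]
    intro s
    refine (intervalIntegral.norm_integral_le_of_norm_le_const
      (fun x _ => f.norm_coe_le_norm _)).trans ?_
    rw [sub_zero, abs_of_nonneg s.2.1, one_mul]
    exact mul_le_of_le_one_right (norm_nonneg _) s.2.2)

lemma primitive_apply (f : C(unitInterval, Z)) (s : unitInterval) :
    primitive f s = ∫ x in (0:ℝ)..s, f (projIcc 0 1 zero_le_one x) := rfl

end Primitive

/-! ### Hadamard's lemma. -/

section Hadamard

open MeasureTheory Set

variable {E : Type*} [NormedAddCommGroup E] [NormedSpace ℝ E]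

/-- The map is a composite of smooth maps through `C([0,1], -)`: the bounded linear map sending `x`
to the segment `t ↦ t x`, composition with `g`, the primitive, and evaluation at `1`. No
differentiation under the integral sign is needed. -/
lemma contDiff_radial_integral {W : Type*} [NormedAddCommGroup W] [NormedSpace ℝ W]
    {g : E → W} (hg : ContDiff ℝ ∞ g) :
    ContDiff ℝ ∞ (fun x => ∫ t in (0:ℝ)..1, g (t • x)) := by
  let R : E →L[ℝ] C(unitInterval, E) := LinearMap.mkContinuous
    { toFun := fun x => ⟨fun t => (t : ℝ) • x, by fun_prop⟩
      map_add' := fun x y => by ext; simp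
      map_smul' := fun c x => by ext t; exact smul_comm (t : ℝ) c x } 1 (fun x => by
    rw [ContinuousMap.norm_le _ (by positivity)]
    intro t
    simp only [LinearMap.coe_mk, AddHom.coe_mk, ContinuousMap.coe_mk, norm_smul, one_mul,
      Real.norm_eq_abs, abs_of_nonneg t.2.1]
    exact mul_le_of_le_one_left (norm_nonneg _) t.2.2)
  have h := (ContinuousMap.evalCLM ℝ (1 : unitInterval)).contDiff.comp
    ((primitive (Z := W)).contDiff.comp
      ((contDiff_postcomp (K := unitInterval) ⟨g, hg.continuous⟩ hg).comp R.contDiff))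
  convert h using 1
  ext x
  refine intervalIntegral.integral_congr fun t ht => ?_
  rw [uIcc_of_le zero_le_one] at ht
  simp [R, projIcc_of_mem _ ht]

/-- Hadamard's lemma: a smooth map vanishing at `0` is `x ↦ h x x` with `h` smooth. -/
lemma exists_hadamard {W : Type*} [NormedAddCommGroup W] [NormedSpace ℝ W] [CompleteSpace W]
    {f : E → W} (hf : ContDiff ℝ ∞ f) (h0 : f 0 = 0) :
    ∃ h : E → E →L[ℝ] W, ContDiff ℝ ∞ h ∧ (∀ x, f x = h x x) ∧ h 0 = fderiv ℝ f 0 := by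
  have hf' : ContDiff ℝ ∞ (fderiv ℝ f) := hf.fderiv_right (m := ∞) (by simp)
  refine ⟨fun x => ∫ t in (0:ℝ)..1, fderiv ℝ f (t • x), contDiff_radial_integral hf',
    fun x => ?_, by simp⟩
  have hc : Continuous fun t : ℝ => fderiv ℝ f (t • x) :=
    hf'.continuous.comp (continuous_id.smul continuous_const)
  rw [ContinuousLinearMap.intervalIntegral_apply (hc.intervalIntegrable _ _)]
  have hd : ∀ t : ℝ, HasDerivAt (fun t : ℝ => f (t • x)) (fderiv ℝ f (t • x) x) t := fun t => by
    have h1 : HasDerivAt (fun t : ℝ => t • x) x t := by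
      simpa using (hasDerivAt_id t).smul_const x
    exact ((hf.differentiable (by simp) (t • x)).hasFDerivAt).comp_hasDerivAt t h1
  rw [intervalIntegral.integral_eq_sub_of_hasDerivAt (fun t _ => hd t)
    ((hc.clm_apply continuous_const).intervalIntegrable _ _)]
  simp [h0]

end Hadamard

/-! ### Singular equations along rays, by an integral equation with parameters. -/

section Radial

open MeasureTheory Set

variable {P Z : Type*} [NormedAddCommGroup P] [NormedSpace ℝ P] [NormedAddCommGroup Z]
  [NormedSpace ℝ Z]

/-- The curve `s ↦ (s, y, b s)` as an affine function of `(y, b)`: its linear part. -/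
def graphCurveL : P × C(unitInterval, Z) →L[ℝ] C(unitInterval, ℝ × P × Z) :=
  LinearMap.mkContinuous
    { toFun := fun q => ⟨fun s => ((0 : ℝ), q.1, q.2 s), by fun_prop⟩
      map_add' := fun q q' => by ext s <;> simp
      map_smul' := fun c q => by ext s <;> simp } 1 (fun q => by
    rw [ContinuousMap.norm_le _ (by positivity), one_mul]
    intro s
    refine norm_prod_le_iff.2 ⟨by simp, norm_prod_le_iff.2 ⟨norm_fst_le q, ?_⟩⟩
    exact (q.2.norm_coe_le_norm s).trans (norm_snd_le q))

/-- The curve `s ↦ (s, y, b s)`. -/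
def graphCurve (q : P × C(unitInterval, Z)) : C(unitInterval, ℝ × P × Z) :=
  (⟨fun s => ((s : ℝ), 0, 0), by fun_prop⟩ : C(unitInterval, ℝ × P × Z)) + graphCurveL q

lemma graphCurve_apply (q : P × C(unitInterval, Z)) (s : unitInterval) :
    graphCurve q s = ((s : ℝ), q.1, q.2 s) := by
  simp [graphCurve, graphCurveL]

lemma hasFDerivAt_graphCurve (q : P × C(unitInterval, Z)) :
    HasFDerivAt (graphCurve : P × C(unitInterval, Z) → C(unitInterval, ℝ × P × Z))
      graphCurveL q := by
  have h := (graphCurveL (P := P) (Z := Z)).hasFDerivAt (x := q)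
  exact (hasFDerivAt_const_add_iff _).2 h

lemma fderiv_comp_graphCurve (G : C(ℝ × P × Z, Z)) (hG : ContDiff ℝ ∞ G)
    (q h : P × C(unitInterval, Z)) (s : unitInterval) :
    fderiv ℝ (fun q : P × C(unitInterval, Z) => G.comp (graphCurve q)) q h s =
      fderiv ℝ G (graphCurve q s) (0, h.1, h.2 s) := by
  have h1 := ((contDiff_postcomp (K := unitInterval) G hG).differentiable (by simp)
    (graphCurve q)).hasFDerivAt.comp q (hasFDerivAt_graphCurve q)
  have h2 : HasFDerivAt (fun q : P × C(unitInterval, Z) => G.comp (graphCurve q)) _ q := h1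
  rw [h2.fderiv, ContinuousLinearMap.comp_apply, fderiv_postcomp_apply G hG]
  simp [graphCurveL]

variable [CompleteSpace P] [CompleteSpace Z]

/-- For each small `y`, the integral equation `b(s) = ∫₀ˢ G(x, y, b(x)) dx` has a unique small
solution on `[0, 1]`, which depends smoothly on `y`. -/
lemma exists_integral_solution (G : C(ℝ × P × Z, Z)) (hG : ContDiff ℝ ∞ G)
    (h0 : ∀ s ∈ Icc (0:ℝ) 1, G (s, 0, 0) = 0)
    (h0' : ∀ s ∈ Icc (0:ℝ) 1, ∀ z, fderiv ℝ G (s, 0, 0) (0, 0, z) = 0) :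
    ∃ (β : P → C(unitInterval, Z)) (r ε : ℝ), 0 < r ∧ r ≤ ε ∧
      ContDiffOn ℝ ∞ β (Metric.ball 0 r) ∧
      (∀ y ∈ Metric.ball 0 r, ‖β y‖ < ε ∧ β y = primitive (G.comp (graphCurve (y, β y)))) ∧
      (∀ y ∈ Metric.ball 0 r, ∀ b, ‖b‖ < ε → b = primitive (G.comp (graphCurve (y, b))) →
        β y = b) := by
  let N : P × C(unitInterval, Z) → C(unitInterval, Z) := fun q => G.comp (graphCurve q)
  have hN : ContDiff ℝ ∞ N :=
    (contDiff_postcomp G hG).comp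
      (contDiff_const.add (graphCurveL (P := P) (Z := Z)).contDiff)
  have hN0 : N 0 = 0 := by
    ext s
    simpa [N, graphCurve_apply] using h0 s s.2
  have hN' : ∀ h : C(unitInterval, Z), fderiv ℝ N 0 (0, h) = 0 := by
    intro h
    ext s
    rw [fderiv_comp_graphCurve G hG, graphCurve_apply]
    exact h0' s s.2 (h s)
  -- Solutions for the parameter `y` are the `b` with `Ψ (y, b) = (y, 0)`. By `hN'` the derivative
  -- of `N` in the `b` direction vanishes at `0`, so the derivative of `Ψ` there is unipotent
  -- triangular and `Ψ` is locally invertible; the solution is the second component of the inverse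
  -- at `(y, 0)`.
  let Ψ : P × C(unitInterval, Z) → P × C(unitInterval, Z) := fun q => (q.1, q.2 - primitive (N q))
  have hΨ : ContDiff ℝ ∞ Ψ :=
    contDiff_fst.prodMk (contDiff_snd.sub ((primitive (Z := Z)).contDiff.comp hN))
  let A : P →L[ℝ] C(unitInterval, Z) :=
    -(primitive ∘L fderiv ℝ N 0 ∘L ContinuousLinearMap.inl ℝ P C(unitInterval, Z))
  let Ψ' := (ContinuousLinearEquiv.refl ℝ P).skewProd
    (ContinuousLinearEquiv.refl ℝ C(unitInterval, Z)) A
  have hΨ' : HasFDerivAt Ψ (Ψ' : P × C(unitInterval, Z) →L[ℝ] P × C(unitInterval, Z)) 0 := by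
    have h1 := (hN.differentiable (by simp) 0).hasFDerivAt
    have h4 := ((primitive (Z := Z)).hasFDerivAt (x := N 0)).comp 0 h1
    have h5 := (hasFDerivAt_snd (𝕜 := ℝ) (p := (0 : P × C(unitInterval, Z)))).sub h4
    have h2 : HasFDerivAt Ψ _ 0 := hasFDerivAt_fst.prodMk h5
    refine h2.congr_fderiv (ContinuousLinearMap.ext fun q => ?_)
    have h3 : fderiv ℝ N 0 q = fderiv ℝ N 0 (q.1, 0) := by
      conv_lhs => rw [← Prod.fst_add_snd q, map_add, hN', add_zero]
    simp [Ψ', A, h3, sub_eq_add_neg]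
  obtain ⟨e, he0, -, heΨ, hes⟩ :=
    exists_smooth_localInverse isOpen_univ hΨ.contDiffOn (mem_univ _) hΨ'
  have hΨ0 : e 0 = 0 := by
    rw [heΨ]
    simp [Ψ, hN0]
  have he0' : e.symm 0 = 0 := by
    conv_lhs => rw [← hΨ0]
    exact e.left_inv he0
  obtain ⟨ε, hε, hball⟩ := Metric.isOpen_iff.1 e.open_source 0 he0
  have ht0 : (0 : P × C(unitInterval, Z)) ∈ e.target := hΨ0 ▸ e.map_source he0
  have hopen : IsOpen (e.target ∩ e.symm ⁻¹' Metric.ball 0 ε) :=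
    e.isOpen_inter_preimage_symm Metric.isOpen_ball
  have hopen' : IsOpen ((fun y : P => (y, (0 : C(unitInterval, Z)))) ⁻¹'
      (e.target ∩ e.symm ⁻¹' Metric.ball 0 ε)) := hopen.preimage (by fun_prop)
  obtain ⟨r, hr, hrb⟩ := Metric.isOpen_iff.1 hopen' 0 ⟨ht0, by
    change e.symm 0 ∈ Metric.ball 0 ε
    rw [he0']
    exact Metric.mem_ball_self hε⟩
  have hfst : ∀ y ∈ Metric.ball (0 : P) r, (e.symm (y, 0)).1 = y ∧
      (e.symm (y, 0)).2 - primitive (N (e.symm (y, 0))) = 0 := by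
    intro y hy
    have h1 := e.right_inv (hrb hy).1
    rw [heΨ] at h1
    exact Prod.ext_iff.1 h1
  -- Taking the minimum with `ε` makes `‖y‖ < ε`, so that `(y, b)` with `‖b‖ < ε` lies in the ball
  -- where `e` is injective; this gives uniqueness.
  refine ⟨fun y => (e.symm (y, 0)).2, min r ε, ε, lt_min hr hε, min_le_right _ _, ?_, ?_, ?_⟩
  · exact contDiff_snd.comp_contDiffOn (hes.comp
      (contDiff_id.prodMk contDiff_const).contDiffOn
      fun y hy => (hrb (Metric.ball_subset_ball (min_le_left _ _) hy)).1)
  · intro y hy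
    have hy' := Metric.ball_subset_ball (min_le_left _ _) hy
    have h1 := (hrb hy').2
    rw [mem_preimage, mem_ball_zero_iff] at h1
    refine ⟨(norm_snd_le _).trans_lt h1, ?_⟩
    have h2 := hfst y hy'
    have h3 : e.symm (y, 0) = (y, (e.symm (y, 0)).2) := Prod.ext h2.1 rfl
    conv_rhs => rw [← h3]
    exact sub_eq_zero.1 h2.2
  · intro y hy b hb hb'
    have hsrc : (y, b) ∈ e.source := hball (by
      rw [mem_ball_zero_iff]
      exact max_lt ((mem_ball_zero_iff.1 hy).trans_le (min_le_right _ _)) hb)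
    have h1 : e (y, b) = (y, 0) := by
      rw [heΨ]
      exact Prod.ext rfl (sub_eq_zero.2 hb')
    have h2 := e.left_inv hsrc
    rw [h1] at h2
    exact congrArg Prod.snd h2

/-- Smooth solutions of singular equations along rays: if `G` is homogeneous, in the sense that
`G(s, t y, tᵏ z) = tᵏ⁺¹ G(t s, y, z)`, there is a smooth solution near `0` of
`du_y(y) = k u(y) + G(1, y, u(y))`. -/
theorem exists_radial_solution (k : ℕ) (G : ℝ × P × Z → Z) (hG : ContDiff ℝ ∞ G)
    (h0 : ∀ s ∈ Icc (0:ℝ) 1, G (s, 0, 0) = 0)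
    (h0' : ∀ s ∈ Icc (0:ℝ) 1, ∀ z, fderiv ℝ G (s, 0, 0) (0, 0, z) = 0)
    (hom : ∀ t ∈ Icc (0:ℝ) 1, ∀ s ∈ Icc (0:ℝ) 1, ∀ y z,
      G (s, t • y, t ^ k • z) = t ^ (k + 1) • G (t * s, y, z)) :
    ∃ (u : P → Z) (r : ℝ), 0 < r ∧ ContDiffOn ℝ ∞ u (Metric.ball 0 r) ∧ u 0 = 0 ∧
      (∀ y ∈ Metric.ball 0 r, fderiv ℝ u y y = (k : ℝ) • u y + G (1, y, u y)) ∧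
      (1 ≤ k → fderiv ℝ u 0 = 0) := by
  obtain ⟨β, r, ε, hr, hrε, hβ, hsol, huniq⟩ :=
    exists_integral_solution ⟨G, hG.continuous⟩ hG h0 h0'
  let pr : ℝ → unitInterval := projIcc 0 1 zero_le_one
  have hpr : ∀ {x : ℝ} (hx : x ∈ Icc (0:ℝ) 1), (pr x : ℝ) = x := fun hx => by
    simp [pr, projIcc_of_mem _ hx]
  let g : P → ℝ → Z := fun y x => G (pr x, y, β y (pr x))
  have hg : ∀ y, Continuous (g y) := fun y => hG.continuous.comp
    ((continuous_subtype_val.comp continuous_projIcc).prodMk (continuous_const.prodMk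
      ((β y).continuous.comp continuous_projIcc)))
  have hβg : ∀ y ∈ Metric.ball (0 : P) r, ∀ s : unitInterval, β y s = ∫ x in (0:ℝ)..s, g y x := by
    intro y hy s
    conv_lhs => rw [(hsol y hy).2]
    rw [primitive_apply]
    simp only [ContinuousMap.comp_apply, graphCurve_apply]
    rfl
  have hscale : ∀ y ∈ Metric.ball (0 : P) r, ∀ t ∈ Icc (0:ℝ) 1,
      β (t • y) 1 = t ^ k • ∫ x in (0:ℝ)..t, g y x := by
    intro y hy t ht
    have hty : t • y ∈ Metric.ball (0 : P) r := by
      rw [mem_ball_zero_iff] at hy ⊢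
      rw [norm_smul, Real.norm_eq_abs, abs_of_nonneg ht.1]
      exact (mul_le_of_le_one_left (norm_nonneg _) ht.2).trans_lt hy
    have hmul : ∀ s : unitInterval, t * s ∈ Icc (0:ℝ) 1 := fun s =>
      ⟨mul_nonneg ht.1 s.2.1, mul_le_one₀ ht.2 s.2.1 s.2.2⟩
    -- Homogeneity of `G` makes the curve `s ↦ tᵏ β_y(t s)` a solution for the parameter `t y`, and
    -- it is still small. By uniqueness it is `β (t • y)`; its value at `s = 1` gives the scaling
    -- law.
    let b : C(unitInterval, Z) := ⟨fun s => t ^ k • β y (pr (t * s)), by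
      have : Continuous pr := continuous_projIcc
      fun_prop⟩
    have hb : ‖b‖ < ε := by
      refine lt_of_le_of_lt ?_ (hsol y hy).1
      rw [ContinuousMap.norm_le _ (norm_nonneg _)]
      intro s
      change ‖t ^ k • β y (pr (t * s))‖ ≤ _
      rw [norm_smul, norm_pow, Real.norm_eq_abs, abs_of_nonneg ht.1]
      exact (mul_le_of_le_one_left (norm_nonneg _) (pow_le_one₀ ht.1 ht.2)).trans
        ((β y).norm_coe_le_norm _)
    have key := huniq (t • y) hty b hb (by
      ext s
      change t ^ k • β y (pr (t * s)) = _
      rw [hβg y hy, hpr (hmul s), primitive_apply]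
      have h1 : ∫ x in (0:ℝ)..s, (⟨G, hG.continuous⟩ : C(ℝ × P × Z, Z)).comp
          (graphCurve (t • y, b)) (projIcc 0 1 zero_le_one x) =
          ∫ x in (0:ℝ)..s, t ^ (k + 1) • g y (t * x) := by
        refine intervalIntegral.integral_congr fun x hx => ?_
        rw [uIcc_of_le s.2.1] at hx
        have hx' : x ∈ Icc (0:ℝ) 1 := ⟨hx.1, hx.2.trans s.2.2⟩
        have hx2 : t * x ∈ Icc (0:ℝ) 1 := hmul ⟨x, hx'⟩
        rw [ContinuousMap.comp_apply, graphCurve_apply]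
        change G ((pr x : ℝ), t • y, t ^ k • β y (pr (t * (pr x : ℝ)))) = t ^ (k + 1) • g y (t * x)
        rw [hom t ht _ (pr x).2, hpr hx']
        simp only [g, hpr hx2]
      rw [h1, intervalIntegral.integral_smul, pow_succ, mul_smul,
        intervalIntegral.smul_integral_comp_mul_left, mul_zero])
    rw [key]
    change t ^ k • β y (pr (t * ((1 : unitInterval) : ℝ))) = _
    have h1 : ((1 : unitInterval) : ℝ) = 1 := rfl
    rw [h1, mul_one, hβg y hy, hpr ht]
  -- Differentiating `u(t y) = tᵏ ∫₀ᵗ g_y` gives the radial derivative of `u`. The formula is known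
  -- for `t ∈ [0, 1]` only, hence the one-sided derivatives at the ends; `t = 1` yields the equation
  -- and `t = 0` the value of `du_0`.
  have hray : ∀ y ∈ Metric.ball (0 : P) r, ∀ t ∈ Icc (0:ℝ) 1,
      HasDerivWithinAt (fun t : ℝ => β (t • y) 1)
        (t ^ k • g y t + ((k : ℝ) * t ^ (k - 1)) • ∫ x in (0:ℝ)..t, g y x) (Icc 0 1) t := by
    intro y hy t ht
    refine HasDerivWithinAt.congr_of_mem ?_ (hscale y hy) ht
    exact ((hasDerivAt_pow k t).smul (intervalIntegral.integral_hasDerivAt_right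
      ((hg y).intervalIntegrable _ _) ((hg y).stronglyMeasurableAtFilter _ _)
      (hg y).continuousAt)).hasDerivWithinAt
  have hu : ContDiffOn ℝ ∞ (fun y => β y 1) (Metric.ball 0 r) :=
    (ContinuousMap.evalCLM (M := Z) ℝ (1 : unitInterval)).contDiff.comp_contDiffOn hβ
  have hud : ∀ y ∈ Metric.ball (0 : P) r, ∀ t ∈ Icc (0:ℝ) 1, t • y ∈ Metric.ball (0 : P) r →
      fderiv ℝ (fun y => β y 1) (t • y) y =
        t ^ k • g y t + ((k : ℝ) * t ^ (k - 1)) • ∫ x in (0:ℝ)..t, g y x := by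
    intro y hy t ht hty
    have h1 : HasDerivAt (fun t : ℝ => t • y) y t := by
      simpa using (hasDerivAt_id t).smul_const y
    have h2 := (((hu.contDiffAt (Metric.isOpen_ball.mem_nhds hty)).differentiableAt
      (by simp)).hasFDerivAt.comp_hasDerivAt t h1).hasDerivWithinAt (s := Icc 0 1)
    exact (uniqueDiffOn_Icc zero_lt_one t ht).eq_deriv _ h2 (hray y hy t ht)
  have h00 : (0 : P) ∈ Metric.ball (0 : P) r := Metric.mem_ball_self hr
  refine ⟨fun y => β y 1, r, hr, hu, ?_, ?_, ?_⟩
  · have h1 := huniq 0 h00 0 (by simpa using hr.trans_le hrε) (by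
      ext s
      rw [primitive_apply]
      have : ∀ x : ℝ, ((⟨G, hG.continuous⟩ : C(ℝ × P × Z, Z)).comp
          (graphCurve ((0 : P), (0 : C(unitInterval, Z))))) (projIcc 0 1 zero_le_one x) = 0 :=
        fun x => by
          rw [ContinuousMap.comp_apply, graphCurve_apply]
          exact h0 _ (pr x).2
      simp [this])
    simp [h1]
  · intro y hy
    have h1 := hud y hy 1 ⟨zero_le_one, le_rfl⟩ (by simpa using hy)
    have h2 := hβg y hy 1
    have h3 : ((1 : unitInterval) : ℝ) = 1 := rfl
    have h4 : pr 1 = 1 := Subtype.ext (hpr ⟨zero_le_one, le_rfl⟩)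
    rw [h3] at h2
    simp only [one_smul, one_pow, mul_one, ← h2] at h1
    rw [h1, add_comm]
    simp only [g, h4, h3]
  · intro hk
    have h1 : ∀ y ∈ Metric.ball (0 : P) r, fderiv ℝ (fun y => β y 1) 0 y = 0 := by
      intro y hy
      have h2 := hud y hy 0 ⟨le_rfl, zero_le_one⟩ (by simpa using hr)
      rw [zero_smul] at h2
      rw [h2, intervalIntegral.integral_same, smul_zero, add_zero, zero_pow (by omega), zero_smul]
    ext y
    obtain ⟨c, hc, hcy⟩ : ∃ c : ℝ, 0 < c ∧ c • y ∈ Metric.ball (0 : P) r := by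
      refine ⟨r / (‖y‖ + 1), by positivity, ?_⟩
      rw [mem_ball_zero_iff, norm_smul, Real.norm_eq_abs, abs_of_pos (by positivity),
        div_mul_eq_mul_div, div_lt_iff₀ (by positivity)]
      nlinarith [norm_nonneg y]
    have h2 := h1 _ hcy
    rw [map_smul, smul_eq_zero] at h2
    exact h2.resolve_left hc.ne'

end Radial

/-! ### Normal form of an Euler-like vector field and derivation in coordinates. -/

section EulerLike

open Set

variable {E : Type*} [NormedAddCommGroup E] [NormedSpace ℝ E] [FiniteDimensional ℝ E]

/-- A function smooth near a point has the germ of a globally smooth function. -/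
lemma exists_contDiff_eventuallyEq {W : Type*} [NormedAddCommGroup W] [NormedSpace ℝ W]
    {f : E → W} {U : Set E} (hU : IsOpen U) (hf : ContDiffOn ℝ ∞ f U) {a : E} (ha : a ∈ U) :
    ∃ g : E → W, ContDiff ℝ ∞ g ∧ g =ᶠ[𝓝 a] f := by
  obtain ⟨r, hr, hrU⟩ := Metric.nhds_basis_closedBall.mem_iff.1 (hU.mem_nhds ha)
  let χ : ContDiffBump a := ⟨r / 2, r, by positivity, by linarith⟩
  refine ⟨fun x => χ x • f x, ?_, ?_⟩
  · rw [contDiff_iff_contDiffAt]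
    intro x
    by_cases hx : x ∈ tsupport χ
    · exact χ.contDiff.contDiffAt.smul
        (hf.contDiffAt (hU.mem_nhds (hrU (χ.tsupport_eq ▸ hx))))
    · refine (contDiffAt_const (c := (0 : W))).congr_of_eventuallyEq ?_
      filter_upwards [notMem_tsupport_iff_eventuallyEq.1 hx] with y hy
      simp [hy]
  · filter_upwards [χ.eventuallyEq_one] with y hy
    simp [hy]

variable [CompleteSpace E]

/-- A vector field `X` vanishing at `z₀` with linearization the identity becomes the Euler vector
field in suitable coordinates `κ` centred at `z₀`. -/
theorem exists_euler_coordinates {X : E → E} {U : Set E} (hU : IsOpen U)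
    (hX : ContDiffOn ℝ ∞ X U) {z₀ : E} (hz₀ : z₀ ∈ U) (hX0 : X z₀ = 0)
    (hX1 : fderiv ℝ X z₀ = ContinuousLinearMap.id ℝ E) :
    ∃ κ : OpenPartialHomeomorph E E, z₀ ∈ κ.source ∧ κ.source ⊆ U ∧ κ z₀ = 0 ∧
      ContDiffOn ℝ ∞ κ κ.source ∧ ContDiffOn ℝ ∞ κ.symm κ.target ∧
      fderiv ℝ κ z₀ = ContinuousLinearMap.id ℝ E ∧
      ∀ z ∈ κ.source, fderiv ℝ κ z (X z) = κ z := by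
  let V : Set E := (fun y => z₀ + y) ⁻¹' U
  have hV : IsOpen V := hU.preimage (by fun_prop)
  have h0V : (0 : E) ∈ V := by simpa [V] using hz₀
  have hq : ContDiffOn ℝ ∞ (fun y => X (z₀ + y) - y) V :=
    (hX.comp (f := fun y => z₀ + y) (by fun_prop) fun y hy => hy).sub contDiffOn_id
  obtain ⟨q, hqs, hqe⟩ := exists_contDiff_eventuallyEq hV hq h0V
  have hq0 : q 0 = 0 := by simp [hqe.self_of_nhds, hX0]
  have hq1 : fderiv ℝ q 0 = 0 := by
    rw [hqe.fderiv_eq]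
    have h1 : HasFDerivAt X (ContinuousLinearMap.id ℝ E) (z₀ + 0) := by
      rw [add_zero, ← hX1]
      exact ((hX.contDiffAt (hU.mem_nhds hz₀)).differentiableAt (by simp)).hasFDerivAt
    have h2 : HasFDerivAt (fun y => X (z₀ + y) - y)
        ((ContinuousLinearMap.id ℝ E).comp (ContinuousLinearMap.id ℝ E) -
          ContinuousLinearMap.id ℝ E) 0 :=
      (h1.comp (0 : E) ((hasFDerivAt_id (0 : E)).const_add z₀)).sub (hasFDerivAt_id 0)
    rw [h2.fderiv]
    simp
  obtain ⟨h, hh, hqh, hh0⟩ := exists_hadamard hqs hq0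
  obtain ⟨B, hB, hhB, -⟩ := exists_hadamard hh (hh0.trans hq1)
  -- The inverse coordinates are sought as `ψ(y) = z₀ + y + u(y)` with `dψ_y(y) = X(ψ(y))`, that is
  -- `du_y(y) = u(y) + q(y + u(y))`. As `q(w) = B(w)(w, w)` is of second order, rescaling `(y, u)`
  -- by `t` extracts `t²` and leaves a factor `t` in the argument of `B`, which is the role of the
  -- variable `s`. This is the homogeneity required with `k = 1`.
  let G : ℝ × E × E → E := fun p => B (p.1 • (p.2.1 + p.2.2)) (p.2.1 + p.2.2) (p.2.1 + p.2.2)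
  have hG : ContDiff ℝ ∞ G := by
    have h1 : ContDiff ℝ ∞ fun p : ℝ × E × E => p.2.1 + p.2.2 := by fun_prop
    have h2 : ContDiff ℝ ∞ fun p : ℝ × E × E => p.1 • (p.2.1 + p.2.2) := by fun_prop
    exact ((hB.comp h2).clm_apply h1).clm_apply h1
  obtain ⟨u, r, hr, hu, hu0, hu1, hu2⟩ := exists_radial_solution 1 G hG (by simp [G])
    (by
      intro s _ z
      have hc : HasDerivAt (fun t : ℝ => (s, (0 : E), t • z)) (0, 0, z) 0 :=
        (hasDerivAt_const _ _).prodMk ((hasDerivAt_const _ _).prodMk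
          (by simpa using (hasDerivAt_id (0 : ℝ)).smul_const z))
      have h1 : HasFDerivAt G (fderiv ℝ G (s, 0, 0)) (s, 0, (0 : ℝ) • z) := by
        rw [zero_smul]
        exact (hG.differentiable (by simp) _).hasFDerivAt
      have h2 := h1.comp_hasDerivAt (0 : ℝ) hc
      have h3 : ContDiff ℝ ∞ fun t : ℝ => B (s • (t • z)) z z := by
        have : ContDiff ℝ ∞ fun t : ℝ => s • (t • z) := by fun_prop
        exact ((hB.comp this).clm_apply contDiff_const).clm_apply contDiff_const
      -- On the line `t ↦ (s, 0, t z)` the function `G` is `t²` times a smooth function, so its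
      -- derivative at `t = 0` vanishes.
      have h4 := (hasDerivAt_pow 2 (0 : ℝ)).smul
        (h3.differentiable (by simp) 0).hasDerivAt
      refine h2.unique (HasDerivAt.congr_deriv (h4.congr_of_eventuallyEq
        (Eventually.of_forall fun t => ?_)) (by simp))
      simp [G, smul_smul, pow_two])
    (by
      intro t _ s _ y z
      simp only [G, pow_one, ← smul_add, map_smul, smul_apply, smul_smul]
      ring_nf)
  let ψ : E → E := fun y => z₀ + (y + u y)
  have hψ : ContDiffOn ℝ ∞ ψ (Metric.ball 0 r) := contDiffOn_const.add (contDiffOn_id.add hu)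
  have hw : ContinuousOn (fun y => y + u y) (Metric.ball 0 r) :=
    continuousOn_id.add hu.continuousOn
  obtain ⟨O, hOq, hO, h0O⟩ := eventually_nhds_iff.1 (hqe.and (hV.mem_nhds h0V))
  -- On `W` the globally extended remainder `q` still equals the original one, and `ψ` takes values
  -- in `U`.
  let W : Set E := Metric.ball 0 r ∩ (fun y => y + u y) ⁻¹' O
  have hW : IsOpen W := hw.isOpen_inter_preimage Metric.isOpen_ball hO
  have h0W : (0 : E) ∈ W := ⟨Metric.mem_ball_self hr, by simpa [hu0] using h0O⟩
  have hψ' : ∀ y ∈ W, HasFDerivAt ψ (ContinuousLinearMap.id ℝ E + fderiv ℝ u y) y := fun y hy =>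
    ((hasFDerivAt_id y).add ((hu.contDiffAt (Metric.isOpen_ball.mem_nhds hy.1)).differentiableAt
      (by simp)).hasFDerivAt).const_add z₀
  have hψ0 : ψ 0 = z₀ := by simp [ψ, hu0]
  have hψ0' : HasFDerivAt ψ ((ContinuousLinearEquiv.refl ℝ E : E ≃L[ℝ] E) : E →L[ℝ] E) 0 := by
    refine (hψ' 0 h0W).congr_fderiv ?_
    rw [hu2 le_rfl, add_zero]
    rfl
  obtain ⟨e, he0, heW, heψ, hes⟩ :=
    exists_smooth_localInverse hW (hψ.mono fun y hy => hy.1) h0W hψ0'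
  have he0' : e 0 = z₀ := by rw [heψ, hψ0]
  have hκ : ∀ y ∈ e.source, fderiv ℝ e.symm (e y) ∘L fderiv ℝ ψ y =
      ContinuousLinearMap.id ℝ E := by
    intro y hy
    have h1 := ((hes.contDiffAt (e.open_target.mem_nhds (e.map_source hy))).differentiableAt
      (by simp)).hasFDerivAt
    rw [heψ] at h1
    have h2 := h1.comp y (hψ' y (heW hy))
    rw [heψ, (hψ' y (heW hy)).fderiv]
    refine h2.unique ((hasFDerivAt_id y).congr_of_eventuallyEq ?_)
    filter_upwards [e.open_source.mem_nhds hy] with x hx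
    rw [Function.comp_apply, ← heψ]
    exact e.left_inv hx
  refine ⟨e.symm, ?_, ?_, ?_, hes, ?_, ?_, ?_⟩
  · rw [← he0']
    exact e.map_source he0
  · intro z hz
    have h1 := (hOq _ (heW (e.map_target hz)).2).2
    have h2 := e.right_inv hz
    rw [heψ] at h2
    exact h2 ▸ h1
  · rw [← he0']
    exact e.left_inv he0
  · refine (hψ.mono fun y hy => (heW hy).1).congr fun y _ => heψ y
  · have h1 := hκ 0 he0
    rw [hψ0'.fderiv, he0'] at h1
    exact h1
  · intro z hz
    have hy := e.map_target hz
    have h1 := hκ _ hy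
    rw [e.right_inv hz] at h1
    have h2 := (hOq _ (heW hy).2).1
    have h3 := hu1 _ (heW hy).1
    -- The identity `dψ_y(y) = X(ψ(y))`; applying the derivative of the inverse `κ` of `ψ` turns it
    -- into `dκ_z(X z) = κ z`.
    have h4 : fderiv ℝ ψ (e.symm z) (e.symm z) = X z := by
      rw [(hψ' _ (heW hy)).fderiv, add_apply, h3]
      have h5 : G (1, e.symm z, u (e.symm z)) = q (e.symm z + u (e.symm z)) := by
        simp only [G, one_smul]
        rw [hqh, hhB]
      have h6 : z₀ + (e.symm z + u (e.symm z)) = z := by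
        have := e.right_inv hz
        rwa [heψ] at this
      rw [h5, h2]
      beta_reduce
      rw [h6]
      simp only [ContinuousLinearMap.id_apply, Nat.cast_one, one_smul]
      abel
    rw [← h4]
    exact DFunLike.congr_fun h1 _

/-- The equation `dg_y(y) = g(y) A(y)`, with `A(0) = 0`, has a solution near `0` with `g(0) = 1`. -/
theorem exists_radial_frame {R : Type*} [NormedRing R] [NormedAlgebra ℝ R] [CompleteSpace R]
    {A : E → R} {U : Set E} (hU : IsOpen U) (hA : ContDiffOn ℝ ∞ A U) (h0U : (0 : E) ∈ U)
    (hA0 : A 0 = 0) :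
    ∃ (g : E → R) (r : ℝ), 0 < r ∧ ContDiffOn ℝ ∞ g (Metric.ball 0 r) ∧ g 0 = 1 ∧
      (∀ y ∈ Metric.ball 0 r, IsUnit (g y)) ∧
      ∀ y ∈ Metric.ball 0 r, fderiv ℝ g y y = g y * A y := by
  obtain ⟨a, ha, hae⟩ := exists_contDiff_eventuallyEq hU hA h0U
  obtain ⟨h, hh, hah, -⟩ := exists_hadamard ha (by rw [hae.self_of_nhds, hA0])
  -- With `g = 1 + u` and `A(y) = h(y) y` the equation becomes `du_y(y) = (1 + u) h(y) y`. Only `y`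
  -- is rescaled, so this is the homogeneous case `k = 0`, and `G` vanishes identically at `y = 0`.
  let G : ℝ × E × R → R := fun p => (1 + p.2.2) * h (p.1 • p.2.1) p.2.1
  have hG : ContDiff ℝ ∞ G := by
    have h1 : ContDiff ℝ ∞ fun p : ℝ × E × R => p.1 • p.2.1 := by fun_prop
    have h2 : ContDiff ℝ ∞ fun p : ℝ × E × R => h (p.1 • p.2.1) p.2.1 :=
      (hh.comp h1).clm_apply (by fun_prop)
    exact ContDiff.mul (by fun_prop) h2
  obtain ⟨u, r, hr, hu, hu0, hu1, -⟩ := exists_radial_solution 0 G hG (by simp [G])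
    (by
      intro s _ z
      have hc : HasDerivAt (fun t : ℝ => (s, (0 : E), t • z)) (0, 0, z) 0 :=
        (hasDerivAt_const _ _).prodMk ((hasDerivAt_const _ _).prodMk
          (by simpa using (hasDerivAt_id (0 : ℝ)).smul_const z))
      have h1 : HasFDerivAt G (fderiv ℝ G (s, 0, 0)) (s, 0, (0 : ℝ) • z) := by
        rw [zero_smul]
        exact (hG.differentiable (by simp) _).hasFDerivAt
      have h2 := h1.comp_hasDerivAt (0 : ℝ) hc
      refine h2.unique ((hasDerivAt_const (0 : ℝ) (0 : R)).congr_of_eventuallyEq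
        (Eventually.of_forall fun t => ?_))
      simp [G])
    (by
      intro t _ s _ y z
      simp [G, smul_smul, mul_comm t s])
  have hg : ContDiffOn ℝ ∞ (fun y => 1 + u y) (Metric.ball 0 r) := contDiffOn_const.add hu
  obtain ⟨O, hOa, hO, h0O⟩ := eventually_nhds_iff.1 hae
  have hopen : IsOpen (Metric.ball 0 r ∩ (fun y => 1 + u y) ⁻¹' {x | IsUnit x}) :=
    hg.continuousOn.isOpen_inter_preimage Metric.isOpen_ball Units.isOpen
  obtain ⟨r', hr', hb⟩ := Metric.isOpen_iff.1 (hopen.inter hO) 0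
    ⟨⟨Metric.mem_ball_self hr, by simp [hu0]⟩, h0O⟩
  refine ⟨fun y => 1 + u y, r', hr', hg.mono fun y hy => (hb hy).1.1, by simp [hu0],
    fun y hy => (hb hy).1.2, fun y hy => ?_⟩
  rw [fderiv_const_add, hu1 y (hb hy).1.1, ← hOa y (hb hy).2, hah]
  simp [G]

/-- An Euler-like derivation `α ↦ dα(X) + Ω α` of the trivial bundle becomes `α ↦ dα(y)` in suitable
coordinates `y = κ(z)` and a suitable frame, given by `g`. -/
theorem exists_linearizing_coordinates {R : Type*} [NormedRing R] [NormedAlgebra ℝ R]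
    [CompleteSpace R] {X : E → E} {Ω : E → R} {U : Set E} (hU : IsOpen U)
    (hX : ContDiffOn ℝ ∞ X U) (hΩ : ContDiffOn ℝ ∞ Ω U) {z₀ : E} (hz₀ : z₀ ∈ U) (hX0 : X z₀ = 0)
    (hX1 : fderiv ℝ X z₀ = ContinuousLinearMap.id ℝ E) (hΩ0 : Ω z₀ = 0) :
    ∃ (κ : OpenPartialHomeomorph E E) (g : E → R), z₀ ∈ κ.source ∧ κ.source ⊆ U ∧ κ z₀ = 0 ∧
      ContDiffOn ℝ ∞ κ κ.source ∧ ContDiffOn ℝ ∞ κ.symm κ.target ∧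
      fderiv ℝ κ z₀ = ContinuousLinearMap.id ℝ E ∧
      (∀ z ∈ κ.source, fderiv ℝ κ z (X z) = κ z) ∧
      ContDiffOn ℝ ∞ g κ.source ∧ g z₀ = 1 ∧ (∀ z ∈ κ.source, IsUnit (g z)) ∧
      ∀ z ∈ κ.source, fderiv ℝ g z (X z) = g z * Ω z := by
  obtain ⟨κ, hκ0, hκU, hκz, hκ, hκs, hκ1, hκX⟩ := exists_euler_coordinates hU hX hz₀ hX0 hX1
  have h0t : (0 : E) ∈ κ.target := hκz ▸ κ.map_source hκ0
  have hsz : κ.symm 0 = z₀ := by rw [← hκz, κ.left_inv hκ0]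
  -- In the coordinates `κ` the field `X` is radial, so the equation `dg(X) = g Ω` for the gauge
  -- transformation is the radial frame equation for `Ω ∘ κ⁻¹`.
  obtain ⟨g, r, hr, hg, hg0, hgu, hgA⟩ := exists_radial_frame (A := fun y => Ω (κ.symm y))
    κ.open_target (hΩ.comp hκs fun y hy => hκU (κ.map_target hy)) h0t (by simp [hsz, hΩ0])
  have hS : IsOpen (κ.source ∩ κ ⁻¹' Metric.ball 0 r) :=
    κ.isOpen_inter_preimage Metric.isOpen_ball
  have hsrc : (κ.restrOpen _ hS).source = κ.source ∩ κ ⁻¹' Metric.ball 0 r := by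
    rw [OpenPartialHomeomorph.restrOpen_source, ← inter_assoc, inter_self]
  refine ⟨κ.restrOpen _ hS, fun z => g (κ z), ?_, ?_, hκz, ?_, ?_, hκ1, ?_, ?_, ?_, ?_, ?_⟩
  · rw [hsrc]
    exact ⟨hκ0, by simpa [hκz] using hr⟩
  · rw [hsrc]
    exact fun z hz => hκU hz.1
  · rw [hsrc]
    exact hκ.mono fun z hz => hz.1
  · exact hκs.mono fun y hy => hy.1
  · rw [hsrc]
    exact fun z hz => hκX z hz.1
  · rw [hsrc]
    exact hg.comp (hκ.mono fun z hz => hz.1) fun z hz => hz.2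
  · simp [hκz, hg0]
  · rw [hsrc]
    exact fun z hz => hgu _ hz.2
  · rw [hsrc]
    intro z hz
    have h1 := ((hg.contDiffAt (Metric.isOpen_ball.mem_nhds hz.2)).differentiableAt
      (by simp)).hasFDerivAt
    have h2 := ((hκ.contDiffAt (κ.open_source.mem_nhds hz.1)).differentiableAt
      (by simp)).hasFDerivAt
    have h3 : HasFDerivAt (fun z => g (κ z)) _ z := h1.comp z h2
    rw [h3.fderiv, ContinuousLinearMap.comp_apply, hκX z hz.1, hgA _ hz.2, κ.left_inv hz.1]

end EulerLike

/-! ### Local coordinates with trivialization, components, and cut-off sections. -/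

section Coordinates

open Set

variable (H : Type*) [NormedAddCommGroup H] [NormedSpace ℝ H]
  {M : Type*} [TopologicalSpace M] [ChartedSpace H M]
  (F : Type*) [NormedAddCommGroup F] [NormedSpace ℝ F]
  (V : M → Type*) [TopologicalSpace (TotalSpace F V)]
  [∀ x, AddCommGroup (V x)] [∀ x, Module ℝ (V x)]
  [∀ x, TopologicalSpace (V x)] [FiberBundle F V] [VectorBundle ℝ F V]

/-- Local coordinates of `M` together with a local trivialization of the vector bundle `V` over
their domain. -/
structure Coords where
  φ : OpenPartialHomeomorph M H
  Φ : ∀ x : M, V x →ₗ[ℝ] F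
  Ψ : ∀ x : M, F →ₗ[ℝ] V x
  contMDiffOn : ContMDiffOn 𝓘(ℝ, H) 𝓘(ℝ, H) ∞ φ φ.source
  contMDiffOn_symm : ContMDiffOn 𝓘(ℝ, H) 𝓘(ℝ, H) ∞ φ.symm φ.target
  left_inv : ∀ x ∈ φ.source, ∀ v, Ψ x (Φ x v) = v
  right_inv : ∀ x ∈ φ.source, ∀ u, Φ x (Ψ x u) = u
  contMDiffOn_total : ContMDiffOn (𝓘(ℝ, H).prod 𝓘(ℝ, F)) 𝓘(ℝ, F) ∞
    (fun v : TotalSpace F V => Φ v.proj v.snd) (TotalSpace.proj ⁻¹' φ.source)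

variable {H F V}

/-- In finite dimension an operator-valued map is a finite sum of its values on a basis multiplied
by fixed coordinate functionals. -/
lemma contMDiffAt_clm_of_apply [FiniteDimensional ℝ F] {G : M → F →L[ℝ] F} {x : M}
    (h : ∀ u, ContMDiffAt 𝓘(ℝ, H) 𝓘(ℝ, F) ∞ (fun y => G y u) x) :
    ContMDiffAt 𝓘(ℝ, H) 𝓘(ℝ, F →L[ℝ] F) ∞ G x := by
  let b := Module.finBasis ℝ F
  let c : ∀ i, F →L[ℝ] ℝ := fun i => LinearMap.toContinuousLinearMap (b.coord i)
  have h1 : G = fun y => ∑ i, ContinuousLinearMap.smulRightL ℝ F F (c i) (G y (b i)) := by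
    ext y u
    conv_lhs => rw [← b.sum_repr u, map_sum]
    simp [c]
  rw [h1]
  exact contMDiffAt_finsetSum fun i _ =>
    (ContinuousLinearMap.smulRightL ℝ F F (c i)).contDiff.contMDiff.contMDiffAt.comp x (h (b i))

namespace Coords

variable (𝒞 : Coords H F V)

lemma Φ_eq_zero_iff {x : M} (hx : x ∈ 𝒞.φ.source) {v : V x} : 𝒞.Φ x v = 0 ↔ v = 0 :=
  ⟨fun h => by rw [← 𝒞.left_inv x hx v, h, map_zero], fun h => by rw [h, map_zero]⟩

lemma contMDiffAt_Φ {x : M} (hx : x ∈ 𝒞.φ.source) {s : ∀ x, V x}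
    (hs : ContMDiffAt 𝓘(ℝ, H) (𝓘(ℝ, H).prod 𝓘(ℝ, F)) ∞
      (fun y => (⟨y, s y⟩ : TotalSpace F V)) x) :
    ContMDiffAt 𝓘(ℝ, H) 𝓘(ℝ, F) ∞ (fun y => 𝒞.Φ y (s y)) x := by
  have hopen : IsOpen (TotalSpace.proj ⁻¹' 𝒞.φ.source : Set (TotalSpace F V)) :=
    𝒞.φ.open_source.preimage (FiberBundle.continuous_proj F V)
  exact (𝒞.contMDiffOn_total.contMDiffAt
    (hopen.mem_nhds (show (⟨x, s x⟩ : TotalSpace F V) ∈ _ from hx))).comp x hs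

/-- A `Coords` only records smoothness of `Φ`, not of the inverse `Ψ`. Relative to a bundle
trivialization, `Φ` is a smooth family `G` of invertible operators on `F`; since inversion in the
Banach algebra of operators is smooth, the components in the trivialization are recovered smoothly
as `G⁻¹ (Φ s)`. -/
lemma contMDiffAt_section_of_Φ [IsManifold 𝓘(ℝ, H) ∞ M] [FiniteDimensional ℝ F]
    [ContMDiffVectorBundle ∞ F V 𝓘(ℝ, H)]
    {x : M} (hx : x ∈ 𝒞.φ.source) {s : ∀ x, V x}
    (hs : ContMDiffAt 𝓘(ℝ, H) 𝓘(ℝ, F) ∞ (fun y => 𝒞.Φ y (s y)) x) :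
    ContMDiffAt 𝓘(ℝ, H) (𝓘(ℝ, H).prod 𝓘(ℝ, F)) ∞ (fun y => (⟨y, s y⟩ : TotalSpace F V)) x := by
  have : CompleteSpace F := FiniteDimensional.complete ℝ F
  let e := trivializationAt F V x
  have hxe : x ∈ e.baseSet := FiberBundle.mem_baseSet_trivializationAt' x
  let G : M → F →L[ℝ] F := fun y => LinearMap.toContinuousLinearMap (𝒞.Φ y ∘ₗ e.symmₗ ℝ y)
  have hG : ContMDiffAt 𝓘(ℝ, H) 𝓘(ℝ, F →L[ℝ] F) ∞ G x := by
    refine contMDiffAt_clm_of_apply fun u => 𝒞.contMDiffAt_Φ hx (s := fun y => e.symmₗ ℝ y u) ?_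
    refine ContMDiffOn.contMDiffAt (s := e.baseSet) ?_ (e.open_baseSet.mem_nhds hxe)
    intro y hy
    rw [e.contMDiffWithinAt_section _ hy]
    exact (contMDiffOn_const (c := u)).congr (fun z hz => by simp [hz]) y hy
  have hinv : ∀ y ∈ 𝒞.φ.source ∩ e.baseSet, ∃ T : (F →L[ℝ] F)ˣ, T = G y ∧
      ∀ v : V y, T⁻¹.1 (𝒞.Φ y v) = e.linearMapAt ℝ y v := by
    intro y hy
    refine ⟨⟨G y, LinearMap.toContinuousLinearMap (e.linearMapAt ℝ y ∘ₗ 𝒞.Ψ y), ?_, ?_⟩,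
      rfl, ?_⟩
    · ext u
      simp [G, e.symmₗ_linearMapAt hy.2, 𝒞.right_inv y hy.1]
    · ext u
      simp [G, e.linearMapAt_symmₗ hy.2, 𝒞.left_inv y hy.1]
    · intro v
      simp [𝒞.left_inv y hy.1]
  rw [contMDiffAt_section]
  obtain ⟨T, hT, -⟩ := hinv x ⟨hx, hxe⟩
  have hI : ContMDiffAt 𝓘(ℝ, H) 𝓘(ℝ, F →L[ℝ] F) ∞ (fun y => Ring.inverse (G y)) x := by
    have h1 : ContMDiffAt 𝓘(ℝ, F →L[ℝ] F) 𝓘(ℝ, F →L[ℝ] F) ∞ Ring.inverse (G x) := by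
      rw [← hT]
      exact (contDiffAt_ringInverse ℝ T).contMDiffAt
    exact h1.comp x hG
  refine (hI.clm_apply hs).congr_of_eventuallyEq ?_
  filter_upwards [𝒞.φ.open_source.mem_nhds hx, e.open_baseSet.mem_nhds hxe] with y hy hye
  obtain ⟨T, hT, hT'⟩ := hinv y ⟨hy, hye⟩
  rw [← hT, Ring.inverse_unit]
  refine Eq.trans ?_ (hT' (s y)).symm
  rw [e.coe_linearMapAt_of_mem hye]

/-- The components of a section, as a function of the coordinates. -/
def rep (s : ∀ x, V x) (z : H) : F := 𝒞.Φ (𝒞.φ.symm z) (s (𝒞.φ.symm z))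

lemma rep_φ (s : ∀ x, V x) {x : M} (hx : x ∈ 𝒞.φ.source) :
    𝒞.rep s (𝒞.φ x) = 𝒞.Φ x (s x) := by
  simp only [rep]
  rw [𝒞.φ.left_inv hx]

lemma eventually_rep_φ (s : ∀ x, V x) {x : M} (hx : x ∈ 𝒞.φ.source) :
    ∀ᶠ y in 𝓝 x, 𝒞.Φ y (s y) = 𝒞.rep s (𝒞.φ y) := by
  filter_upwards [𝒞.φ.open_source.mem_nhds hx] with y hy
  exact (𝒞.rep_φ s hy).symm

lemma contMDiffAt_φ {x : M} (hx : x ∈ 𝒞.φ.source) :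
    ContMDiffAt 𝓘(ℝ, H) 𝓘(ℝ, H) ∞ 𝒞.φ x :=
  𝒞.contMDiffOn.contMDiffAt (𝒞.φ.open_source.mem_nhds hx)

lemma contMDiffAt_φ_symm {z : H} (hz : z ∈ 𝒞.φ.target) :
    ContMDiffAt 𝓘(ℝ, H) 𝓘(ℝ, H) ∞ 𝒞.φ.symm z :=
  𝒞.contMDiffOn_symm.contMDiffAt (𝒞.φ.open_target.mem_nhds hz)

lemma contDiffAt_rep {s : ∀ x, V x} {z : H} (hz : z ∈ 𝒞.φ.target)
    (hs : ContMDiffAt 𝓘(ℝ, H) (𝓘(ℝ, H).prod 𝓘(ℝ, F)) ∞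
      (fun y => (⟨y, s y⟩ : TotalSpace F V)) (𝒞.φ.symm z)) :
    ContDiffAt ℝ ∞ (𝒞.rep s) z :=
  contMDiffAt_iff_contDiffAt.1
    ((𝒞.contMDiffAt_Φ (𝒞.φ.map_target hz) hs).comp z (𝒞.contMDiffAt_φ_symm hz))

lemma contDiffAt_rep_sec (s : Sec H F V) {z : H} (hz : z ∈ 𝒞.φ.target) :
    ContDiffAt ℝ ∞ (𝒞.rep s) z := 𝒞.contDiffAt_rep hz (s.contMDiff _)

lemma contDiffOn_rep_sec (s : Sec H F V) : ContDiffOn ℝ ∞ (𝒞.rep s) 𝒞.φ.target :=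
  fun _ hz => (𝒞.contDiffAt_rep_sec s hz).contDiffWithinAt

variable (V) in
/-- The trivialization of the tangent bundle induced by local coordinates. -/
def tangent [IsManifold 𝓘(ℝ, H) ∞ M] : Coords H H (TangentSpace 𝓘(ℝ, H) : M → Type _) where
  φ := 𝒞.φ
  Φ x := (mfderiv 𝓘(ℝ, H) 𝓘(ℝ, H) 𝒞.φ x).toLinearMap
  Ψ x := (mfderiv 𝓘(ℝ, H) 𝓘(ℝ, H) 𝒞.φ.symm (𝒞.φ x)).toLinearMap
  contMDiffOn := 𝒞.contMDiffOn
  contMDiffOn_symm := 𝒞.contMDiffOn_symm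
  left_inv x hx v := by
    have h1 := ((𝒞.contMDiffAt_φ hx).mdifferentiableAt (by simp)).hasMFDerivAt
    have h2 := ((𝒞.contMDiffAt_φ_symm (𝒞.φ.map_source hx)).mdifferentiableAt
      (by simp)).hasMFDerivAt
    have h3 := h2.comp x h1
    have h4 : HasMFDerivAt 𝓘(ℝ, H) 𝓘(ℝ, H) (𝒞.φ.symm ∘ 𝒞.φ) x _ :=
      (hasMFDerivAt_id x).congr_of_eventuallyEq (by
        filter_upwards [𝒞.φ.open_source.mem_nhds hx] with y hy using 𝒞.φ.left_inv hy)
    exact DFunLike.congr_fun (hasMFDerivAt_unique h3 h4) v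
  right_inv x hx v := by
    have h1 := ((𝒞.contMDiffAt_φ hx).mdifferentiableAt (by simp)).hasMFDerivAt
    have h2 := ((𝒞.contMDiffAt_φ_symm (𝒞.φ.map_source hx)).mdifferentiableAt
      (by simp)).hasMFDerivAt
    have h3 : HasMFDerivAt 𝓘(ℝ, H) 𝓘(ℝ, H) (𝒞.φ ∘ 𝒞.φ.symm) (𝒞.φ x) _ :=
      HasMFDerivAt.comp (𝒞.φ x) (by rw [𝒞.φ.left_inv hx]; exact h1) h2
    have h4 : HasMFDerivAt 𝓘(ℝ, H) 𝓘(ℝ, H) (𝒞.φ ∘ 𝒞.φ.symm) (𝒞.φ x) _ :=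
      (hasMFDerivAt_id (𝒞.φ x)).congr_of_eventuallyEq (by
        filter_upwards [𝒞.φ.open_target.mem_nhds (𝒞.φ.map_source hx)] with y hy
          using 𝒞.φ.right_inv hy)
    exact DFunLike.congr_fun (hasMFDerivAt_unique h3 h4) v
  contMDiffOn_total := by
    intro v hv
    have h := 𝒞.contMDiffOn.contMDiffOn_tangentMapWithin (m := ∞) (by simp)
      𝒞.φ.open_source.uniqueMDiffOn v hv
    refine (contMDiffWithinAt_totalSpace.1 h).2.congr_of_mem (fun w hw => ?_) hv
    simp [tangentMapWithin, mfderivWithin_of_isOpen 𝒞.φ.open_source hw]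
    rfl

lemma tangent_Φ [IsManifold 𝓘(ℝ, H) ∞ M] (x : M) (v : TangentSpace 𝓘(ℝ, H) x) :
    𝒞.tangent.Φ x v = mfderiv 𝓘(ℝ, H) 𝓘(ℝ, H) 𝒞.φ x v := rfl

variable [IsManifold 𝓘(ℝ, H) ∞ M]

/-- The differential of a function which near `x` is a function `h` of the coordinates. -/
lemma d_apply_of_eventuallyEq {f : C^∞⟮𝓘(ℝ, H), M; ℝ⟯} {h : H → ℝ} {x : M} (hx : x ∈ 𝒞.φ.source)
    (hf : ∀ᶠ y in 𝓝 x, f y = h (𝒞.φ y)) (hh : DifferentiableAt ℝ h (𝒞.φ x))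
    (v : TangentSpace 𝓘(ℝ, H) x) : d f x v = fderiv ℝ h (𝒞.φ x) (𝒞.tangent.Φ x v) := by
  have h1 := ((𝒞.contMDiffAt_φ hx).mdifferentiableAt (by simp)).hasMFDerivAt
  have h2 := (hh.hasFDerivAt.hasMFDerivAt.comp x h1).congr_of_eventuallyEq hf
  rw [d, h2.mfderiv]
  rfl

end Coords

lemma exists_smooth_bump [FiniteDimensional ℝ H] [T2Space M] [IsManifold 𝓘(ℝ, H) ∞ M] {U : Set M}
    (hU : IsOpen U) {x : M} (hx : x ∈ U) : ∃ χ : C^∞⟮𝓘(ℝ, H), M; ℝ⟯,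
      (∀ᶠ y in 𝓝 x, χ y = 1) ∧ tsupport χ ⊆ U := by
  obtain ⟨χ, -, h⟩ := (SmoothBumpFunction.nhds_basis_tsupport (I := 𝓘(ℝ, H)) x).mem_iff.1
    (hU.mem_nhds hx)
  exact ⟨⟨χ, χ.contMDiff⟩, χ.eventuallyEq_one, h⟩

namespace Coords

variable (𝒞 : Coords H F V) [IsManifold 𝓘(ℝ, H) ∞ M]

section Extension

variable [FiniteDimensional ℝ F] [ContMDiffVectorBundle ∞ F V 𝓘(ℝ, H)]

/-- The global section with components `χ a`, where `χ` is a cutoff function. -/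
def sec (χ : C^∞⟮𝓘(ℝ, H), M; ℝ⟯) (hχ : tsupport χ ⊆ 𝒞.φ.source) (a : M → F)
    (ha : ContMDiffOn 𝓘(ℝ, H) 𝓘(ℝ, F) ∞ a 𝒞.φ.source) : Sec H F V :=
  ⟨fun x => χ x • 𝒞.Ψ x (a x), by
    refine ContMDiffOn.smul_section_of_tsupport χ.contMDiff.contMDiffOn 𝒞.φ.open_source hχ ?_
    intro x hx
    refine (𝒞.contMDiffAt_section_of_Φ hx ?_).contMDiffWithinAt
    refine (ha.contMDiffAt (𝒞.φ.open_source.mem_nhds hx)).congr_of_eventuallyEq ?_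
    filter_upwards [𝒞.φ.open_source.mem_nhds hx] with y hy using 𝒞.right_inv y hy _⟩

lemma sec_apply (χ : C^∞⟮𝓘(ℝ, H), M; ℝ⟯) (hχ : tsupport χ ⊆ 𝒞.φ.source) (a : M → F)
    (ha : ContMDiffOn 𝓘(ℝ, H) 𝓘(ℝ, F) ∞ a 𝒞.φ.source) (x : M) :
    𝒞.sec χ hχ a ha x = χ x • 𝒞.Ψ x (a x) := rfl

/-- The global function `χ a`, where `χ` is a cutoff function. -/
def func (χ : C^∞⟮𝓘(ℝ, H), M; ℝ⟯) (hχ : tsupport χ ⊆ 𝒞.φ.source) (a : M → ℝ)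
    (ha : ContMDiffOn 𝓘(ℝ, H) 𝓘(ℝ, ℝ) ∞ a 𝒞.φ.source) : C^∞⟮𝓘(ℝ, H), M; ℝ⟯ :=
  ⟨fun x => χ x • a x, by
    refine contMDiff_of_tsupport fun x hx => ?_
    have hx' : x ∈ 𝒞.φ.source := hχ (tsupport_smul_subset_left χ a hx)
    exact χ.contMDiff.contMDiffAt.smul (ha.contMDiffAt (𝒞.φ.open_source.mem_nhds hx'))⟩

variable [FiniteDimensional ℝ H] [T2Space M]

lemma exists_func {a : M → ℝ} (ha : ContMDiffOn 𝓘(ℝ, H) 𝓘(ℝ, ℝ) ∞ a 𝒞.φ.source) {x : M}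
    (hx : x ∈ 𝒞.φ.source) : ∃ f : C^∞⟮𝓘(ℝ, H), M; ℝ⟯, ∀ᶠ y in 𝓝 x, f y = a y := by
  obtain ⟨χ, h1, h2⟩ := exists_smooth_bump (H := H) 𝒞.φ.open_source hx
  refine ⟨𝒞.func χ h2 a ha, ?_⟩
  filter_upwards [h1] with y hy
  change χ y • a y = a y
  rw [hy, one_smul]

/-- Sections with constant components near `p`. -/
lemma exists_frame {p : M} (hp : p ∈ 𝒞.φ.source) : ∃ (E : F →ₗ[ℝ] Sec H F V) (N : Set M),
    IsOpen N ∧ p ∈ N ∧ N ⊆ 𝒞.φ.source ∧ ∀ x ∈ N, ∀ u, 𝒞.Φ x (E u x) = u := by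
  obtain ⟨χ, h1, h2⟩ := exists_smooth_bump (H := H) 𝒞.φ.open_source hp
  obtain ⟨N, hN, hNo, hpN⟩ := eventually_nhds_iff.1 (h1.and (𝒞.φ.open_source.mem_nhds hp))
  refine ⟨{ toFun := fun u => 𝒞.sec χ h2 (fun _ => u) contMDiffOn_const, map_add' := fun u v => ?_,
            map_smul' := fun c u => ?_ }, N, hNo, hpN, fun x hx => (hN x hx).2, fun x hx u => ?_⟩
  · ext x
    simp [sec_apply]
  · ext x
    simp [sec_apply, smul_comm c]
  · change 𝒞.Φ x (𝒞.sec χ h2 (fun _ => u) contMDiffOn_const x) = u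
    rw [sec_apply, (hN x hx).1, one_smul, 𝒞.right_inv x (hN x hx).2]

end Extension

end Coords

end Coordinates

/-! ### Locality and coordinate expressions of derivations and brackets. -/

section Local

open Set

variable {H : Type*} [NormedAddCommGroup H] [NormedSpace ℝ H] [FiniteDimensional ℝ H]
  {M : Type*} [TopologicalSpace M] [T2Space M] [ChartedSpace H M] [IsManifold 𝓘(ℝ, H) ∞ M]
  {F : Type*} [NormedAddCommGroup F] [NormedSpace ℝ F]
  {V : M → Type*} [TopologicalSpace (TotalSpace F V)]
  [∀ x, AddCommGroup (V x)] [∀ x, Module ℝ (V x)]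
  [∀ x, TopologicalSpace (V x)] [FiberBundle F V] [VectorBundle ℝ F V]

/-- A section vanishing near `x` is a multiple of itself by a function vanishing at `x`. -/
lemma exists_fsmul_eq_self {α : Sec H F V} {x : M} (h : ∀ᶠ y in 𝓝 x, α y = 0) :
    ∃ f : C^∞⟮𝓘(ℝ, H), M; ℝ⟯, f x = 0 ∧ fsmul f α = α := by
  obtain ⟨O, hO, hOo, hxO⟩ := eventually_nhds_iff.1 h
  obtain ⟨χ, h1, h2⟩ := exists_smooth_bump (H := H) hOo hxO
  refine ⟨1 - χ, ?_, ?_⟩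
  -- The function `1 - χ` vanishes at `x`, and it equals `1` wherever `α` may be nonzero.
  · simp [h1.self_of_nhds]
  · ext y
    change (1 - χ y) • α y = α y
    by_cases hy : y ∈ O
    · simp [hO y hy]
    · have : χ y = 0 := by
        by_contra hne
        exact hy (h2 (subset_tsupport χ hne))
      simp [this]

/-- With `α = f α` and `f x = 0`, both Leibniz terms carry a factor vanishing at `x`, namely `f x`
or `α x`. The same device gives locality of the bracket in each argument. -/
lemma Der.toLin_eq_zero (D : Der H F V) {α : Sec H F V} {x : M} (h : ∀ᶠ y in 𝓝 x, α y = 0) :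
    D.toLin α x = 0 := by
  obtain ⟨f, hf, hα⟩ := exists_fsmul_eq_self h
  have := D.leibniz f α x
  rw [hα, hf, h.self_of_nhds] at this
  simpa using this

lemma Der.toLin_congr (D : Der H F V) {α β : Sec H F V} {x : M} (h : ∀ᶠ y in 𝓝 x, α y = β y) :
    D.toLin α x = D.toLin β x := by
  have h1 : D.toLin (α - β) x = 0 := D.toLin_eq_zero (h.mono fun y hy => by simp [hy])
  rw [map_sub] at h1
  exact sub_eq_zero.1 h1

namespace AlmostLodayAlgebroid

variable (A : AlmostLodayAlgebroid H F V)

lemma bracket_congr_left {α β : Sec H F V} (γ : Sec H F V) {x : M}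
    (h : ∀ᶠ y in 𝓝 x, α y = β y) : A.bracket α γ x = A.bracket β γ x := by
  have h0 : ∀ᶠ y in 𝓝 x, (α - β) y = 0 := h.mono fun y hy => by simp [hy]
  obtain ⟨f, hf, hα⟩ := exists_fsmul_eq_self h0
  have h1 := A.leibniz_left f (α - β) γ x
  rw [hα, hf, h0.self_of_nhds, map_sub] at h1
  refine sub_eq_zero.1 (Eq.trans ?_ (h1.trans ?_))
  · rfl
  · simp

lemma bracket_congr_right (γ : Sec H F V) {α β : Sec H F V} {x : M}
    (h : ∀ᶠ y in 𝓝 x, α y = β y) : A.bracket γ α x = A.bracket γ β x := by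
  have h0 : ∀ᶠ y in 𝓝 x, (α - β) y = 0 := h.mono fun y hy => by simp [hy]
  obtain ⟨f, hf, hα⟩ := exists_fsmul_eq_self h0
  have h1 := A.leibniz_right f γ (α - β) x
  rw [hα, hf, h0.self_of_nhds, map_sub] at h1
  refine sub_eq_zero.1 (Eq.trans ?_ (h1.trans ?_))
  · rfl
  · simp

end AlmostLodayAlgebroid

lemma sec_sum_apply {ι : Type*} (s : Finset ι) (α : ι → Sec H F V) (x : M) :
    (∑ i ∈ s, α i) x = ∑ i ∈ s, α i x :=
  map_sum ({ toFun := fun β => β x, map_zero' := rfl, map_add' := fun _ _ => rfl } :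
    Sec H F V →+ V x) α s

variable [FiniteDimensional ℝ F] [ContMDiffVectorBundle ∞ F V 𝓘(ℝ, H)]

namespace Coords

variable (𝒞 : Coords H F V)

/-- Near a point, a section is a combination of sections with constant components, with coefficients
the components of the section. -/
lemma exists_eventuallyEq_sum {E : F →ₗ[ℝ] Sec H F V} {N : Set M} (hN : IsOpen N)
    (hNs : N ⊆ 𝒞.φ.source) (hE : ∀ x ∈ N, ∀ u, 𝒞.Φ x (E u x) = u) (α : Sec H F V) {x : M}
    (hx : x ∈ N) : ∃ f : Fin (Module.finrank ℝ F) → C^∞⟮𝓘(ℝ, H), M; ℝ⟯,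
      (∀ i, ∀ᶠ y in 𝓝 x, f i y = (Module.finBasis ℝ F).coord i (𝒞.rep α (𝒞.φ y))) ∧
      ∀ᶠ y in 𝓝 x, α y = (∑ i, fsmul (f i) (E (Module.finBasis ℝ F i))) y := by
  let b := Module.finBasis ℝ F
  have h : ∀ i, ∃ f : C^∞⟮𝓘(ℝ, H), M; ℝ⟯, ∀ᶠ y in 𝓝 x,
      f y = (Module.finBasis ℝ F).coord i (𝒞.Φ y (α y)) := by
    intro i
    refine 𝒞.exists_func (fun y hy => ?_) (hNs hx)
    exact ((LinearMap.toContinuousLinearMap (b.coord i)).contDiff.contMDiff.contMDiffAt.comp y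
      (𝒞.contMDiffAt_Φ hy (α.contMDiff y))).contMDiffWithinAt
  choose f hf using h
  refine ⟨f, fun i => ?_, ?_⟩
  · filter_upwards [hf i, 𝒞.eventually_rep_φ α (hNs hx)] with y hy hy'
    rw [hy, hy']
  · filter_upwards [eventually_all.2 hf, hN.mem_nhds hx] with y hy hyN
    rw [sec_sum_apply, ← 𝒞.left_inv y (hNs hyN) (α y),
      ← 𝒞.left_inv y (hNs hyN) (∑ i, fsmul (f i) (E (Module.finBasis ℝ F i)) y), map_sum]
    congr 1
    conv_lhs => rw [← b.sum_repr (𝒞.Φ y (α y))]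
    refine Finset.sum_congr rfl fun i _ => ?_
    change _ = 𝒞.Φ y (f i y • E (Module.finBasis ℝ F i) y)
    rw [map_smul, hE y hyN, hy i]
    rfl

lemma differentiableAt_coord_rep (α : Sec H F V) {z : H} (hz : z ∈ 𝒞.φ.target) (ξ : F →ₗ[ℝ] ℝ) :
    DifferentiableAt ℝ (fun y => ξ (𝒞.rep α y)) z :=
  (LinearMap.toContinuousLinearMap ξ).differentiableAt.comp z
    ((𝒞.contDiffAt_rep_sec α hz).differentiableAt (by simp))

lemma fderiv_coord_rep (α : Sec H F V) {z : H} (hz : z ∈ 𝒞.φ.target) (ξ : F →ₗ[ℝ] ℝ) :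
    fderiv ℝ (fun y => ξ (𝒞.rep α y)) z =
      (LinearMap.toContinuousLinearMap ξ) ∘L fderiv ℝ (𝒞.rep α) z :=
  ((LinearMap.toContinuousLinearMap ξ).hasFDerivAt.comp z
    ((𝒞.contDiffAt_rep_sec α hz).differentiableAt (by simp)).hasFDerivAt).fderiv

/-- The local expression of a derivation. -/
lemma Φ_toLin {E : F →ₗ[ℝ] Sec H F V} {N : Set M} (hN : IsOpen N)
    (hNs : N ⊆ 𝒞.φ.source) (hE : ∀ x ∈ N, ∀ u, 𝒞.Φ x (E u x) = u) (D : Der H F V)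
    (α : Sec H F V) {x : M} (hx : x ∈ N) :
    𝒞.Φ x (D.toLin α x) = fderiv ℝ (𝒞.rep α) (𝒞.φ x) (𝒞.tangent.Φ x (D.symbol x)) +
      𝒞.Φ x (D.toLin (E (𝒞.Φ x (α x))) x) := by
  have hxs := hNs hx
  obtain ⟨f, hf, hα⟩ := 𝒞.exists_eventuallyEq_sum hN hNs hE α hx
  have hz := 𝒞.φ.map_source hxs
  let b := Module.finBasis ℝ F
  rw [D.toLin_congr hα, map_sum, sec_sum_apply, map_sum]
  have h1 : ∀ i, 𝒞.Φ x (D.toLin (fsmul (f i) (E (b i))) x) =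
      (b.repr (fderiv ℝ (𝒞.rep α) (𝒞.φ x) (𝒞.tangent.Φ x (D.symbol x))) i) • b i +
      (b.repr (𝒞.Φ x (α x)) i) • 𝒞.Φ x (D.toLin (E (b i)) x) := by
    intro i
    rw [D.leibniz, map_add, map_smul, map_smul, hE x hx, (hf i).self_of_nhds, 𝒞.rep_φ α hxs,
      𝒞.d_apply_of_eventuallyEq hxs (hf i) (𝒞.differentiableAt_coord_rep α hz _),
      𝒞.fderiv_coord_rep α hz, add_comm]
    rfl
  refine (Finset.sum_congr rfl fun i _ => h1 i).trans ?_
  rw [Finset.sum_add_distrib, b.sum_repr]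
  congr 1
  conv_rhs => rw [← b.sum_repr (𝒞.Φ x (α x))]
  simp only [map_sum, map_smul, sec_sum_apply]
  exact Finset.sum_congr rfl fun i _ => (map_smul (𝒞.Φ x) _ _).symm

/-- The anchor in local coordinates. -/
def anchor (A : AlmostLodayAlgebroid H F V) (x : M) : F →ₗ[ℝ] H :=
  𝒞.tangent.Φ x ∘ₗ A.anchor x ∘ₗ 𝒞.Ψ x

/-- The co-anchor in local coordinates. -/
def coanchor (A : AlmostLodayAlgebroid H F V) (x : M) (ξ : H →L[ℝ] ℝ) (u v : F) : F :=
  𝒞.Φ x (A.coanchor x (ξ ∘L mfderiv 𝓘(ℝ, H) 𝓘(ℝ, H) 𝒞.φ x) (𝒞.Ψ x u) (𝒞.Ψ x v))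

lemma anchor_Φ (A : AlmostLodayAlgebroid H F V) {x : M} (hx : x ∈ 𝒞.φ.source) (v : V x) :
    𝒞.anchor A x (𝒞.Φ x v) = 𝒞.tangent.Φ x (A.anchor x v) := by
  simp [anchor, 𝒞.left_inv x hx]

lemma d_eq_of_eventuallyEq {f : C^∞⟮𝓘(ℝ, H), M; ℝ⟯} {h : H → ℝ} {x : M} (hx : x ∈ 𝒞.φ.source)
    (hf : ∀ᶠ y in 𝓝 x, f y = h (𝒞.φ y)) (hh : DifferentiableAt ℝ h (𝒞.φ x)) :
    d f x = fderiv ℝ h (𝒞.φ x) ∘L mfderiv 𝓘(ℝ, H) 𝓘(ℝ, H) 𝒞.φ x :=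
  ContinuousLinearMap.ext fun v => 𝒞.d_apply_of_eventuallyEq hx hf hh v

/-- The right Leibniz rule in local coordinates. -/
lemma Φ_bracket_right {E : F →ₗ[ℝ] Sec H F V} {N : Set M} (hN : IsOpen N)
    (hNs : N ⊆ 𝒞.φ.source) (hE : ∀ x ∈ N, ∀ u, 𝒞.Φ x (E u x) = u)
    (A : AlmostLodayAlgebroid H F V) (γ α : Sec H F V) {x : M} (hx : x ∈ N) :
    𝒞.Φ x (A.bracket γ α x) = 𝒞.Φ x (A.bracket γ (E (𝒞.Φ x (α x))) x) +
      fderiv ℝ (𝒞.rep α) (𝒞.φ x) (𝒞.anchor A x (𝒞.Φ x (γ x))) := by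
  have hxs := hNs hx
  obtain ⟨f, hf, hα⟩ := 𝒞.exists_eventuallyEq_sum hN hNs hE α hx
  have hz := 𝒞.φ.map_source hxs
  let b := Module.finBasis ℝ F
  rw [A.bracket_congr_right γ hα, map_sum, sec_sum_apply, map_sum, 𝒞.anchor_Φ A hxs]
  have h1 : ∀ i, 𝒞.Φ x (A.bracket γ (fsmul (f i) (E (b i))) x) =
      (b.repr (𝒞.Φ x (α x)) i) • 𝒞.Φ x (A.bracket γ (E (b i)) x) +
      (b.repr (fderiv ℝ (𝒞.rep α) (𝒞.φ x) (𝒞.tangent.Φ x (A.anchor x (γ x)))) i) • b i := by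
    intro i
    rw [A.leibniz_right, map_add, map_smul, map_smul, hE x hx, (hf i).self_of_nhds, 𝒞.rep_φ α hxs,
      𝒞.d_apply_of_eventuallyEq hxs (hf i) (𝒞.differentiableAt_coord_rep α hz _),
      𝒞.fderiv_coord_rep α hz]
    rfl
  refine (Finset.sum_congr rfl fun i _ => h1 i).trans ?_
  rw [Finset.sum_add_distrib, b.sum_repr]
  congr 1
  conv_rhs => rw [← b.sum_repr (𝒞.Φ x (α x))]
  simp only [map_sum, map_smul, sec_sum_apply]
  exact Finset.sum_congr rfl fun i _ => (map_smul (𝒞.Φ x) _ _).symm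

/-- The left Leibniz rule in local coordinates. -/
lemma Φ_bracket_left {E : F →ₗ[ℝ] Sec H F V} {N : Set M} (hN : IsOpen N)
    (hNs : N ⊆ 𝒞.φ.source) (hE : ∀ x ∈ N, ∀ u, 𝒞.Φ x (E u x) = u)
    (A : AlmostLodayAlgebroid H F V) (α γ : Sec H F V) {x : M} (hx : x ∈ N) :
    𝒞.Φ x (A.bracket α γ x) = 𝒞.Φ x (A.bracket (E (𝒞.Φ x (α x))) γ x) -
      fderiv ℝ (𝒞.rep α) (𝒞.φ x) (𝒞.anchor A x (𝒞.Φ x (γ x))) +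
      ∑ i, 𝒞.coanchor A x ((LinearMap.toContinuousLinearMap ((Module.finBasis ℝ F).coord i)) ∘L
        fderiv ℝ (𝒞.rep α) (𝒞.φ x)) (Module.finBasis ℝ F i) (𝒞.Φ x (γ x)) := by
  have hxs := hNs hx
  obtain ⟨f, hf, hα⟩ := 𝒞.exists_eventuallyEq_sum hN hNs hE α hx
  have hz := 𝒞.φ.map_source hxs
  let b := Module.finBasis ℝ F
  rw [A.bracket_congr_left γ hα, map_sum, LinearMap.sum_apply, sec_sum_apply, map_sum,
    𝒞.anchor_Φ A hxs]
  have h1 : ∀ i, 𝒞.Φ x (A.bracket (fsmul (f i) (E (b i))) γ x) =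
      (b.repr (𝒞.Φ x (α x)) i) • 𝒞.Φ x (A.bracket (E (b i)) γ x) -
      (b.repr (fderiv ℝ (𝒞.rep α) (𝒞.φ x) (𝒞.tangent.Φ x (A.anchor x (γ x)))) i) • b i +
      𝒞.coanchor A x ((LinearMap.toContinuousLinearMap (b.coord i)) ∘L
        fderiv ℝ (𝒞.rep α) (𝒞.φ x)) (b i) (𝒞.Φ x (γ x)) := by
    intro i
    have h2 : 𝒞.Ψ x (b i) = E (b i) x := by
      conv_lhs => rw [← hE x hx (b i)]
      exact 𝒞.left_inv x hxs _
    rw [A.leibniz_left, map_add, map_sub, map_smul, map_smul, hE x hx, (hf i).self_of_nhds,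
      𝒞.rep_φ α hxs,
      𝒞.d_apply_of_eventuallyEq hxs (hf i) (𝒞.differentiableAt_coord_rep α hz _),
      𝒞.d_eq_of_eventuallyEq hxs (hf i) (𝒞.differentiableAt_coord_rep α hz _),
      𝒞.fderiv_coord_rep α hz, coanchor, 𝒞.left_inv x hxs, h2]
    rfl
  refine (Finset.sum_congr rfl fun i _ => h1 i).trans ?_
  rw [Finset.sum_add_distrib, Finset.sum_sub_distrib, b.sum_repr]
  congr 2
  conv_rhs => rw [← b.sum_repr (𝒞.Φ x (α x))]
  simp only [map_sum, map_smul, sec_sum_apply, LinearMap.sum_apply, LinearMap.smul_apply]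
  exact Finset.sum_congr rfl fun i _ => (map_smul (𝒞.Φ x) _ _).symm

end Coords

end Local

/-! ### The Euler field is a symmetry of the linear model. -/

section EulerModel

variable {H : Type*} [NormedAddCommGroup H] [NormedSpace ℝ H]
  {F : Type*} [NormedAddCommGroup F] [NormedSpace ℝ F]

lemma hasDerivAt_bilin {E₁ E₂ E₃ : Type*} [NormedAddCommGroup E₁] [NormedSpace ℝ E₁]
    [NormedAddCommGroup E₂] [NormedSpace ℝ E₂] [NormedAddCommGroup E₃] [NormedSpace ℝ E₃]
    [FiniteDimensional ℝ E₁] [FiniteDimensional ℝ E₂] (B : E₁ →ₗ[ℝ] E₂ →ₗ[ℝ] E₃)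
    {f : ℝ → E₁} {g : ℝ → E₂} {f' : E₁} {g' : E₂} {t : ℝ} (hf : HasDerivAt f f' t)
    (hg : HasDerivAt g g' t) :
    HasDerivAt (fun s => B (f s) (g s)) (B f' (g t) + B (f t) g') t := by
  let C : E₁ →L[ℝ] E₂ →L[ℝ] E₃ := LinearMap.toContinuousLinearMap
    ((LinearMap.toContinuousLinearMap : (E₂ →ₗ[ℝ] E₃) ≃ₗ[ℝ] (E₂ →L[ℝ] E₃)).toLinearMap ∘ₗ B)
  exact (C.hasFDerivAt.comp_hasDerivAt t hf).clm_apply hg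

/-- By the product rule and the symmetry of the second derivative, passing from `α` to its radial
derivative changes `dα` by radial differentiation plus one extra copy of `dα`. This copy accounts
for the weight of a differential under the Euler field. -/
lemma fderiv_fderiv_apply_self {α : H → F} {x : H} (hα : ContDiffAt ℝ ∞ α x) :
    fderiv ℝ (fun y => fderiv ℝ α y y) x = fderiv ℝ (fderiv ℝ α) x x + fderiv ℝ α x := by
  have h1 : HasFDerivAt (fderiv ℝ α) (fderiv ℝ (fderiv ℝ α) x) x :=
    ((hα.fderiv_right (m := ∞) (by simp)).differentiableAt (by simp)).hasFDerivAt
  have h3 : HasFDerivAt (fun y => fderiv ℝ α y y) _ x := h1.clm_apply (hasFDerivAt_id x)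
  rw [h3.fderiv]
  ext v
  have h2 := hα.isSymmSndFDerivAt (by
    rw [minSmoothness_of_isRCLikeNormedField]
    exact WithTop.coe_le_coe.2 (le_top (a := (2 : ℕ∞)))) v x
  simp [h2, add_comm]

variable [FiniteDimensional ℝ H] [FiniteDimensional ℝ F]

/-- The derivative in the direction of the Euler vector field is a derivation of the bracket given
by linear data. -/
lemma modelBracket_euler (a : F →ₗ[ℝ] F →ₗ[ℝ] F) (r : F →ₗ[ℝ] (H →L[ℝ] H))
    (l : (H →L[ℝ] ℝ) →ₗ[ℝ] F →ₗ[ℝ] F →ₗ[ℝ] (H →L[ℝ] F)) {α β : H → F} (hα : ContDiff ℝ ∞ α)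
    (hβ : ContDiff ℝ ∞ β) (x : H) :
    modelBracket a r l (fun y => fderiv ℝ α y y) β x +
      modelBracket a r l α (fun y => fderiv ℝ β y y) x =
      fderiv ℝ (modelBracket a r l α β) x x := by
  let c : ℝ → H := fun t => x + t • x
  have hc0 : c 0 = x := by simp [c]
  have hc : HasDerivAt c x 0 := by
    simpa [c] using ((hasDerivAt_id (0 : ℝ)).smul_const x).const_add x
  have hcompd : ∀ {f : H → F}, ContDiff ℝ ∞ f →
      HasDerivAt (fun t => fderiv ℝ f (c t)) (fderiv ℝ (fderiv ℝ f) x x) 0 := by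
    intro f hf
    have h1 : HasFDerivAt (fderiv ℝ f) (fderiv ℝ (fderiv ℝ f) x) (c 0) := by
      rw [hc0]
      exact ((hf.fderiv_right (m := ∞) (by simp)).differentiable (by simp) x).hasFDerivAt
    exact h1.comp_hasDerivAt (0 : ℝ) hc
  have hcompF : ∀ {f : H → F}, ContDiff ℝ ∞ f →
      HasDerivAt (fun t => f (c t)) (fderiv ℝ f x x) 0 := by
    intro f hf
    have h1 : HasFDerivAt f (fderiv ℝ f x) (c 0) := by
      rw [hc0]
      exact (hf.differentiable (by simp) x).hasFDerivAt
    exact h1.comp_hasDerivAt (0 : ℝ) hc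
  have hr : ∀ {f : H → F}, ContDiff ℝ ∞ f →
      HasDerivAt (fun t => r (f (c t)) (c t)) (r (fderiv ℝ f x x) x + r (f x) x) 0 := by
    intro f hf
    have h1 := ((LinearMap.toContinuousLinearMap r).hasFDerivAt.comp_hasDerivAt (0 : ℝ)
      (hcompF hf)).clm_apply hc
    simpa [hc0] using h1
  have hl : ∀ i, HasDerivAt (fun t => l ((LinearMap.toContinuousLinearMap
      ((Module.finBasis ℝ F).coord i)) ∘L fderiv ℝ α (c t)) (Module.finBasis ℝ F i) (β (c t)) (c t))
      (l ((LinearMap.toContinuousLinearMap ((Module.finBasis ℝ F).coord i)) ∘L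
          fderiv ℝ (fderiv ℝ α) x x) (Module.finBasis ℝ F i) (β x) x +
        l ((LinearMap.toContinuousLinearMap ((Module.finBasis ℝ F).coord i)) ∘L
          fderiv ℝ α x) (Module.finBasis ℝ F i) (fderiv ℝ β x x) x +
        l ((LinearMap.toContinuousLinearMap ((Module.finBasis ℝ F).coord i)) ∘L
          fderiv ℝ α x) (Module.finBasis ℝ F i) (β x) x) 0 := by
    intro i
    let B : (H →L[ℝ] F) →ₗ[ℝ] F →ₗ[ℝ] (H →L[ℝ] F) := LinearMap.mk₂ ℝ
      (fun (T : H →L[ℝ] F) (v : F) => l ((LinearMap.toContinuousLinearMap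
        ((Module.finBasis ℝ F).coord i)) ∘L T) (Module.finBasis ℝ F i) v)
      (fun S T v => by simp [ContinuousLinearMap.comp_add])
      (fun k T v => by simp)
      (fun T v w => by simp) (fun k T v => by simp)
    have h1 := (hasDerivAt_bilin B (hcompd hα) (hcompF hβ)).clm_apply hc
    simpa [hc0, B] using h1
  have key : HasDerivAt (fun t => modelBracket a r l α β (c t)) _ 0 :=
    (((hasDerivAt_bilin a (hcompF hα) (hcompF hβ)).add ((hcompd hβ).clm_apply (hr hα))).sub
      ((hcompd hα).clm_apply (hr hβ))).add (HasDerivAt.fun_sum fun i _ => hl i)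
  -- The bracket is differentiated along a curve through `x` with velocity `x`. The terms where the
  -- point itself is differentiated inside `r` and `l` match the extra copies of `dα` and `dβ` from
  -- `fderiv_fderiv_apply_self`; all others match termwise.
  rw [(hcompF (contDiff_modelBracket a r l hα hβ)).unique key]
  simp only [modelBracket, fderiv_fderiv_apply_self hα.contDiffAt, fderiv_fderiv_apply_self hβ.contDiffAt, hc0,
    ContinuousLinearMap.comp_add, map_add, LinearMap.add_apply, add_apply, Finset.sum_add_distrib]
  abel

end EulerModel

/-- Since `f z = 0`, the part `(K y - K z) (f y)` is `o(1) · O(‖y - z‖)`. Mere continuity of `K`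
suffices, and no derivative of `K` enters: this is why linear parts of vanishing sections are
insensitive to first-order changes of frame. -/
lemma hasFDerivAt_clm_apply_of_eq_zero {E W W' : Type*} [NormedAddCommGroup E] [NormedSpace ℝ E]
    [NormedAddCommGroup W] [NormedSpace ℝ W] [NormedAddCommGroup W'] [NormedSpace ℝ W']
    {K : E → W →L[ℝ] W'} {f : E → W} {f' : E →L[ℝ] W} {z : E} (hK : ContinuousAt K z)
    (hf : HasFDerivAt f f' z) (h0 : f z = 0) :
    HasFDerivAt (fun y => K y (f y)) (K z ∘L f') z := by
  have h1 : HasFDerivAt (fun y => K z (f y)) (K z ∘L f') z := (K z).hasFDerivAt.comp z hf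
  have h2 : HasFDerivAt (fun y => (K y - K z) (f y)) (0 : E →L[ℝ] W') z := by
    rw [hasFDerivAt_iff_isLittleO]
    simp only [h0, map_zero, sub_zero, zero_apply]
    have hO : f =O[𝓝 z] fun y => y - z := by
      simpa [h0] using hf.isBigO_sub
    have ho : (fun y => K y - K z) =o[𝓝 z] fun _ => (1 : ℝ) := by
      rw [Asymptotics.isLittleO_one_iff]
      have := hK.tendsto.sub (tendsto_const_nhds (x := K z))
      rwa [sub_self] at this
    have h3 : (fun y => ‖K y - K z‖ * ‖f y‖) =o[𝓝 z] fun y => (1 : ℝ) * ‖y - z‖ :=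
      ho.norm_left.mul_isBigO hO.norm_norm
    refine Asymptotics.IsLittleO.of_norm_right ((Asymptotics.IsBigO.of_bound 1
      (Eventually.of_forall fun y => ?_)).trans_isLittleO (h3.congr_right fun y => one_mul _))
    rw [one_mul, Real.norm_of_nonneg (by positivity)]
    exact ContinuousLinearMap.le_opNorm _ _
  refine (h1.add h2).congr_fderiv (by simp) |>.congr_of_eventuallyEq (Eventually.of_forall fun y => ?_)
  simp

/-! ### Changes of coordinates and the preferred chart and trivialization. -/

section Charts

open Set

variable {H : Type*} [NormedAddCommGroup H] [NormedSpace ℝ H]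
  {M : Type*} [TopologicalSpace M] [ChartedSpace H M] [IsManifold 𝓘(ℝ, H) ∞ M]
  {F : Type*} [NormedAddCommGroup F] [NormedSpace ℝ F]
  {V : M → Type*} [TopologicalSpace (TotalSpace F V)]
  [∀ x, AddCommGroup (V x)] [∀ x, Module ℝ (V x)]
  [∀ x, TopologicalSpace (V x)] [FiberBundle F V] [VectorBundle ℝ F V]

namespace Coords

section Transition

variable (𝒞 𝒞' : Coords H F V)

lemma contDiffAt_transition {x : M} (hx : x ∈ 𝒞.φ.source) (hx' : x ∈ 𝒞'.φ.source) :
    ContDiffAt ℝ ∞ (𝒞'.φ ∘ 𝒞.φ.symm) (𝒞.φ x) := by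
  have h1 : ContMDiffAt 𝓘(ℝ, H) 𝓘(ℝ, H) ∞ 𝒞'.φ (𝒞.φ.symm (𝒞.φ x)) := by
    rw [𝒞.φ.left_inv hx]
    exact 𝒞'.contMDiffAt_φ hx'
  exact contMDiffAt_iff_contDiffAt.1 (h1.comp (𝒞.φ x) (𝒞.contMDiffAt_φ_symm (𝒞.φ.map_source hx)))

lemma tangent_Φ_eq {x : M} (hx : x ∈ 𝒞.φ.source) (hx' : x ∈ 𝒞'.φ.source)
    (v : TangentSpace 𝓘(ℝ, H) x) : 𝒞'.tangent.Φ x v =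
      fderiv ℝ (𝒞'.φ ∘ 𝒞.φ.symm) (𝒞.φ x) (𝒞.tangent.Φ x v) := by
  have h1 := ((𝒞.contMDiffAt_φ hx).mdifferentiableAt (by simp)).hasMFDerivAt
  have h2 := (((𝒞.contDiffAt_transition 𝒞' hx hx').differentiableAt
    (by simp)).hasFDerivAt.hasMFDerivAt.comp x h1)
  have h3 : HasMFDerivAt 𝓘(ℝ, H) 𝓘(ℝ, H) 𝒞'.φ x _ := h2.congr_of_eventuallyEq (by
    filter_upwards [𝒞.φ.open_source.mem_nhds hx] with y hy
    simp [𝒞.φ.left_inv hy])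
  rw [tangent_Φ, h3.mfderiv]
  rfl

/-- Both transition derivatives express the same tangent vector in the other coordinates, so their
composite is the identity. -/
lemma fderiv_transition_comp {x : M} (hx : x ∈ 𝒞.φ.source) (hx' : x ∈ 𝒞'.φ.source) :
    fderiv ℝ (𝒞'.φ ∘ 𝒞.φ.symm) (𝒞.φ x) ∘L fderiv ℝ (𝒞.φ ∘ 𝒞'.φ.symm) (𝒞'.φ x) =
      ContinuousLinearMap.id ℝ H := by
  ext w
  have h := 𝒞'.tangent.right_inv x hx' w
  conv_rhs => rw [ContinuousLinearMap.id_apply, ← h]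
  rw [𝒞.tangent_Φ_eq 𝒞' hx hx', 𝒞'.tangent_Φ_eq 𝒞 hx' hx, h]
  rfl

end Transition

end Coords

/-- The coordinates given by the preferred chart and trivialization at `p`. -/
def stdCoords [ContMDiffVectorBundle ∞ F V 𝓘(ℝ, H)] (p : M) : Coords H F V where
  φ := (chartAt H p).restrOpen (trivializationAt F V p).baseSet
    (trivializationAt F V p).open_baseSet
  Φ x := (trivializationAt F V p).linearMapAt ℝ x
  Ψ x := (trivializationAt F V p).symmₗ ℝ x
  contMDiffOn := (contMDiffOn_chart (I := 𝓘(ℝ, H)) (x := p)).mono fun x hx => hx.1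
  contMDiffOn_symm := (contMDiffOn_chart_symm (I := 𝓘(ℝ, H)) (x := p)).mono fun x hx => hx.1
  left_inv x hx v := (trivializationAt F V p).symmₗ_linearMapAt hx.2 v
  right_inv x hx u := (trivializationAt F V p).linearMapAt_symmₗ hx.2 u
  contMDiffOn_total := by
    have h := (trivializationAt F V p).contMDiffOn (n := ∞) (IB := 𝓘(ℝ, H))
    rw [(trivializationAt F V p).source_eq] at h
    refine (contMDiff_snd.comp_contMDiffOn (h.mono fun v hv => hv.2)).congr fun v hv => ?_
    rw [(trivializationAt F V p).coe_linearMapAt_of_mem hv.2]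
    rfl

variable [ContMDiffVectorBundle ∞ F V 𝓘(ℝ, H)]

variable (F V) in
lemma mem_stdCoords_source (p : M) : p ∈ (stdCoords (F := F) (V := V) p : Coords H F V).φ.source :=
  ⟨mem_chart_source H p, FiberBundle.mem_baseSet_trivializationAt' p⟩

lemma linPart_eq_fderiv_rep (p : M) (s : ∀ x, V x) :
    linPart (H := H) F p s = fderiv ℝ ((stdCoords p : Coords H F V).rep s)
      ((stdCoords p : Coords H F V).φ p) := by
  have h := coords_eventually (H := H) (F := F) (V := V) p
  have h2 : extChartAt 𝓘(ℝ, H) p p = (stdCoords p : Coords H F V).φ p := by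
    simp [stdCoords, mfld_simps]
  unfold linPart
  rw [h2] at h ⊢
  refine Filter.EventuallyEq.fderiv_eq ?_
  filter_upwards [h] with y hy
  have hy' : (chartAt H p).symm y ∈ (trivializationAt F V p).baseSet := by
    simpa [mfld_simps] using hy
  change _ = (trivializationAt F V p).linearMapAt ℝ ((chartAt H p).symm y)
    (s ((chartAt H p).symm y))
  rw [(trivializationAt F V p).coe_linearMapAt_of_mem hy']
  simp [mfld_simps]

-- Over the chart domain the preferred trivialization of the tangent bundle is the differential of
-- the chart. Hence the trivialization induced by the coordinates for `V`, whose domain may be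
-- smaller, has the same germ at `p` and computes the same linear part.
variable (F V) in
lemma linPart_tangent_eq_fderiv_rep (p : M) (X : ∀ x : M, TangentSpace 𝓘(ℝ, H) x) :
    linPart (H := H) H p X = fderiv ℝ ((stdCoords p : Coords H F V).tangent.rep X)
      ((stdCoords p : Coords H F V).φ p) := by
  have h := coords_eventually (H := H) (F := H) (V := (TangentSpace 𝓘(ℝ, H) : M → Type _)) p
  have h2 : extChartAt 𝓘(ℝ, H) p p = (stdCoords p : Coords H F V).φ p := by
    simp [stdCoords, mfld_simps]
  unfold linPart
  rw [h2] at h ⊢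
  refine Filter.EventuallyEq.fderiv_eq ?_
  filter_upwards [h] with y hy
  have hy' : (chartAt H p).symm y ∈
      (trivializationAt H (TangentSpace 𝓘(ℝ, H) : M → Type _) p).baseSet := by
    simpa [mfld_simps] using hy
  have hy2 : (chartAt H p).symm y ∈ (chartAt H p).source := by
    simpa using hy'
  change _ = mfderiv 𝓘(ℝ, H) 𝓘(ℝ, H) (chartAt H p) ((chartAt H p).symm y)
    (X ((chartAt H p).symm y))
  have h3 := TangentBundle.continuousLinearMapAt_trivializationAt (I := 𝓘(ℝ, H)) hy2
  have h4 : (extChartAt 𝓘(ℝ, H) p : M → H) = chartAt H p := by simp [mfld_simps]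
  rw [h4] at h3
  refine Eq.trans ?_ (DFunLike.congr_fun h3 (X ((chartAt H p).symm y)))
  rw [Trivialization.continuousLinearMapAt_apply, Trivialization.coe_linearMapAt_of_mem _ hy']
  simp [mfld_simps]
  rfl

end Charts

/-! ### From a linear model to an Euler-like derivation. -/

section EulerDerivation

open Set

variable {H : Type*} [NormedAddCommGroup H] [NormedSpace ℝ H] [FiniteDimensional ℝ H]
  {M : Type*} [TopologicalSpace M] [ChartedSpace H M] [IsManifold 𝓘(ℝ, H) ∞ M]
  {F : Type*} [NormedAddCommGroup F] [NormedSpace ℝ F] [FiniteDimensional ℝ F]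
  {V : M → Type*} [TopologicalSpace (TotalSpace F V)]
  [∀ x, AddCommGroup (V x)] [∀ x, Module ℝ (V x)]
  [∀ x, TopologicalSpace (V x)] [FiberBundle F V] [VectorBundle ℝ F V]
  [ContMDiffVectorBundle ∞ F V 𝓘(ℝ, H)]

namespace Coords

variable (𝒞 : Coords H F V)

lemma contDiffAt_fderiv_rep_self (α : Sec H F V) {z : H} (hz : z ∈ 𝒞.φ.target) :
    ContDiffAt ℝ ∞ (fun y => fderiv ℝ (𝒞.rep α) y y) z :=
  ((𝒞.contDiffAt_rep_sec α hz).fderiv_right (m := ∞) (by simp)).clm_apply contDiffAt_id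

lemma contMDiffOn_fderiv_rep_self (α : Sec H F V) : ContMDiffOn 𝓘(ℝ, H) 𝓘(ℝ, F) ∞
    (fun x => fderiv ℝ (𝒞.rep α) (𝒞.φ x) (𝒞.φ x)) 𝒞.φ.source := fun x hx =>
  ((𝒞.contDiffAt_fderiv_rep_self α (𝒞.φ.map_source hx)).contMDiffAt.comp x
    (𝒞.contMDiffAt_φ hx)).contMDiffWithinAt

lemma rep_add (α β : ∀ x, V x) : 𝒞.rep (fun x => α x + β x) = 𝒞.rep α + 𝒞.rep β := by
  ext z
  simp [rep]

lemma rep_smul (f : M → ℝ) (α : ∀ x, V x) :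
    𝒞.rep (fun x => f x • α x) = fun z => f (𝒞.φ.symm z) • 𝒞.rep α z := by
  ext z
  simp [rep]

lemma differentiableAt_comp_symm (f : C^∞⟮𝓘(ℝ, H), M; ℝ⟯) {z : H} (hz : z ∈ 𝒞.φ.target) :
    DifferentiableAt ℝ (fun y => f (𝒞.φ.symm y)) z :=
  (contMDiffAt_iff_contDiffAt.1 (f.contMDiff.contMDiffAt.comp z
    (𝒞.contMDiffAt_φ_symm hz))).differentiableAt (by simp)

/-- The derivation of `V` which is the derivative along the Euler vector field in the coordinates
`𝒞`, cut off by `χ`. -/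
def euler (χ : C^∞⟮𝓘(ℝ, H), M; ℝ⟯) (hχ : tsupport χ ⊆ 𝒞.φ.source) : Der H F V where
  toLin :=
    { toFun := fun α => 𝒞.sec χ hχ _ (𝒞.contMDiffOn_fderiv_rep_self α)
      map_add' := fun α β => by
        ext x
        change χ x • 𝒞.Ψ x (fderiv ℝ (𝒞.rep (fun x => α x + β x)) _ _) =
          χ x • 𝒞.Ψ x _ + χ x • 𝒞.Ψ x _
        by_cases hx : x ∈ 𝒞.φ.source
        · have hz := 𝒞.φ.map_source hx
          rw [𝒞.rep_add, fderiv_add ((𝒞.contDiffAt_rep_sec α hz).differentiableAt (by simp))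
            ((𝒞.contDiffAt_rep_sec β hz).differentiableAt (by simp)), add_apply, map_add, smul_add]
        · simp [image_eq_zero_of_notMem_tsupport fun h => hx (hχ h)]
      map_smul' := fun c α => by
        ext x
        change χ x • 𝒞.Ψ x (fderiv ℝ (𝒞.rep (fun x => c • α x)) _ _) = c • χ x • 𝒞.Ψ x _
        by_cases hx : x ∈ 𝒞.φ.source
        · have hz := 𝒞.φ.map_source hx
          rw [𝒞.rep_smul (fun _ => c), fderiv_fun_const_smul
            ((𝒞.contDiffAt_rep_sec α hz).differentiableAt (by simp)), smul_apply, map_smul,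
            smul_comm]
        · simp [image_eq_zero_of_notMem_tsupport fun h => hx (hχ h)] }
  symbol x := χ x • 𝒞.tangent.Ψ x (𝒞.φ x)
  symbol_smooth := (𝒞.tangent.sec χ hχ 𝒞.φ 𝒞.contMDiffOn).contMDiff
  leibniz f α x := by
    change χ x • 𝒞.Ψ x (fderiv ℝ (𝒞.rep (fun x => f x • α x)) _ _) =
      f x • (χ x • 𝒞.Ψ x _) + _
    by_cases hx : x ∈ 𝒞.φ.source
    · have hz := 𝒞.φ.map_source hx
      have hd := 𝒞.differentiableAt_comp_symm f hz
      have hf : ∀ᶠ y in 𝓝 x, f y = (fun z => f (𝒞.φ.symm z)) (𝒞.φ y) := by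
        filter_upwards [𝒞.φ.open_source.mem_nhds hx] with y hy
        rw [𝒞.φ.left_inv hy]
      rw [𝒞.rep_smul f, fderiv_fun_smul hd
        ((𝒞.contDiffAt_rep_sec α hz).differentiableAt (by simp)),
        𝒞.d_apply_of_eventuallyEq hx hf hd, map_smul, 𝒞.tangent.right_inv x hx]
      simp only [add_apply, smul_apply, ContinuousLinearMap.smulRight_apply, map_add, map_smul,
        𝒞.φ.left_inv hx, 𝒞.rep_φ α hx, 𝒞.left_inv x hx, smul_add, smul_smul, smul_eq_mul]
      congr 2
      ring
    · simp [image_eq_zero_of_notMem_tsupport fun h => hx (hχ h)]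

variable (χ : C^∞⟮𝓘(ℝ, H), M; ℝ⟯) (hχ : tsupport χ ⊆ 𝒞.φ.source)

lemma Φ_euler {x : M} (hx : x ∈ 𝒞.φ.source) (h1 : χ x = 1) (α : Sec H F V) :
    𝒞.Φ x ((𝒞.euler χ hχ).toLin α x) = fderiv ℝ (𝒞.rep α) (𝒞.φ x) (𝒞.φ x) := by
  change 𝒞.Φ x (χ x • 𝒞.Ψ x _) = _
  rw [h1, one_smul, 𝒞.right_inv x hx]

/-- In the standard coordinates the symbol near `p` is `dτ(κ(z)) κ(z)`, with `κ` the transition to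
`𝒞` and `τ` its inverse. As `κ` vanishes at `p`, its linearization there is `dτ ∘ dκ = id`. The
fibre part vanishes because a derivative is evaluated on the zero vector. -/
lemma euler_isEulerLikeAt [T2Space M] {p : M} (hp : p ∈ 𝒞.φ.source) (hp0 : 𝒞.φ p = 0)
    (h1 : ∀ᶠ x in 𝓝 p, χ x = 1) : (𝒞.euler χ hχ).IsEulerLikeAt p := by
  refine ⟨?_, ?_, ?_⟩
  · change χ p • 𝒞.tangent.Ψ p (𝒞.φ p) = 0
    rw [hp0, map_zero, smul_zero]
  · rw [linPart_tangent_eq_fderiv_rep F V]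
    let 𝒞₀ : Coords H F V := stdCoords p
    have hp₀ : p ∈ 𝒞₀.φ.source := mem_stdCoords_source F V p
    let τ : H → H := 𝒞₀.φ ∘ 𝒞.φ.symm
    let κ : H → H := 𝒞.φ ∘ 𝒞₀.φ.symm
    have hτ : ContDiffAt ℝ ∞ τ (𝒞.φ p) := 𝒞.contDiffAt_transition 𝒞₀ hp hp₀
    have hκ : ContDiffAt ℝ ∞ κ (𝒞₀.φ p) := 𝒞₀.contDiffAt_transition 𝒞 hp₀ hp
    have hκp : κ (𝒞₀.φ p) = 𝒞.φ p := by simp [κ, 𝒞₀.φ.left_inv hp₀]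
    have hK : ContinuousAt (fun z => fderiv ℝ τ (κ z)) (𝒞₀.φ p) := by
      refine ContinuousAt.comp ?_ hκ.continuousAt
      rw [hκp]
      exact (hτ.fderiv_right (m := ∞) (by simp)).continuousAt
    have h2 := hasFDerivAt_clm_apply_of_eq_zero hK (hκ.differentiableAt (by simp)).hasFDerivAt
      (hκp.trans hp0)
    rw [hκp, 𝒞.fderiv_transition_comp 𝒞₀ hp hp₀] at h2
    refine (h2.congr_of_eventuallyEq ?_).fderiv
    have hz := 𝒞₀.φ.map_source hp₀
    have hc : Tendsto 𝒞₀.φ.symm (𝓝 (𝒞₀.φ p)) (𝓝 p) := by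
      have := (𝒞₀.contMDiffAt_φ_symm hz).continuousAt.tendsto
      rwa [𝒞₀.φ.left_inv hp₀] at this
    filter_upwards [hc.eventually h1, hc.eventually (𝒞.φ.open_source.mem_nhds hp),
      hc.eventually (𝒞₀.φ.open_source.mem_nhds hp₀)] with z h3 h4 h5
    change 𝒞₀.tangent.Φ (𝒞₀.φ.symm z) (χ (𝒞₀.φ.symm z) • 𝒞.tangent.Ψ (𝒞₀.φ.symm z)
      (𝒞.φ (𝒞₀.φ.symm z))) = fderiv ℝ τ (κ z) (κ z)
    rw [h3, one_smul, 𝒞.tangent_Φ_eq 𝒞₀ h4 h5, 𝒞.tangent.right_inv _ h4]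
    rfl
  · ext u
    change (trivializationAt F V p).linearMapAt ℝ p (χ p • 𝒞.Ψ p
      (fderiv ℝ (𝒞.rep (frame (H := H) (V := V) p u)) (𝒞.φ p) (𝒞.φ p))) = 0
    rw [hp0]
    simp

/-- Coordinates given by an isomorphism onto a trivial bundle. -/
def ofIso (φ : OpenPartialHomeomorph M H) (Φ : ∀ x : M, V x →ₗ[ℝ] F)
    (h1 : ContMDiffOn 𝓘(ℝ, H) 𝓘(ℝ, H) ∞ φ φ.source)
    (h2 : ContMDiffOn 𝓘(ℝ, H) 𝓘(ℝ, H) ∞ φ.symm φ.target)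
    (h3 : ∀ x ∈ φ.source, Function.Bijective (Φ x))
    (h4 : ContMDiffOn (𝓘(ℝ, H).prod 𝓘(ℝ, F)) (𝓘(ℝ, H).prod 𝓘(ℝ, F)) ∞
      (fun v : TotalSpace F V => (⟨φ v.proj, Φ v.proj v.snd⟩ : TotalSpace F (Trivial H F)))
      (TotalSpace.proj ⁻¹' φ.source)) : Coords H F V where
  φ := φ
  Φ := Φ
  Ψ x := open Classical in
    if h : Function.Bijective (Φ x) then (LinearEquiv.ofBijective (Φ x) h).symm.toLinearMap else 0
  contMDiffOn := h1
  contMDiffOn_symm := h2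
  left_inv x hx v := by
    rw [dif_pos (h3 x hx)]
    exact (LinearEquiv.ofBijective (Φ x) (h3 x hx)).symm_apply_apply v
  right_inv x hx u := by
    rw [dif_pos (h3 x hx)]
    exact (LinearEquiv.ofBijective (Φ x) (h3 x hx)).apply_symm_apply u
  contMDiffOn_total v hv := (contMDiffWithinAt_totalSpace.1 (h4 v hv)).2

end Coords

variable [T2Space M]

/-- Near a point, a section has the components of a smooth section of the trivial bundle. -/
lemma Coords.exists_eventuallyEq_comp (𝒞 : Coords H F V) (α : Sec H F V) {x : M}
    (hx : x ∈ 𝒞.φ.source) :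
    ∃ a : H → F, ContDiff ℝ ∞ a ∧ ∀ᶠ y in 𝓝 x, 𝒞.Φ y (α y) = a (𝒞.φ y) := by
  obtain ⟨a, ha, hae⟩ := exists_contDiff_eventuallyEq 𝒞.φ.open_target (𝒞.contDiffOn_rep_sec α)
    (𝒞.φ.map_source hx)
  refine ⟨a, ha, ?_⟩
  filter_upwards [𝒞.eventually_rep_φ α hx,
    (𝒞.contMDiffAt_φ hx).continuousAt.eventually hae] with y h1 h2
  rw [h1, h2]

/-- If `𝔞` is isomorphic to the bracket given by linear data, the derivative along the Euler vector
field is an Euler-like derivation of `𝔞`. -/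
theorem exists_eulerLike_of_locallyIsomorphic_model (A : AlmostLodayAlgebroid H F V) (p : M)
    (a : F →ₗ[ℝ] F →ₗ[ℝ] F) (r : F →ₗ[ℝ] (H →L[ℝ] H))
    (l : (H →L[ℝ] ℝ) →ₗ[ℝ] F →ₗ[ℝ] F →ₗ[ℝ] (H →L[ℝ] F))
    (h : LocallyIsomorphic A p (model a r l) (0 : H)) :
    ∃ D : Der H F V, D.IsEulerLikeAt p ∧ ∃ U : Set M, IsOpen U ∧ p ∈ U ∧
      ∀ α β : Sec H F V, ∀ x ∈ U, A.lieDeriv D α β x = 0 := by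
  obtain ⟨φ, Φ, hp, hp0, h1, h2, h3, h4, h5⟩ := h
  let 𝒞 : Coords H F V := Coords.ofIso φ Φ h1 h2 h3 h4
  obtain ⟨χ, hχ1, hχ⟩ := exists_smooth_bump (H := H) φ.open_source hp
  obtain ⟨U, hU, hUo, hpU⟩ := eventually_nhds_iff.1 (hχ1.and (φ.open_source.mem_nhds hp))
  let D := 𝒞.euler χ hχ
  refine ⟨D, 𝒞.euler_isEulerLikeAt χ hχ hp hp0 hχ1, U, hUo, hpU, fun α β x hx => ?_⟩
  have hxs : x ∈ 𝒞.φ.source := (hU x hx).2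
  obtain ⟨α', hα', hαe⟩ := 𝒞.exists_eventuallyEq_comp α hxs
  obtain ⟨β', hβ', hβe⟩ := 𝒞.exists_eventuallyEq_comp β hxs
  -- The bracket is identified with the model bracket as a germ rather than at `x` alone, because
  -- the third term of the Lie derivative applies `D` to it.
  have hbr : ∀ {γ δ : Sec H F V} {c e : H → F}, ContDiff ℝ ∞ c → ContDiff ℝ ∞ e →
      (∀ᶠ y in 𝓝 x, 𝒞.Φ y (γ y) = c (𝒞.φ y)) → (∀ᶠ y in 𝓝 x, 𝒞.Φ y (δ y) = e (𝒞.φ y)) →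
      ∀ᶠ y in 𝓝 x, 𝒞.Φ y (A.bracket γ δ y) = modelBracket a r l c e (𝒞.φ y) := by
    intro γ δ c e hc he hγ hδ
    filter_upwards [hγ.eventually_nhds, hδ.eventually_nhds, 𝒞.φ.open_source.mem_nhds hxs]
      with y hy1 hy2 hy3
    exact h5 y hy3 γ δ (ofFn c hc) (ofFn e he) hy1 hy2
  have hder : ∀ {γ : Sec H F V} {c : H → F}, ContDiff ℝ ∞ c →
      (∀ᶠ y in 𝓝 x, 𝒞.Φ y (γ y) = c (𝒞.φ y)) →
      ∀ᶠ y in 𝓝 x, 𝒞.Φ y (D.toLin γ y) = (fun z => fderiv ℝ c z z) (𝒞.φ y) := by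
    intro γ c hc hγ
    filter_upwards [hγ.eventually_nhds, hUo.mem_nhds hx] with y hy1 hy2
    have hys : y ∈ 𝒞.φ.source := (hU y hy2).2
    rw [𝒞.Φ_euler χ hχ hys (hU y hy2).1]
    have hz := 𝒞.φ.map_source hys
    have hcont : Tendsto 𝒞.φ.symm (𝓝 (𝒞.φ y)) (𝓝 y) := by
      have := (𝒞.contMDiffAt_φ_symm hz).continuousAt.tendsto
      rwa [𝒞.φ.left_inv hys] at this
    have : 𝒞.rep γ =ᶠ[𝓝 (𝒞.φ y)] c := by
      filter_upwards [hcont.eventually hy1, 𝒞.φ.open_target.mem_nhds hz] with z hz1 hz2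
      rw [𝒞.φ.right_inv hz2] at hz1
      exact hz1
    rw [this.fderiv_eq]
  have hE : ∀ {c : H → F}, ContDiff ℝ ∞ c → ContDiff ℝ ∞ (fun z => fderiv ℝ c z z) := fun hc =>
    (hc.fderiv_right (m := ∞) (by simp)).clm_apply contDiff_id
  have e1 := (hbr (hE hα') hβ' (hder hα' hαe) hβe).self_of_nhds
  have e2 := (hbr hα' (hE hβ') hαe (hder hβ' hβe)).self_of_nhds
  have e3 := (hder (contDiff_modelBracket a r l hα' hβ') (hbr hα' hβ' hαe hβe)).self_of_nhds
  rw [← 𝒞.Φ_eq_zero_iff hxs]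
  change 𝒞.Φ x (A.bracket (D.toLin α) β x + A.bracket α (D.toLin β) x -
    D.toLin (A.bracket α β) x) = 0
  rw [map_sub, map_add, e1, e2, e3, modelBracket_euler a r l hα' hβ', sub_self]

end EulerDerivation

/-! ### Homogeneous smooth functions and vanishing linear parts. -/

section RadialFunctions

variable {E : Type*} [NormedAddCommGroup E] [NormedSpace ℝ E]
  {W : Type*} [NormedAddCommGroup W] [NormedSpace ℝ W]

/-- A smooth function on a ball which is homogeneous of degree `0` is constant. -/
lemma eq_of_fderiv_apply_self_eq_zero {f : E → W} {r : ℝ}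
    (hf : ∀ z ∈ Metric.ball (0 : E) r, ContDiffAt ℝ ∞ f z)
    (h : ∀ z ∈ Metric.ball (0 : E) r, fderiv ℝ f z z = 0) {z : E} (hz : z ∈ Metric.ball (0 : E) r) :
    f z = f 0 := by
  have h0 : (0 : E) ∈ Metric.ball (0 : E) r := by
    simpa using (norm_nonneg z).trans_lt (mem_ball_zero_iff.1 hz)
  have hd0 : fderiv ℝ f 0 = 0 := by
    -- The hypothesis at `z = 0` says nothing about `df_0`; differentiating the identity `df_y(y) =
    -- 0` at `y = 0` gives `df_0 = 0`.
    have h1 := hasFDerivAt_clm_apply_of_eq_zero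
      ((hf 0 h0).fderiv_right (m := ∞) (by simp)).continuousAt (hasFDerivAt_id (0 : E)) rfl
    have h2 : (fun y => fderiv ℝ f y (id y)) =ᶠ[𝓝 0] fun _ => (0 : W) := by
      filter_upwards [Metric.isOpen_ball.mem_nhds h0] with y hy using h y hy
    have h3 := h1.unique ((hasFDerivAt_const (0 : W) (0 : E)).congr_of_eventuallyEq h2)
    simpa using h3
  have hmem : ∀ t ∈ Set.Icc (0 : ℝ) 1, t • z ∈ Metric.ball (0 : E) r := fun t ht =>
    (convex_ball (0 : E) r).smul_mem_of_zero_mem h0 hz ht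
  have hd : ∀ t ∈ Set.Icc (0 : ℝ) 1, HasDerivAt (fun s : ℝ => f (s • z)) 0 t := by
    intro t ht
    have h1 := ((hf _ (hmem t ht)).differentiableAt (by simp)).hasFDerivAt.comp_hasDerivAt t
      ((hasDerivAt_id t).smul_const z)
    refine h1.congr_deriv ?_
    rcases eq_or_ne t 0 with rfl | hne
    · simp [hd0]
    · have h2 := h _ (hmem t ht)
      rw [map_smul] at h2
      simpa using (smul_eq_zero.1 h2).resolve_left hne
  have h4 := constant_of_has_deriv_right_zero (f := fun s : ℝ => f (s • z)) (a := 0) (b := 1)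
    (fun t ht => (hd t ht).continuousAt.continuousWithinAt)
    (fun t ht => (hd t ⟨ht.1, ht.2.le⟩).hasDerivWithinAt) 1 ⟨zero_le_one, le_rfl⟩
  simpa using h4

/-- A smooth function on a ball which is homogeneous of degree `1` is linear. -/
lemma eq_fderiv_zero_of_fderiv_apply_self_eq {f : E → W} {r : ℝ}
    (hf : ∀ z ∈ Metric.ball (0 : E) r, ContDiffAt ℝ ∞ f z)
    (h : ∀ z ∈ Metric.ball (0 : E) r, fderiv ℝ f z z = f z) {z : E}
    (hz : z ∈ Metric.ball (0 : E) r) : f z = fderiv ℝ f 0 z := by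
  -- Weight 1 for `f` means weight 0 for `df`, so `df` is constant and `f(z) = df_z(z) = df_0(z)`.
  have h1 : ∀ z ∈ Metric.ball (0 : E) r, fderiv ℝ (fderiv ℝ f) z z = 0 := by
    intro y hy
    have h2 : (fun w => fderiv ℝ f w w) =ᶠ[𝓝 y] f := by
      filter_upwards [Metric.isOpen_ball.mem_nhds hy] with w hw using h w hw
    have h3 := h2.fderiv_eq (𝕜 := ℝ)
    rw [fderiv_fderiv_apply_self (hf y hy)] at h3
    simpa using h3
  rw [← eq_of_fderiv_apply_self_eq_zero
    (fun y hy => (hf y hy).fderiv_right (𝕜 := ℝ) (m := ∞) (by simp)) h1 hz, h z hz]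

lemma apply_eq_fderiv_zero_of_eq_clm {W' : Type*} [NormedAddCommGroup W'] [NormedSpace ℝ W']
    {f : E → W} {s : Set E} (hs : s ∈ 𝓝 0) (hf : DifferentiableAt ℝ f 0) (ξ : W →L[ℝ] W')
    (L : E →L[ℝ] W') (h : ∀ z ∈ s, ξ (f z) = L z) {z : E} (hz : z ∈ s) :
    ξ (f z) = ξ (fderiv ℝ f 0 z) := by
  have h1 : HasFDerivAt (fun z => ξ (f z)) (ξ ∘L fderiv ℝ f 0) 0 := ξ.hasFDerivAt.comp 0 hf.hasFDerivAt
  have h2 : (fun z => ξ (f z)) =ᶠ[𝓝 0] L := by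
    filter_upwards [hs] with w hw using h w hw
  have h3 := h1.unique (L.hasFDerivAt.congr_of_eventuallyEq h2)
  rw [h z hz, ← h3]
  rfl

/-- A linear combination of functions vanishing at `z`, with coefficients vanishing at `z`. -/
lemma hasFDerivAt_zero_of_linear_comb {U : Type*} [NormedAddCommGroup U] [NormedSpace ℝ U]
    [FiniteDimensional ℝ U] (S : U → E → W) {f : E → U} {G : E → W} {z : E}
    (hadd : ∀ u v y, S (u + v) y = S u y + S v y) (hsmul : ∀ (c : ℝ) u y, S (c • u) y = c • S u y)
    (hS : ∀ u, DifferentiableAt ℝ (S u) z) (hS0 : ∀ u, S u z = 0) (hf : DifferentiableAt ℝ f z)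
    (hf0 : f z = 0) (hG : ∀ᶠ y in 𝓝 z, G y = S (f y) y) : HasFDerivAt G (0 : E →L[ℝ] W) z := by
  let b := Module.finBasis ℝ U
  let c : ∀ i, U →L[ℝ] ℝ := fun i => LinearMap.toContinuousLinearMap (b.coord i)
  let S' : E → U →ₗ[ℝ] W := fun y =>
    { toFun := fun u => S u y, map_add' := fun u v => hadd u v y, map_smul' := fun c u => hsmul c u y }
  have h1 : ∀ y, S (f y) y =
      ∑ i, c i (f y) • S (b i) y := by
    intro y
    change S' y (f y) = ∑ i, c i (f y) • S' y (b i)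
    conv_lhs => rw [← b.sum_repr (f y), map_sum]
    simp [c]
  have h2 : HasFDerivAt (fun y => ∑ i, c i (f y) •
      S (b i) y) _ z := HasFDerivAt.fun_sum fun i _ =>
    (((c i).hasFDerivAt.comp z hf.hasFDerivAt).smul
      (hS (b i)).hasFDerivAt)
  refine (h2.congr_fderiv ?_).congr_of_eventuallyEq (hG.mono fun y hy => hy.trans (h1 y))
  refine Finset.sum_eq_zero fun i _ => ?_
  ext v
  simp [hS0, hf0]

end RadialFunctions

/-! ### Change of coordinates and gauge. -/

section Change

open Set

variable {H : Type*} [NormedAddCommGroup H] [NormedSpace ℝ H]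
  {M : Type*} [TopologicalSpace M] [ChartedSpace H M] [IsManifold 𝓘(ℝ, H) ∞ M]
  {F : Type*} [NormedAddCommGroup F] [NormedSpace ℝ F]
  {V : M → Type*} [TopologicalSpace (TotalSpace F V)]
  [∀ x, AddCommGroup (V x)] [∀ x, Module ℝ (V x)]
  [∀ x, TopologicalSpace (V x)] [FiberBundle F V] [VectorBundle ℝ F V]
  [ContMDiffVectorBundle ∞ F V 𝓘(ℝ, H)]

namespace Coords

/-- Change of coordinates by a diffeomorphism `κ` and of the trivialization by a gauge
transformation `g`. -/
def change (𝒞 : Coords H F V) (κ : OpenPartialHomeomorph H H) (g : H → F →L[ℝ] F)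
    (hκ : ContDiffOn ℝ ∞ κ κ.source) (hκs : ContDiffOn ℝ ∞ κ.symm κ.target)
    (hg : ContDiffOn ℝ ∞ g κ.source) (hu : ∀ z ∈ κ.source, IsUnit (g z)) : Coords H F V where
  φ := 𝒞.φ ≫ₕ κ
  Φ x := (g (𝒞.φ x)).toLinearMap ∘ₗ 𝒞.Φ x
  Ψ x := 𝒞.Ψ x ∘ₗ (Ring.inverse (g (𝒞.φ x))).toLinearMap
  contMDiffOn := by
    rw [OpenPartialHomeomorph.trans_source]
    exact hκ.contMDiffOn.comp (𝒞.contMDiffOn.mono inter_subset_left) fun x hx => hx.2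
  contMDiffOn_symm := by
    rw [OpenPartialHomeomorph.trans_target]
    exact 𝒞.contMDiffOn_symm.comp (hκs.contMDiffOn.mono inter_subset_left) fun x hx => hx.2
  left_inv x hx v := by
    rw [OpenPartialHomeomorph.trans_source] at hx
    have h1 := DFunLike.congr_fun (Ring.inverse_mul_cancel _ (hu _ hx.2)) (𝒞.Φ x v)
    have h2 : Ring.inverse (g (𝒞.φ x)) (g (𝒞.φ x) (𝒞.Φ x v)) = 𝒞.Φ x v := h1
    simp [h2, 𝒞.left_inv x hx.1]
  right_inv x hx u := by
    rw [OpenPartialHomeomorph.trans_source] at hx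
    have h1 : g (𝒞.φ x) (Ring.inverse (g (𝒞.φ x)) u) = u :=
      DFunLike.congr_fun (Ring.mul_inverse_cancel _ (hu _ hx.2)) u
    simp [𝒞.right_inv x hx.1, h1]
  contMDiffOn_total := by
    rw [OpenPartialHomeomorph.trans_source]
    have h1 : ContMDiffOn (𝓘(ℝ, H).prod 𝓘(ℝ, F)) 𝓘(ℝ, H) ∞
        (fun v : TotalSpace F V => 𝒞.φ v.proj) (TotalSpace.proj ⁻¹' 𝒞.φ.source) :=
      𝒞.contMDiffOn.comp (contMDiff_proj V).contMDiffOn fun v hv => hv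
    have h2 : ContMDiffOn (𝓘(ℝ, H).prod 𝓘(ℝ, F)) 𝓘(ℝ, F →L[ℝ] F) ∞
        (fun v : TotalSpace F V => g (𝒞.φ v.proj))
        (TotalSpace.proj ⁻¹' (𝒞.φ.source ∩ 𝒞.φ ⁻¹' κ.source)) :=
      hg.contMDiffOn.comp (h1.mono fun v hv => hv.1) fun v hv => hv.2
    exact h2.clm_apply (𝒞.contMDiffOn_total.mono fun v hv => hv.1)

end Coords

end Change

/-! ### Coordinates in which an Euler-like derivation is radial. -/

section RadialCoordinates

open Set

variable {H : Type*} [NormedAddCommGroup H] [NormedSpace ℝ H] [FiniteDimensional ℝ H]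
  {M : Type*} [TopologicalSpace M] [T2Space M] [ChartedSpace H M] [IsManifold 𝓘(ℝ, H) ∞ M]
  {F : Type*} [NormedAddCommGroup F] [NormedSpace ℝ F]
  {V : M → Type*} [TopologicalSpace (TotalSpace F V)]
  [∀ x, AddCommGroup (V x)] [∀ x, Module ℝ (V x)]
  [∀ x, TopologicalSpace (V x)] [FiberBundle F V] [VectorBundle ℝ F V]
  [ContMDiffVectorBundle ∞ F V 𝓘(ℝ, H)]

variable (F V) in
lemma eventually_stdCoords_frame (p : M) : ∀ᶠ x in 𝓝 p, ∀ u : F,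
    (stdCoords p : Coords H F V).Φ x (frame (H := H) (V := V) p u x) = u := by
  filter_upwards [(cutoff (H := H) F V p).eventuallyEq_one,
    (trivializationAt F V p).open_baseSet.mem_nhds (FiberBundle.mem_baseSet_trivializationAt' p)]
    with x hx hxb u
  change (trivializationAt F V p).linearMapAt ℝ x
    (cutoff (H := H) F V p x • (trivializationAt F V p).symmₗ ℝ x u) = u
  rw [hx, Pi.one_apply, one_smul, Trivialization.linearMapAt_symmₗ _ hxb]

variable (F V) in
lemma eventually_coord (p : M) : ∀ᶠ x in 𝓝 p, ∀ ξ : H →L[ℝ] ℝ,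
    coord (H := H) p ξ x = ξ ((stdCoords p : Coords H F V).φ x) := by
  filter_upwards [(cutoff (H := H) H (TangentSpace 𝓘(ℝ, H)) p).eventuallyEq_one] with x hx ξ
  change (cutoff (H := H) H (TangentSpace 𝓘(ℝ, H)) p) x • ξ (extChartAt 𝓘(ℝ, H) p x) = _
  rw [hx, Pi.one_apply, one_smul]
  simp [stdCoords, mfld_simps]

/-- Around a point where the derivation `D` is Euler-like there are coordinates in which `D` is the
derivative along the Euler vector field. -/
theorem Der.IsEulerLikeAt.exists_coords [FiniteDimensional ℝ F] {D : Der H F V} {p : M}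
    (hD : D.IsEulerLikeAt p) :
    ∃ 𝒞 : Coords H F V, p ∈ 𝒞.φ.source ∧ 𝒞.φ p = 0 ∧ 𝒞.Φ p = (stdCoords p : Coords H F V).Φ p ∧
      fderiv ℝ (𝒞.φ ∘ (stdCoords p : Coords H F V).φ.symm) ((stdCoords p : Coords H F V).φ p) =
        ContinuousLinearMap.id ℝ H ∧
      ∀ x ∈ 𝒞.φ.source, ∀ α : Sec H F V,
        𝒞.Φ x (D.toLin α x) = fderiv ℝ (𝒞.rep α) (𝒞.φ x) (𝒞.φ x) := by
  have : CompleteSpace H := FiniteDimensional.complete ℝ H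
  have : CompleteSpace F := FiniteDimensional.complete ℝ F
  let 𝒞₀ : Coords H F V := stdCoords p
  have hp : p ∈ 𝒞₀.φ.source := mem_stdCoords_source F V p
  obtain ⟨N, hN, hNo, hpN⟩ := eventually_nhds_iff.1
    ((eventually_stdCoords_frame (H := H) F V p).and (𝒞₀.φ.open_source.mem_nhds hp))
  have hNs : N ⊆ 𝒞₀.φ.source := fun x hx => (hN x hx).2
  have hNE : ∀ x ∈ N, ∀ u, 𝒞₀.Φ x (frame (H := H) (V := V) p u x) = u := fun x hx => (hN x hx).1
  let U : Set H := 𝒞₀.φ.target ∩ 𝒞₀.φ.symm ⁻¹' N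
  have hU : IsOpen U := 𝒞₀.φ.isOpen_inter_preimage_symm hNo
  have hz₀ : 𝒞₀.φ p ∈ U := ⟨𝒞₀.φ.map_source hp, by
    change 𝒞₀.φ.symm (𝒞₀.φ p) ∈ N
    rwa [𝒞₀.φ.left_inv hp]⟩
  let X : H → H := 𝒞₀.tangent.rep D.symbol
  have hX : ContDiffOn ℝ ∞ X U := fun z hz =>
    (𝒞₀.tangent.contDiffAt_rep hz.1 (D.symbol_smooth _)).contDiffWithinAt
  -- `Ω` is the zeroth-order part of `D` in the standard frame, so that `D` reads `α ↦ dα(X) + Ω α`.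
  -- Its vanishing at `p` is the condition `D^L = 0`.
  let Ω : H → F →L[ℝ] F := fun z => LinearMap.toContinuousLinearMap
    { toFun := fun u => 𝒞₀.rep (D.toLin (frame p u)) z
      map_add' := fun u v => by simp [Coords.rep]
      map_smul' := fun c u => by simp [Coords.rep] }
  have hΩ : ContDiffOn ℝ ∞ Ω U := contDiffOn_clm_apply.2 fun u =>
    (𝒞₀.contDiffOn_rep_sec (D.toLin (frame p u))).mono inter_subset_left
  have hX0 : X (𝒞₀.φ p) = 0 := by
    refine (𝒞₀.tangent.rep_φ D.symbol hp).trans ?_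
    rw [hD.1, map_zero]
  have hX1 : fderiv ℝ X (𝒞₀.φ p) = ContinuousLinearMap.id ℝ H := by
    rw [← hD.2.1, linPart_tangent_eq_fderiv_rep F V]
  have hΩ0 : Ω (𝒞₀.φ p) = 0 := by
    ext u
    exact (𝒞₀.rep_φ _ hp).trans (DFunLike.congr_fun hD.2.2 u)
  obtain ⟨κ, g, hκ0, hκU, hκz, hκ, hκs, hκ1, hκX, hg, hg1, hgu, hgX⟩ :=
    exists_linearizing_coordinates hU hX hΩ hz₀ hX0 hX1 hΩ0
  let 𝒞 : Coords H F V := 𝒞₀.change κ g hκ hκs hg hgu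
  have hsrc : 𝒞.φ.source = 𝒞₀.φ.source ∩ 𝒞₀.φ ⁻¹' κ.source := 𝒞₀.φ.trans_source κ
  refine ⟨𝒞, ?_, hκz, ?_, ?_, ?_⟩
  · rw [hsrc]
    exact ⟨hp, hκ0⟩
  · ext v
    change g (𝒞₀.φ p) (𝒞₀.Φ p v) = _
    rw [hg1]
    rfl
  · rw [← hκ1]
    refine EventuallyEq.fderiv_eq ?_
    filter_upwards [𝒞₀.φ.open_target.mem_nhds (𝒞₀.φ.map_source hp)] with z hz
    change κ (𝒞₀.φ (𝒞₀.φ.symm z)) = κ z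
    rw [𝒞₀.φ.right_inv hz]
  · intro x hx α
    have hx' := hx
    rw [hsrc] at hx'
    obtain ⟨hx0, hxκ⟩ := hx'
    have hxU := hκU hxκ
    have hxN : x ∈ N := by
      have := hxU.2
      rwa [mem_preimage, 𝒞₀.φ.left_inv hx0] at this
    have h1 : ∀ᶠ z in 𝓝 (𝒞₀.φ x), 𝒞.rep α (κ z) = g z (𝒞₀.rep α z) := by
      filter_upwards [κ.open_source.mem_nhds hxκ, 𝒞₀.φ.open_target.mem_nhds hxU.1] with z hz hzt
      change g (𝒞₀.φ (𝒞₀.φ.symm (κ.symm (κ z)))) (𝒞₀.Φ (𝒞₀.φ.symm (κ.symm (κ z)))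
        (α (𝒞₀.φ.symm (κ.symm (κ z))))) = _
      rw [κ.left_inv hz, 𝒞₀.φ.right_inv hzt]
      rfl
    have h2 : HasFDerivAt (𝒞.rep α) (fderiv ℝ (𝒞.rep α) (κ (𝒞₀.φ x))) (κ (𝒞₀.φ x)) :=
      ((𝒞.contDiffAt_rep_sec α (𝒞.φ.map_source hx)).differentiableAt (by simp)).hasFDerivAt
    have h3 : HasFDerivAt κ (fderiv ℝ κ (𝒞₀.φ x)) (𝒞₀.φ x) :=
      ((hκ.contDiffAt (κ.open_source.mem_nhds hxκ)).differentiableAt (by simp)).hasFDerivAt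
    have h4 : HasFDerivAt g (fderiv ℝ g (𝒞₀.φ x)) (𝒞₀.φ x) :=
      ((hg.contDiffAt (κ.open_source.mem_nhds hxκ)).differentiableAt (by simp)).hasFDerivAt
    have h5 : HasFDerivAt (𝒞₀.rep α) (fderiv ℝ (𝒞₀.rep α) (𝒞₀.φ x)) (𝒞₀.φ x) :=
      ((𝒞₀.contDiffAt_rep_sec α hxU.1).differentiableAt (by simp)).hasFDerivAt
    -- The new components satisfy `rep α ∘ κ = g · rep₀ α`. Differentiating along `X`, with `dκ(X) =
    -- κ` and `dg(X) = g Ω`, the right side becomes `g (d(rep₀ α)(X) + Ω rep₀ α)`, which is `g`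
    -- applied to the components of `D α`.
    have h6 := (h2.comp _ h3).unique ((h4.clm_apply h5).congr_of_eventuallyEq h1)
    have h7 := DFunLike.congr_fun h6 (X (𝒞₀.φ x))
    have h8 : 𝒞₀.tangent.Φ x (D.symbol x) = X (𝒞₀.φ x) := (𝒞₀.tangent.rep_φ D.symbol hx0).symm
    have h9 : 𝒞₀.Φ x (D.toLin (frame p (𝒞₀.Φ x (α x))) x) = Ω (𝒞₀.φ x) (𝒞₀.Φ x (α x)) :=
      (𝒞₀.rep_φ _ hx0).symm
    have h10 := hκX _ hxκ
    have h11 := hgX _ hxκ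
    change g (𝒞₀.φ x) (𝒞₀.Φ x (D.toLin α x)) = fderiv ℝ (𝒞.rep α) (κ (𝒞₀.φ x)) (κ (𝒞₀.φ x))
    rw [𝒞₀.Φ_toLin hNo hNs hNE D α hxN, h8, h9, map_add]
    simp only [ContinuousLinearMap.comp_apply, add_apply, h10,
      ContinuousLinearMap.flip_apply, h11, 𝒞₀.rep_φ _ hx0] at h7
    rw [h7]
    rfl

end RadialCoordinates

/-! ### At a singular point, linear parts depend only on values and first-order data. -/

section Comparison

open Set

variable {H : Type*} [NormedAddCommGroup H] [NormedSpace ℝ H] [FiniteDimensional ℝ H]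
  {M : Type*} [TopologicalSpace M] [ChartedSpace H M] [IsManifold 𝓘(ℝ, H) ∞ M]
  {F : Type*} [NormedAddCommGroup F] [NormedSpace ℝ F] [FiniteDimensional ℝ F]
  {V : M → Type*} [TopologicalSpace (TotalSpace F V)]
  [∀ x, AddCommGroup (V x)] [∀ x, Module ℝ (V x)]
  [∀ x, TopologicalSpace (V x)] [FiberBundle F V] [VectorBundle ℝ F V]
  [ContMDiffVectorBundle ∞ F V 𝓘(ℝ, H)]

lemma Coords.tendsto_symm (𝒞 : Coords H F V) {x : M} (hx : x ∈ 𝒞.φ.source) :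
    Tendsto 𝒞.φ.symm (𝓝 (𝒞.φ x)) (𝓝 x) := by
  have := (𝒞.contMDiffAt_φ_symm (𝒞.φ.map_source hx)).continuousAt.tendsto
  rwa [𝒞.φ.left_inv hx] at this

/-- The linear part at `p` of a section vanishing at `p` is the same in coordinates which agree to
first order at `p`. -/
lemma Coords.fderiv_rep_eq_of_agree (𝒞 𝒞' : Coords H F V) {p : M} (hp : p ∈ 𝒞.φ.source)
    (hp' : p ∈ 𝒞'.φ.source) (hΦ : 𝒞.Φ p = 𝒞'.Φ p)
    (hφ : fderiv ℝ (𝒞.φ ∘ 𝒞'.φ.symm) (𝒞'.φ p) = ContinuousLinearMap.id ℝ H) {s : ∀ x, V x}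
    (hs : ContMDiffAt 𝓘(ℝ, H) (𝓘(ℝ, H).prod 𝓘(ℝ, F)) ∞
      (fun y => (⟨y, s y⟩ : TotalSpace F V)) p) (hs0 : s p = 0) :
    fderiv ℝ (𝒞.rep s) (𝒞.φ p) = fderiv ℝ (𝒞'.rep s) (𝒞'.φ p) := by
  have hz := 𝒞.φ.map_source hp
  have hz' := 𝒞'.φ.map_source hp'
  let G : M → F →L[ℝ] F := fun x => LinearMap.toContinuousLinearMap (𝒞.Φ x ∘ₗ 𝒞'.Ψ x)
  have hG : ContMDiffAt 𝓘(ℝ, H) 𝓘(ℝ, F →L[ℝ] F) ∞ G p := by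
    refine contMDiffAt_clm_of_apply fun u => 𝒞.contMDiffAt_Φ hp (s := fun y => 𝒞'.Ψ y u) ?_
    refine 𝒞'.contMDiffAt_section_of_Φ hp' ((contMDiffAt_const (c := u)).congr_of_eventuallyEq ?_)
    filter_upwards [𝒞'.φ.open_source.mem_nhds hp'] with y hy using 𝒞'.right_inv y hy u
  have hK : ContinuousAt (fun z => G (𝒞'.φ.symm z)) (𝒞'.φ p) := by
    have h1 := hG.continuousAt
    exact ContinuousAt.comp (f := 𝒞'.φ.symm) (by rwa [𝒞'.φ.left_inv hp'])
      (𝒞'.contMDiffAt_φ_symm hz').continuousAt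
  have hG1 : G (𝒞'.φ.symm (𝒞'.φ p)) = ContinuousLinearMap.id ℝ F := by
    rw [𝒞'.φ.left_inv hp']
    ext u
    change 𝒞.Φ p (𝒞'.Ψ p u) = u
    rw [hΦ, 𝒞'.right_inv p hp']
  have hd' : HasFDerivAt (𝒞'.rep s) (fderiv ℝ (𝒞'.rep s) (𝒞'.φ p)) (𝒞'.φ p) :=
    ((𝒞'.contDiffAt_rep hz' (by rwa [𝒞'.φ.left_inv hp'])).differentiableAt (by simp)).hasFDerivAt
  have hd : HasFDerivAt (𝒞.rep s) (fderiv ℝ (𝒞.rep s) (𝒞.φ p))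
      ((𝒞.φ ∘ 𝒞'.φ.symm) (𝒞'.φ p)) := by
    rw [Function.comp_apply, 𝒞'.φ.left_inv hp']
    exact ((𝒞.contDiffAt_rep hz (by rwa [𝒞.φ.left_inv hp])).differentiableAt (by simp)).hasFDerivAt
  have h1 := hasFDerivAt_clm_apply_of_eq_zero hK hd' (by rw [𝒞'.rep_φ s hp', hs0, map_zero])
  have h2 := hd.comp _ ((𝒞'.contDiffAt_transition 𝒞 hp' hp).differentiableAt (by simp)).hasFDerivAt
  rw [hφ, ContinuousLinearMap.comp_id] at h2
  rw [hG1, ContinuousLinearMap.id_comp] at h1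
  refine h2.unique (h1.congr_of_eventuallyEq ?_)
  have hc := 𝒞'.tendsto_symm hp'
  filter_upwards [hc.eventually (𝒞.φ.open_source.mem_nhds hp),
    hc.eventually (𝒞'.φ.open_source.mem_nhds hp')] with z h3 h4
  change 𝒞.rep s (𝒞.φ (𝒞'.φ.symm z)) = 𝒞.Φ _ (𝒞'.Ψ _ (𝒞'.Φ (𝒞'.φ.symm z) (s (𝒞'.φ.symm z))))
  rw [𝒞.rep_φ s h3, 𝒞'.left_inv _ h4]

variable [T2Space M]

lemma eventually_eq_frame (p : M) : ∀ᶠ x in 𝓝 p, ∀ α : Sec H F V,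
    α x = frame (H := H) p ((stdCoords p : Coords H F V).Φ x (α x)) x := by
  filter_upwards [eventually_stdCoords_frame (H := H) F V p,
    (stdCoords p : Coords H F V).φ.open_source.mem_nhds (mem_stdCoords_source F V p)] with x h1 h2 α
  rw [← (stdCoords p : Coords H F V).left_inv x h2 (frame (H := H) (V := V) p _ x), h1,
    (stdCoords p : Coords H F V).left_inv x h2]

lemma stdCoords_sub_frame (p : M) (α : Sec H F V) :
    (α - frame p ((stdCoords p : Coords H F V).Φ p (α p)) : Sec H F V) p = 0 :=
  sub_eq_zero.2 ((eventually_eq_frame p).self_of_nhds α)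

/-- The linear part of a section which near `p` is a combination of sections vanishing at `p`, with
coefficients vanishing at `p`. -/
lemma linPart_eq_zero_of_eventuallyEq {W : Type*} [NormedAddCommGroup W] [NormedSpace ℝ W]
    [FiniteDimensional ℝ W] {p : M} (S : W →ₗ[ℝ] Sec H F V)
    (hS : ∀ w, S w p = 0) {w : H → W} (γ : Sec H F V)
    (hw : DifferentiableAt ℝ w ((stdCoords p : Coords H F V).φ p))
    (hw0 : w ((stdCoords p : Coords H F V).φ p) = 0)
    (h : ∀ᶠ x in 𝓝 p, γ x = S (w ((stdCoords p : Coords H F V).φ x)) x) :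
    linPart F p γ = (0 : H →L[ℝ] F) := by
  let 𝒞 : Coords H F V := stdCoords p
  have hps : p ∈ 𝒞.φ.source := mem_stdCoords_source F V p
  have hz := 𝒞.φ.map_source hps
  rw [linPart_eq_fderiv_rep]
  refine (hasFDerivAt_zero_of_linear_comb (fun u => 𝒞.rep (S u)) (f := w)
    (fun u v y => by simp [Coords.rep]) (fun c u y => by simp [Coords.rep])
    (fun u => (𝒞.contDiffAt_rep_sec _ hz).differentiableAt (by simp))
    (fun u => ?_) hw hw0 ?_).fderiv
  · rw [𝒞.rep_φ _ hps, hS, map_zero]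
  · filter_upwards [(𝒞.tendsto_symm hps).eventually h, 𝒞.φ.open_target.mem_nhds hz] with z h1 h2
    change 𝒞.Φ _ (γ (𝒞.φ.symm z)) = 𝒞.Φ _ (S (w z) (𝒞.φ.symm z))
    rw [h1]
    change 𝒞.Φ _ (S (w (𝒞.φ (𝒞.φ.symm z))) _) = _
    rw [𝒞.φ.right_inv h2]

namespace AlmostLodayAlgebroid

variable (A : AlmostLodayAlgebroid H F V) {p : M}

/-- In the frame, `ρ(α)` is a combination of the fields `ρ(e_u)`, which vanish at the singular
point, with coefficients the components of `α`, which vanish there too. A product of two vanishing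
factors has no linear part. -/
lemma linPart_anchor_eq_zero (hp : A.IsSingularAt p) {α : Sec H F V} (hα : α p = 0) :
    linPart (H := H) H p (fun x => A.anchor x (α x)) = 0 := by
  let 𝒞 : Coords H F V := stdCoords p
  have hps : p ∈ 𝒞.φ.source := mem_stdCoords_source F V p
  have hz := 𝒞.φ.map_source hps
  rw [linPart_tangent_eq_fderiv_rep F V]
  refine (hasFDerivAt_zero_of_linear_comb
    (fun u => 𝒞.tangent.rep fun x => A.anchor x (frame (H := H) (V := V) p u x)) (f := 𝒞.rep α)
    (fun u v y => by simp [Coords.rep]) (fun c u y => by simp [Coords.rep])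
    (fun u => (𝒞.tangent.contDiffAt_rep hz (A.anchor_section_smooth (frame p u) _)).differentiableAt
      (by simp))
    (fun u => ?_) ((𝒞.contDiffAt_rep_sec α hz).differentiableAt (by simp)) ?_ ?_).fderiv
  · refine (𝒞.tangent.rep_φ _ hps).trans ?_
    rw [hp.1, LinearMap.zero_apply, map_zero]
  · rw [𝒞.rep_φ _ hps, hα, map_zero]
  · filter_upwards [(𝒞.tendsto_symm hps).eventually (eventually_eq_frame (H := H) (F := F) (V := V) p)]
      with z h1
    change 𝒞.tangent.Φ _ (A.anchor (𝒞.φ.symm z) (α (𝒞.φ.symm z))) =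
      𝒞.tangent.Φ _ (A.anchor (𝒞.φ.symm z) (frame p (𝒞.rep α z) (𝒞.φ.symm z)))
    conv_lhs => rw [h1 α]
    rfl

lemma linPart_anchor (hp : A.IsSingularAt p) (α : Sec H F V) :
    linPart (H := H) H p (fun x => A.anchor x (α x)) =
      A.anchorLin p ((stdCoords p : Coords H F V).Φ p (α p)) := by
  let β : Sec H F V := frame p ((stdCoords p : Coords H F V).Φ p (α p))
  have h1 := linPart_add (A.anchor_section_smooth (α - β)) (A.anchor_section_smooth β) (p := p)
  rw [A.linPart_anchor_eq_zero hp (stdCoords_sub_frame p α), zero_add] at h1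
  refine Eq.trans ?_ h1
  simp

/-- The section `λ(df ⊗ α ⊗ β)`. -/
def coanchorSec (f : C^∞⟮𝓘(ℝ, H), M; ℝ⟯) (α β : Sec H F V) : Sec H F V :=
  ⟨fun x => A.coanchor x (d f x) (α x) (β x), A.coanchor_smooth f α β⟩

lemma coanchorSec_apply (f : C^∞⟮𝓘(ℝ, H), M; ℝ⟯) (α β : Sec H F V) (x : M) :
    A.coanchorSec f α β x = A.coanchor x (d f x) (α x) (β x) := rfl

lemma coanchorSec_eq_zero (hp : A.IsSingularAt p) (f : C^∞⟮𝓘(ℝ, H), M; ℝ⟯) (α β : Sec H F V) :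
    A.coanchorSec f α β p = 0 := by
  rw [coanchorSec_apply, hp.2]
  rfl

/-- The arguments `β`, `α` and `f` are replaced in turn by frame sections and a linear coordinate
agreeing with them at `p`, up to first order in the case of `f`. Each replacement alters the section
by a combination of sections vanishing at `p` with coefficients vanishing at `p`, hence does not
alter the linear part. -/
lemma linPart_coanchorSec (hp : A.IsSingularAt p) (f : C^∞⟮𝓘(ℝ, H), M; ℝ⟯) (α β : Sec H F V) :
    linPart F p (A.coanchorSec f α β) = A.coanchorLin p
      (fderiv ℝ (f ∘ (stdCoords p : Coords H F V).φ.symm) ((stdCoords p : Coords H F V).φ p))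
      ((stdCoords p : Coords H F V).Φ p (α p)) ((stdCoords p : Coords H F V).Φ p (β p)) := by
  let 𝒞 : Coords H F V := stdCoords p
  have hps : p ∈ 𝒞.φ.source := mem_stdCoords_source F V p
  have hz := 𝒞.φ.map_source hps
  let α₀ : Sec H F V := frame p (𝒞.Φ p (α p))
  let β₀ : Sec H F V := frame p (𝒞.Φ p (β p))
  let ξ : H →L[ℝ] ℝ := fderiv ℝ (f ∘ 𝒞.φ.symm) (𝒞.φ p)
  have hf : ∀ z ∈ 𝒞.φ.target, ContDiffAt ℝ ∞ (f ∘ 𝒞.φ.symm) z := fun z hz =>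
    contMDiffAt_iff_contDiffAt.1 (f.contMDiff.contMDiffAt.comp z (𝒞.contMDiffAt_φ_symm hz))
  have hadd : ∀ γ δ : Sec H F V, linPart F p (γ + δ : Sec H F V) =
      linPart (H := H) F p γ + linPart F p δ := fun γ δ => linPart_add γ.contMDiff δ.contMDiff
  have hβ : linPart (H := H) F p (A.coanchorSec f α β) = linPart F p (A.coanchorSec f α β₀) := by
    have h1 : linPart F p (A.coanchorSec f α (β - β₀)) = (0 : H →L[ℝ] F) := by
      refine linPart_eq_zero_of_eventuallyEq
        { toFun := fun u => A.coanchorSec f α (frame p u)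
          map_add' := fun u v => by ext x; simp [coanchorSec_apply]
          map_smul' := fun c u => by ext x; simp [coanchorSec_apply] }
        (fun w => A.coanchorSec_eq_zero hp _ _ _) (w := 𝒞.rep (β - β₀ : Sec H F V)) _
        ((𝒞.contDiffAt_rep_sec _ hz).differentiableAt (by simp)) ?_ ?_
      · change 𝒞.rep _ (𝒞.φ p) = 0
        rw [𝒞.rep_φ _ hps, stdCoords_sub_frame, map_zero]
      · filter_upwards [eventually_eq_frame (H := H) (F := F) (V := V) p, 𝒞.φ.open_source.mem_nhds hps]
          with x h1 h2
        change A.coanchor x (d f x) (α x) ((β - β₀ : Sec H F V) x) =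
          A.coanchor x (d f x) (α x) (frame p (𝒞.rep _ (𝒞.φ x)) x)
        rw [𝒞.rep_φ _ h2, ← h1]
    have h2 : A.coanchorSec f α β = A.coanchorSec f α (β - β₀) + A.coanchorSec f α β₀ := by
      ext x
      simp [coanchorSec_apply]
    rw [h2, hadd, h1, zero_add]
  have hα : linPart (H := H) F p (A.coanchorSec f α β₀) = linPart F p (A.coanchorSec f α₀ β₀) := by
    have h1 : linPart F p (A.coanchorSec f (α - α₀) β₀) = (0 : H →L[ℝ] F) := by
      refine linPart_eq_zero_of_eventuallyEq
        { toFun := fun u => A.coanchorSec f (frame p u) β₀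
          map_add' := fun u v => by ext x; simp [coanchorSec_apply]
          map_smul' := fun c u => by ext x; simp [coanchorSec_apply] }
        (fun w => A.coanchorSec_eq_zero hp _ _ _) (w := 𝒞.rep (α - α₀ : Sec H F V)) _
        ((𝒞.contDiffAt_rep_sec _ hz).differentiableAt (by simp)) ?_ ?_
      · change 𝒞.rep _ (𝒞.φ p) = 0
        rw [𝒞.rep_φ _ hps, stdCoords_sub_frame, map_zero]
      · filter_upwards [eventually_eq_frame (H := H) (F := F) (V := V) p, 𝒞.φ.open_source.mem_nhds hps]
          with x h1 h2
        change A.coanchor x (d f x) ((α - α₀ : Sec H F V) x) (β₀ x) =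
          A.coanchor x (d f x) (frame p (𝒞.rep _ (𝒞.φ x)) x) (β₀ x)
        rw [𝒞.rep_φ _ h2, ← h1]
    have h2 : A.coanchorSec f α β₀ = A.coanchorSec f (α - α₀) β₀ + A.coanchorSec f α₀ β₀ := by
      ext x
      simp [coanchorSec_apply]
    rw [h2, hadd, h1, zero_add]
  have hdc : ∀ᶠ x in 𝓝 p, ∀ η : H →L[ℝ] ℝ,
      d (coord p η) x = η ∘L mfderiv 𝓘(ℝ, H) 𝓘(ℝ, H) 𝒞.φ x := by
    filter_upwards [(eventually_coord (H := H) F V p).eventually_nhds,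
      𝒞.φ.open_source.mem_nhds hps] with x h1 h2 η
    rw [𝒞.d_eq_of_eventuallyEq (h := η) h2 (h1.mono fun y hy => hy η) η.differentiableAt, η.fderiv]
  have hξ : linPart (H := H) F p (A.coanchorSec f α₀ β₀) =
      linPart F p (A.coanchorSec (coord p ξ) α₀ β₀) := by
    have h1 : linPart F p (A.coanchorSec (f - coord p ξ) α₀ β₀) = (0 : H →L[ℝ] F) := by
      refine linPart_eq_zero_of_eventuallyEq
        { toFun := fun η => A.coanchorSec (coord p η) α₀ β₀
          map_add' := fun u v => by ext x; simp [coanchorSec_apply, d_add]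
          map_smul' := fun c u => by ext x; simp [coanchorSec_apply, d_smul] }
        (fun w => A.coanchorSec_eq_zero hp _ _ _)
        -- Near `p` the form `d(f - coord p ξ)` has coefficients `df - ξ` in the coordinate
        -- differentials; they vanish at `p` by the choice of `ξ`.
        (w := fun z => fderiv ℝ (f ∘ 𝒞.φ.symm) z - ξ) _ ?_ (sub_self ξ) ?_
      · exact (((hf _ hz).fderiv_right (m := ∞) (by simp)).differentiableAt (by simp)).sub_const ξ
      · filter_upwards [hdc, 𝒞.φ.open_source.mem_nhds hps] with x h1 h2
        have h3 : d f x = fderiv ℝ (f ∘ 𝒞.φ.symm) (𝒞.φ x) ∘L mfderiv 𝓘(ℝ, H) 𝓘(ℝ, H) 𝒞.φ x := by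
          refine 𝒞.d_eq_of_eventuallyEq h2 ?_
            ((hf _ (𝒞.φ.map_source h2)).differentiableAt (by simp))
          filter_upwards [𝒞.φ.open_source.mem_nhds h2] with y hy
          simp [𝒞.φ.left_inv hy]
        have h4 : d (f - coord p ξ) x = d f x - d (coord p ξ) x := by
          have := d_add (f - coord p ξ) (coord p ξ) x
          rw [sub_add_cancel] at this
          rw [this, add_sub_cancel_right]
        change A.coanchor x (d (f - coord p ξ) x) (α₀ x) (β₀ x) =
          A.coanchor x (d (coord p (fderiv ℝ (f ∘ 𝒞.φ.symm) (𝒞.φ x) - ξ)) x) (α₀ x) (β₀ x)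
        rw [h4, h3, h1, h1]
        rfl
    have h2 : A.coanchorSec f α₀ β₀ =
        A.coanchorSec (f - coord p ξ) α₀ β₀ + A.coanchorSec (coord p ξ) α₀ β₀ := by
      ext x
      change A.coanchor x (d f x) (α₀ x) (β₀ x) = A.coanchor x (d (f - coord p ξ) x) (α₀ x) (β₀ x) +
        A.coanchor x (d (coord p ξ) x) (α₀ x) (β₀ x)
      rw [← LinearMap.add_apply, ← LinearMap.add_apply, ← map_add, ← d_add, sub_add_cancel]
    rw [h2, hadd, h1, zero_add]
  exact (hβ.trans hα).trans hξ

/-- At a singular point the bracket only depends on the values of the sections. -/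
lemma bracket_congr_of_isSingularAt (hp : A.IsSingularAt p) {α α' β β' : Sec H F V}
    (hα : α p = α' p) (hβ : β p = β' p) : A.bracket α β p = A.bracket α' β' p := by
  let 𝒞 : Coords H F V := stdCoords p
  have hps : p ∈ 𝒞.φ.source := mem_stdCoords_source F V p
  obtain ⟨E, N, hNo, hpN, hNs, hE⟩ := 𝒞.exists_frame hps
  have h1 : ∀ u, 𝒞.anchor A p u = 0 := fun u => by simp [Coords.anchor, hp.1]
  have h2 : ∀ ξ u v, 𝒞.coanchor A p ξ u v = 0 := fun ξ u v => by simp [Coords.coanchor, hp.2]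
  have hl : ∀ α γ : Sec H F V, 𝒞.Φ p (A.bracket α γ p) =
      𝒞.Φ p (A.bracket (E (𝒞.Φ p (α p))) γ p) := fun α γ => by
    rw [𝒞.Φ_bracket_left hNo hNs hE A α γ hpN]
    simp [h1, h2]
  have hr : ∀ α γ : Sec H F V, 𝒞.Φ p (A.bracket γ α p) =
      𝒞.Φ p (A.bracket γ (E (𝒞.Φ p (α p))) p) := fun α γ => by
    rw [𝒞.Φ_bracket_right hNo hNs hE A γ α hpN]
    simp [h1]
  rw [← 𝒞.left_inv p hps (A.bracket α β p), ← 𝒞.left_inv p hps (A.bracket α' β' p), hl α, hr β,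
    hl α', hr β', hα, hβ]

end AlmostLodayAlgebroid

end Comparison

/-! ### From an Euler-like derivation to linear coordinates. -/

section Linearizability

open Set

variable {H : Type*} [NormedAddCommGroup H] [NormedSpace ℝ H] [FiniteDimensional ℝ H]
  {M : Type*} [TopologicalSpace M] [T2Space M] [ChartedSpace H M] [IsManifold 𝓘(ℝ, H) ∞ M]
  {F : Type*} [NormedAddCommGroup F] [NormedSpace ℝ F] [FiniteDimensional ℝ F]
  {V : M → Type*} [TopologicalSpace (TotalSpace F V)]
  [∀ x, AddCommGroup (V x)] [∀ x, Module ℝ (V x)]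
  [∀ x, TopologicalSpace (V x)] [FiberBundle F V] [VectorBundle ℝ F V]
  [ContMDiffVectorBundle ∞ F V 𝓘(ℝ, H)]

/-- Functions which are linear in the coordinates near `p`. -/
lemma Coords.exists_linear_func (𝒞 : Coords H F V) {p : M} (hp : p ∈ 𝒞.φ.source) :
    ∃ (c : (H →L[ℝ] ℝ) → C^∞⟮𝓘(ℝ, H), M; ℝ⟯) (N : Set M), IsOpen N ∧ p ∈ N ∧
      ∀ x ∈ N, ∀ ξ, c ξ x = ξ (𝒞.φ x) := by
  obtain ⟨χ, h1, h2⟩ := exists_smooth_bump (H := H) 𝒞.φ.open_source hp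
  obtain ⟨N, hN, hNo, hpN⟩ := eventually_nhds_iff.1 h1
  refine ⟨fun ξ => 𝒞.func χ h2 (fun x => ξ (𝒞.φ x))
    (ξ.contDiff.contMDiff.comp_contMDiffOn 𝒞.contMDiffOn), N, hNo, hpN, fun x hx ξ => ?_⟩
  change χ x • ξ (𝒞.φ x) = _
  rw [hN x hx, one_smul]

/-- If in some coordinates the bracket is constant on constant sections and its anchor and co-anchor
are linear, then it is isomorphic to the bracket given by linear data. -/
theorem Coords.locallyIsomorphic_model (𝒞 : Coords H F V) {W : Set M} (hW : IsOpen W)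
    (hWs : W ⊆ 𝒞.φ.source) {p : M} (hpW : p ∈ W) (hp0 : 𝒞.φ p = 0) {E : F →ₗ[ℝ] Sec H F V}
    (hE : ∀ x ∈ W, ∀ u, 𝒞.Φ x (E u x) = u) (A : AlmostLodayAlgebroid H F V)
    (a : F →ₗ[ℝ] F →ₗ[ℝ] F) (r : F →ₗ[ℝ] (H →L[ℝ] H))
    (l : (H →L[ℝ] ℝ) →ₗ[ℝ] F →ₗ[ℝ] F →ₗ[ℝ] (H →L[ℝ] F))
    (ha : ∀ x ∈ W, ∀ u v, 𝒞.Φ x (A.bracket (E u) (E v) x) = a u v)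
    (hr : ∀ x ∈ W, ∀ u, 𝒞.anchor A x u = r u (𝒞.φ x))
    (hl : ∀ x ∈ W, ∀ ξ u v, 𝒞.coanchor A x ξ u v = l ξ u v (𝒞.φ x)) :
    LocallyIsomorphic A p (model a r l) (0 : H) := by
  refine ⟨𝒞.φ.restrOpen W hW, 𝒞.Φ, ⟨hWs hpW, hpW⟩, hp0, 𝒞.contMDiffOn.mono inter_subset_left,
    𝒞.contMDiffOn_symm.mono inter_subset_left, fun x hx => ?_, fun v hv => ?_, ?_⟩
  · exact ⟨Function.LeftInverse.injective (𝒞.left_inv x hx.1),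
      Function.RightInverse.surjective (𝒞.right_inv x hx.1)⟩
  · refine contMDiffWithinAt_totalSpace.2 ⟨?_, ?_⟩
    · exact ((𝒞.contMDiffAt_φ hv.1).comp v (contMDiff_proj V).contMDiffAt).contMDiffWithinAt
    · exact (𝒞.contMDiffOn_total.mono fun w hw => hw.1) v hv
  · rintro x ⟨hxs, hxW⟩ α β α' β' hα hβ
    have hz := 𝒞.φ.map_source hxs
    have hrep : ∀ {γ : Sec H F V} {γ' : Sec H F (Trivial H F)},
        (∀ᶠ y in 𝓝 x, 𝒞.Φ y (γ y) = fn γ' (𝒞.φ y)) →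
        fderiv ℝ (𝒞.rep γ) (𝒞.φ x) = fderiv ℝ (fn γ') (𝒞.φ x) := by
      intro γ γ' h
      refine EventuallyEq.fderiv_eq ?_
      filter_upwards [(𝒞.tendsto_symm hxs).eventually h, 𝒞.φ.open_target.mem_nhds hz] with z h1 h2
      rw [𝒞.φ.right_inv h2] at h1
      exact h1
    have hα0 : 𝒞.Φ x (α x) = fn α' (𝒞.φ x) := hα.self_of_nhds
    have hβ0 : 𝒞.Φ x (β x) = fn β' (𝒞.φ x) := hβ.self_of_nhds
    change 𝒞.Φ x (A.bracket α β x) = modelBracket a r l (fn α') (fn β') (𝒞.φ x)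
    rw [𝒞.Φ_bracket_left hW hWs hE A α β hxW, 𝒞.Φ_bracket_right hW hWs hE A _ β hxW, hE x hxW,
      ha x hxW, hr x hxW, hr x hxW, hrep hα, hrep hβ, hα0, hβ0]
    simp only [hl x hxW, modelBracket]

/-- If there is a derivation of `𝔞` near the singular point `p` which is Euler-like at `p`, then `𝔞`
is linearizable around `p`. -/
theorem AlmostLodayAlgebroid.IsSingularAt.isLinearizableAt {A : AlmostLodayAlgebroid H F V} {p : M}
    (hp : A.IsSingularAt p) {D : Der H F V} (hD : D.IsEulerLikeAt p) {U : Set M} (hU : IsOpen U)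
    (hpU : p ∈ U) (hL : ∀ α β : Sec H F V, ∀ x ∈ U, A.lieDeriv D α β x = 0) :
    A.IsLinearizableAt p := by
  obtain ⟨𝒞, hps, hp0, hΦ, hφ, hDr⟩ := hD.exists_coords
  obtain ⟨E, N₁, hN₁o, hpN₁, -, hE⟩ := 𝒞.exists_frame hps
  obtain ⟨c, N₂, hN₂o, hpN₂, hc⟩ := 𝒞.exists_linear_func hps
  have hN : IsOpen (N₁ ∩ N₂ ∩ U) := (hN₁o.inter hN₂o).inter hU
  have h0t : (0 : H) ∈ 𝒞.φ.target := hp0 ▸ 𝒞.φ.map_source hps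
  have hs0 : 𝒞.φ.symm 0 = p := by rw [← hp0, 𝒞.φ.left_inv hps]
  -- The coordinate image must be star-shaped about `0` for the homogeneity lemmas, hence a ball. It
  -- is taken small enough for the frame and the linear functions to be uncut and for `D` to
  -- preserve the bracket.
  obtain ⟨r, hr, hball⟩ := Metric.isOpen_iff.1 (𝒞.φ.isOpen_inter_preimage_symm hN) 0
    ⟨h0t, by
      rw [mem_preimage, hs0]
      exact ⟨⟨hpN₁, hpN₂⟩, hpU⟩⟩
  let B : Set H := Metric.ball 0 r
  let W : Set M := 𝒞.φ.source ∩ 𝒞.φ ⁻¹' B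
  have hW : IsOpen W := 𝒞.φ.isOpen_inter_preimage Metric.isOpen_ball
  have hWs : W ⊆ 𝒞.φ.source := inter_subset_left
  have h0B : (0 : H) ∈ B := Metric.mem_ball_self hr
  have hB : B ∈ 𝓝 (0 : H) := Metric.isOpen_ball.mem_nhds h0B
  have hpW : p ∈ W := ⟨hps, by rwa [mem_preimage, hp0]⟩
  have hWN : ∀ x ∈ W, x ∈ N₁ ∩ N₂ ∩ U := fun x hx => by
    have := (hball hx.2).2
    rwa [mem_preimage, 𝒞.φ.left_inv hx.1] at this
  have hEW : ∀ x ∈ W, ∀ u, 𝒞.Φ x (E u x) = u := fun x hx => hE x (hWN x hx).1.1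
  have hcW : ∀ x ∈ W, ∀ ξ, c ξ x = ξ (𝒞.φ x) := fun x hx => hc x (hWN x hx).1.2
  have hBW : ∀ z ∈ B, 𝒞.φ.symm z ∈ W ∧ 𝒞.φ (𝒞.φ.symm z) = z := fun z hz => by
    have h1 := 𝒞.φ.right_inv (hball hz).1
    exact ⟨⟨𝒞.φ.map_target (hball hz).1, by rwa [mem_preimage, h1]⟩, h1⟩
  have hrepB : ∀ (s : Sec H F V), ∀ z ∈ B, ContDiffAt ℝ ∞ (𝒞.rep s) z := fun s z hz =>
    𝒞.contDiffAt_rep_sec s (hball hz).1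
  have hDB : ∀ (s : Sec H F V), ∀ z ∈ B, 𝒞.rep (D.toLin s) z = fderiv ℝ (𝒞.rep s) z z := by
    intro s z hz
    have h1 := hDr _ (hBW z hz).1.1 s
    rwa [(hBW z hz).2] at h1
  have hconst : ∀ s : Sec H F V, (∀ x ∈ W, D.toLin s x = 0) → ∀ z ∈ B,
      𝒞.rep s z = 𝒞.rep s 0 := by
    intro s hs z hz
    refine eq_of_fderiv_apply_self_eq_zero (hrepB s) (fun y hy => ?_) hz
    rw [← hDB s y hy, Coords.rep, hs _ (hBW y hy).1, map_zero]
  have hlin : ∀ s : Sec H F V, (∀ x ∈ W, D.toLin s x = s x) → ∀ z ∈ B,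
      𝒞.rep s z = fderiv ℝ (𝒞.rep s) 0 z := by
    intro s hs z hz
    refine eq_fderiv_zero_of_fderiv_apply_self_eq (hrepB s) (fun y hy => ?_) hz
    rw [← hDB s y hy, Coords.rep, hs _ (hBW y hy).1, Coords.rep]
  have hrepE : ∀ u, ∀ z ∈ B, 𝒞.rep (E u) z = u := fun u z hz => hEW _ (hBW z hz).1 u
  have hD0 : ∀ u, ∀ x ∈ W, D.toLin (E u) x = 0 := by
    intro u x hx
    rw [← 𝒞.Φ_eq_zero_iff hx.1, hDr x hx.1]
    have h1 : 𝒞.rep (E u) =ᶠ[𝓝 (𝒞.φ x)] fun _ => u := by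
      filter_upwards [Metric.isOpen_ball.mem_nhds hx.2] with z hz using hrepE u z hz
    rw [h1.fderiv_eq, fderiv_fun_const]
    rfl
  have hd : ∀ ξ, ∀ x ∈ W, ∀ v, d (c ξ) x v = ξ (𝒞.tangent.Φ x v) := by
    intro ξ x hx v
    rw [𝒞.d_apply_of_eventuallyEq (h := ξ) hx.1 ?_ ξ.differentiableAt, ξ.fderiv]
    filter_upwards [hW.mem_nhds hx] with y hy using hcW y hy ξ
  have hD1 : ∀ ξ u, ∀ x ∈ W, D.toLin (fsmul (c ξ) (E u)) x = fsmul (c ξ) (E u) x := by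
    intro ξ u x hx
    have h1 : 𝒞.rep (fsmul (c ξ) (E u)) =ᶠ[𝓝 (𝒞.φ x)] fun z => ξ z • u := by
      filter_upwards [Metric.isOpen_ball.mem_nhds hx.2] with z hz
      change 𝒞.Φ _ (c ξ _ • E u _) = _
      rw [map_smul, hEW _ (hBW z hz).1, hcW _ (hBW z hz).1, (hBW z hz).2]
    have h2 : HasFDerivAt (fun z => ξ z • u) (ξ.smulRight u) (𝒞.φ x) :=
      (ξ.smulRight u).hasFDerivAt
    rw [← 𝒞.left_inv x hx.1 (D.toLin _ x), ← 𝒞.left_inv x hx.1 (fsmul (c ξ) (E u) x),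
      hDr x hx.1, h1.fderiv_eq, h2.fderiv]
    change 𝒞.Ψ x (ξ (𝒞.φ x) • u) = 𝒞.Ψ x (𝒞.Φ x (c ξ x • E u x))
    rw [map_smul (𝒞.Φ x), hEW x hx, hcW x hx]
  have hbr : ∀ {α β α' β' : Sec H F V}, (∀ x ∈ W, D.toLin α x = α' x) →
      (∀ x ∈ W, D.toLin β x = β' x) → ∀ x ∈ W,
      D.toLin (A.bracket α β) x = A.bracket α' β x + A.bracket α β' x := by
    intro α β α' β' hα hβ x hx
    have h1 : A.bracket (D.toLin α) β x + A.bracket α (D.toLin β) x -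
        D.toLin (A.bracket α β) x = 0 := hL α β x (hWN x hx).2
    rw [← sub_eq_zero.1 h1,
      A.bracket_congr_left β (eventually_of_mem (hW.mem_nhds hx) hα),
      A.bracket_congr_right α (eventually_of_mem (hW.mem_nhds hx) hβ)]
  have hΓ : ∀ x ∈ W, ∀ u v, 𝒞.Φ x (A.bracket (E u) (E v) x) =
      𝒞.rep (A.bracket (E u) (E v)) 0 := by
    intro x hx u v
    rw [← hconst _ (fun y hy => ?_) _ hx.2, 𝒞.rep_φ _ hx.1]
    rw [hbr (α' := 0) (β' := 0) (hD0 u) (hD0 v) y hy]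
    simp
  have hlr : ∀ ξ u v, ∀ x ∈ W, D.toLin (A.bracket (E u) (fsmul (c ξ) (E v))) x =
      A.bracket (E u) (fsmul (c ξ) (E v)) x := by
    intro ξ u v x hx
    rw [hbr (α' := 0) (hD0 u) (hD1 ξ v) x hx]
    simp
  have hll : ∀ ξ u v, ∀ x ∈ W, D.toLin (A.bracket (fsmul (c ξ) (E u)) (E v)) x =
      A.bracket (fsmul (c ξ) (E u)) (E v) x := by
    intro ξ u v x hx
    rw [hbr (β' := 0) (hD1 ξ u) (hD0 v) x hx]
    simp
  let 𝒞₀ : Coords H F V := stdCoords p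
  have hp₀ : p ∈ 𝒞₀.φ.source := mem_stdCoords_source F V p
  have hE0 : ∀ u, 𝒞₀.Φ p (E u p) = u := fun u => by
    rw [← hΦ]
    exact hEW p hpW u
  -- The sections `E u` and the standard frame agree only at the point `p`; that is enough because
  -- the bracket at a singular point depends only on values.
  have hbracket : ∀ u v, 𝒞.rep (A.bracket (E u) (E v)) 0 = A.bracketLin p u v := by
    intro u v
    have h1 : ∀ u, E u p = frame p u p := fun u => by
      have := (eventually_eq_frame p).self_of_nhds (E u)
      rwa [hE0 u] at this
    rw [← hp0, 𝒞.rep_φ _ hps, A.bracket_congr_of_isSingularAt hp (h1 u) (h1 v), hΦ]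
    rfl
  let R : F → H → H := fun u => 𝒞.tangent.rep fun x => A.anchor x (E u x)
  have hRd : ∀ u, DifferentiableAt ℝ (R u) 0 := fun u =>
    (𝒞.tangent.contDiffAt_rep h0t (A.anchor_section_smooth (E u) _)).differentiableAt (by simp)
  have hR1 : ∀ u, fderiv ℝ (R u) 0 = A.anchorLin p u := by
    intro u
    have h1 := 𝒞.tangent.fderiv_rep_eq_of_agree 𝒞₀.tangent hps hp₀
      (by
        ext v
        refine (𝒞₀.tangent_Φ_eq 𝒞 hp₀ hps v).trans ?_
        rw [hφ]
        rfl)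
      hφ (A.anchor_section_smooth (E u) p) (by simp [hp.1])
    have h2 := A.linPart_anchor hp (E u)
    rw [linPart_tangent_eq_fderiv_rep F V, hE0] at h2
    exact (congrArg (fderiv ℝ (R u)) hp0.symm).trans (h1.trans h2)
  have hRφ : ∀ u, ∀ x ∈ W, 𝒞.tangent.Φ x (A.anchor x (E u x)) = R u (𝒞.φ x) := fun u x hx =>
    (𝒞.tangent.rep_φ (fun x => A.anchor x (E u x)) hx.1).symm
  -- Using the same `u` in both slots isolates the anchor with one nonzero vector: the left side is
  -- linear in the coordinates, so a functional `ζ` with `ζ u = 1` shows that every component `ξ (R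
  -- u z)` is linear in `z`.
  have hRξ : ∀ u, ∀ ξ : H →L[ℝ] ℝ, ∀ x ∈ W, 𝒞.rep (A.bracket (E u) (fsmul (c ξ) (E u))) (𝒞.φ x) =
      ξ (𝒞.φ x) • A.bracketLin p u u + ξ (R u (𝒞.φ x)) • u := by
    intro u ξ x hx
    rw [𝒞.rep_φ _ hx.1, A.leibniz_right, map_add, map_smul, map_smul, hΓ x hx, hbracket,
      hcW x hx, hEW x hx, hd ξ x hx]
    congr 3
    exact hRφ u x hx
  have hR : ∀ x ∈ W, ∀ u, 𝒞.anchor A x u = A.anchorLin p u (𝒞.φ x) := by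
    intro x hx u
    have h1 : 𝒞.anchor A x u = R u (𝒞.φ x) := by
      rw [← hRφ u x hx, ← 𝒞.anchor_Φ A hx.1, hEW x hx]
    rcases eq_or_ne u 0 with rfl | hu
    · simp
    obtain ⟨ζ, hζ⟩ := SeparatingDual.exists_eq_one (R := ℝ) hu
    rw [h1, ← hR1]
    refine (SeparatingDual.eq_iff_forall_dual_eq (R := ℝ)).2 fun ξ => ?_
    refine apply_eq_fderiv_zero_of_eq_clm hB (hRd u) ξ
      (ζ ∘L fderiv ℝ (𝒞.rep (A.bracket (E u) (fsmul (c ξ) (E u)))) 0 -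
        ζ (A.bracketLin p u u) • ξ) (fun z hz => ?_) hx.2
    have h2 := hRξ u ξ _ (hBW z hz).1
    rw [(hBW z hz).2] at h2
    rw [sub_apply, ContinuousLinearMap.comp_apply, ← hlin _ (hlr ξ u u) z hz, h2]
    simp [hζ, mul_comm]
  refine 𝒞.locallyIsomorphic_model hW hWs hpW hp0 hEW A _ _ _
    (fun x hx u v => by rw [hΓ x hx, hbracket]) hR fun x hx ξ u v => ?_
  have hΨ : ∀ u, 𝒞.Ψ x u = E u x := fun u => by
    conv_lhs => rw [← hEW x hx u]
    exact 𝒞.left_inv x hx.1 _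
  have hdξ : d (c ξ) x = ξ ∘L mfderiv 𝓘(ℝ, H) 𝓘(ℝ, H) 𝒞.φ x :=
    ContinuousLinearMap.ext fun v => hd ξ x hx v
  let C : H → F := 𝒞.rep (A.coanchorSec (c ξ) (E u) (E v))
  have hC : 𝒞.coanchor A x ξ u v = C (𝒞.φ x) := by
    change _ = 𝒞.rep _ _
    rw [𝒞.rep_φ _ hx.1, A.coanchorSec_apply, hdξ, Coords.coanchor, hΨ, hΨ]
  have hCd : DifferentiableAt ℝ C 0 := (hrepB _ 0 h0B).differentiableAt (by simp)
  have hC1 : fderiv ℝ C 0 = A.coanchorLin p ξ u v := by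
    have h1 := 𝒞.fderiv_rep_eq_of_agree 𝒞₀ hps hp₀ hΦ hφ
      ((A.coanchorSec (c ξ) (E u) (E v)).contMDiff p) (A.coanchorSec_eq_zero hp _ _ _)
    have h2 := A.linPart_coanchorSec hp (c ξ) (E u) (E v)
    have h3 : fderiv ℝ (c ξ ∘ 𝒞₀.φ.symm) (𝒞₀.φ p) = ξ := by
      have h4 : c ξ ∘ 𝒞₀.φ.symm =ᶠ[𝓝 (𝒞₀.φ p)] fun z => ξ ((𝒞.φ ∘ 𝒞₀.φ.symm) z) := by
        filter_upwards [(𝒞₀.tendsto_symm hp₀).eventually (hW.mem_nhds hpW)] with z hz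
          using hcW _ hz ξ
      have h5 := ξ.hasFDerivAt.comp (𝒞₀.φ p)
        ((𝒞₀.contDiffAt_transition 𝒞 hp₀ hps).differentiableAt (by simp)).hasFDerivAt
      rw [hφ] at h5
      exact (h5.congr_of_eventuallyEq h4).fderiv
    rw [hE0, hE0, h3, linPart_eq_fderiv_rep] at h2
    exact (congrArg (fderiv ℝ C) hp0.symm).trans (h1.trans h2)
  rw [hC, ← hC1]
  refine apply_eq_fderiv_zero_of_eq_clm hB hCd (ContinuousLinearMap.id ℝ F)
    -- The left Leibniz rule is solved for the co-anchor: the bracket `[ξ e_u, e_v]` is linear by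
    -- homogeneity, `[e_u, e_v]` is constant, and the anchor is already known to be linear, so what
    -- remains is linear.
    (fderiv ℝ (𝒞.rep (A.bracket (fsmul (c ξ) (E u)) (E v))) 0 - ξ.smulRight (A.bracketLin p u v) +
      (ξ ∘L A.anchorLin p v).smulRight u) (fun z hz => ?_) hx.2
  obtain ⟨hzW, hzφ⟩ := hBW z hz
  have h1 : 𝒞.rep (A.bracket (fsmul (c ξ) (E u)) (E v)) z =
      ξ z • A.bracketLin p u v - ξ (A.anchorLin p v z) • u + C z := by
    change 𝒞.Φ _ (A.bracket (fsmul (c ξ) (E u)) (E v) (𝒞.φ.symm z)) = _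
    rw [A.leibniz_left, map_add, map_sub, map_smul, map_smul, hΓ _ hzW, hbracket, hcW _ hzW,
      hEW _ hzW, hd ξ _ hzW, ← 𝒞.anchor_Φ A hzW.1, hEW _ hzW, hR _ hzW, hzφ]
    rfl
  rw [add_apply, sub_apply, ← hlin _ (hll ξ u v) z hz, h1]
  simp only [ContinuousLinearMap.smulRight_apply, ContinuousLinearMap.comp_apply,
    ContinuousLinearMap.id_apply]
  abel

end Linearizability

end Loday

end

theorem mainTheorem3
    {H : Type*} [NormedAddCommGroup H] [NormedSpace ℝ H] [FiniteDimensional ℝ H]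
    {M : Type*} [TopologicalSpace M] [T2Space M] [ChartedSpace H M] [IsManifold 𝓘(ℝ, H) ∞ M]
    {F : Type*} [NormedAddCommGroup F] [NormedSpace ℝ F] [FiniteDimensional ℝ F]
    {V : M → Type*} [TopologicalSpace (TotalSpace F V)]
    [∀ x, AddCommGroup (V x)] [∀ x, Module ℝ (V x)] [∀ x, TopologicalSpace (V x)]
    [FiberBundle F V] [VectorBundle ℝ F V] [ContMDiffVectorBundle ∞ F V 𝓘(ℝ, H)]
    (A : Loday.AlmostLodayAlgebroid H F V) (hA : A.IsLoday)
    (p : M) (hp : A.IsSingularAt p) :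
    A.IsLinearizableAt p ↔
      ∃ D : Loday.Der H F V, D.IsEulerLikeAt p ∧
        ∃ U : Set M, IsOpen U ∧ p ∈ U ∧
          ∀ α β : Loday.Sec H F V, ∀ x ∈ U, A.lieDeriv D α β x = 0 :=
  ⟨fun h => Loday.exists_eulerLike_of_locallyIsomorphic_model A p _ _ _ h,
    fun ⟨_, hD, _, hU, hpU, hL⟩ => hp.isLinearizableAt hD hU hpU hL⟩
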